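/- Let $d\ge 5$, $\frac14<\alpha\le\frac13$ and $p\ge1$. **Setting.** For $n\in\mathbb Z^d$ put $|n|=\max(\max_j|n_j|,1)$. Let $\omega=(\omega_n)_{n\in\mathbb Z^d}\in\{\pm1\}^{\mathbb Z^d}$ be i.i.d. symmetric Bernoulli variables with law $\mathbb P$, and $\mathbb E_p|f|=(\mathbb E|f|^p)^{1/p}$. For $\kappa\ge0$ let $v_n=\kappa|n|^{-\alpha}$ and let $V$ be the diagonal matrix $V(n)=v_n\omega_n$; functions on $\mathbb Z^d$ are identified with diagonal matrices. With $\hat G_0(\xi)=\big(2d-2\sum_{j=1}^d\cos2\pi\xi_j\big)^{-1}$ on $\mathbb T^d=\mathbb R^d/\mathbb Z^d$, let $$G_0(n,n')=\int_{\mathbb T^d}e^{-2\pi i(n-n')\cdot\xi}\,\hat G_0(\xi)\,d\xi,\quad \sigma=G_0(0,0),\quad \rho=2\sigma^3-(\hat G_0*\hat G_0*\hat G_0)(0),\quad \widetilde{G_0}=G_0-\sigma I,$$ $$M(n_1,n_2)=\widetilde{G_0}(n_1,n_2)^3-(\sigma^3-\rho)\delta_{n_1,n_2},\qquad W=v^2Mv^2,\qquad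 D_4(n_1)=v_{n_1}^2\sum_{n_2}v_{n_2}^2\,\widetilde{G_0}(n_1,n_2)^4 .$$ A tuple $(m_1,\dots,m_s)$ of lattice points is *admissible* if there are no $1\le s_1<s_2\le s$ with $\mathbb P(\omega_{m_{s_1}}\omega_{m_{s_1+1}}\cdots\omega_{m_{s_2}}=1)=1$. For deterministic matrices $A_0,\dots,A_s$ and random diagonal matrices $U_j(n)=u_j(n)\omega_n$ with $u_j$ deterministic, $(A_0U_1A_1\cdots U_sA_s)^{(*)}(n,n')$ denotes the matrix product written as a sum over the intermediate indices $(m_1,\dots,m_s)$ and restricted to admissible tuples, taken as an unconditionally convergent sum in $L^2(\mathbb P)$ (for $s=1$ there is no restriction and the superscript is omitted). The remainder terms of order $0\le i\le5$ are $$[G_0,0]=G_0,\qquad [G_0,1]=-G_0VG_0,\qquad [G_0,2]=(G_0VG_0VG_0)^{(*)},$$ $$[G_0,3]=\sigma^2G_0v^2VG_0-(G_0VG_0VG_0VG_0)^{(*)},$$ $$[G_0,4]=-\sigma^2(G_0v^2VG_0VG_0)^{(*)}-\sigma^2(G_0VG_0v^2VG_0)^{(*)}+(G_0VG_0VG_0VG_0VG_0)^{(*)}+G_0WG_0,$$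 $$\begin{aligned}[G_0,5]={}&-2\sigma\rho\,G_0v^4VG_0+G_0VD_4G_0-G_0V\widetilde{G_0}WG_0-G_0W\widetilde{G_0}VG_0\\&+\sigma^2(G_0v^2VG_0VG_0VG_0)^{(*)}+\sigma^2(G_0VG_0v^2VG_0VG_0)^{(*)}+\sigma^2(G_0VG_0VG_0v^2VG_0)^{(*)}\\&-(G_0VG_0VG_0VG_0VG_0VG_0)^{(*)}.\end{aligned}$$ **Theorem.** For every $\kappa\ge0$, the series defining $D_4$ and the entries of $G_0WG_0$, $\widetilde{G_0}WG_0$ and $G_0W\widetilde{G_0}$ converge absolutely, and the entries of all the random terms above converge unconditionally in $L^2(\mathbb P)$. Moreover there is a constant $C>0$ depending only on $d,p,\alpha$ such that for all $\kappa\ge0$, all $0\le i\le5$ and all $n,n'\in\mathbb Z^d$, $$\mathbb E_p\big|[G_0,i](n,n')\big|\le C\,\kappa^i\,\frac{1}{(|n|\wedge|n'|)^{i\alpha}\,|n-n'|^{d-2}} .$$ -/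

import Mathlib

open MeasureTheory

noncomputable section

namespace DecayingBernoulli

/-! ### Lattice, free Green's function, constants -/

/-- The lattice `ℤ^d`. -/
abbrev Site (d : ℕ) : Type := Fin d → ℤ

/-- Infinite matrices indexed by `ℤ^d`, with real entries. -/
abbrev Kernel (d : ℕ) : Type := Site d → Site d → ℝ

/-- `|n| = max (max_i |n_i|) 1` (the norm on `Fin d → ℤ` is the sup norm), so `|0| = 1`. -/
def size {d : ℕ} (n : Site d) : ℝ := max ‖n‖ 1

/-- The function `1 / (2d - 2 ∑_j cos (2π ξ_j))` on the torus `ℝ^d / ℤ^d`, i.e. the symbol of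
`(-Δ)⁻¹`; here `fourier 1 (ξ j) = exp (2π i ξ_j)`. -/
def greenSymbol (d : ℕ) (ξ : UnitAddTorus (Fin d)) : ℝ :=
  1 / (2 * (d : ℝ) - 2 * ∑ j, (fourier 1 (ξ j) : ℂ).re)

/-- `G₀(n,n') = ∫ exp (-2π i (n-n')·ξ) / (2d - 2 ∑_j cos (2π ξ_j)) dξ` over the torus; the integral
is real since the symbol is even, and the real part only serves to view it in `ℝ`. -/
def G0 (d : ℕ) : Kernel d := fun n n' =>
  (UnitAddTorus.mFourierCoeff (fun ξ => (greenSymbol d ξ : ℂ)) (n - n')).re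

/-- `σ = G₀(0,0)`. -/
def sigma (d : ℕ) : ℝ := G0 d 0 0

/-- The normalized Haar measure `dξ` on the torus (the one used by `UnitAddTorus.mFourierCoeff`). -/
def torusMeasure (d : ℕ) : Measure (UnitAddTorus (Fin d)) :=
  Measure.pi fun _ => AddCircle.haarAddCircle

/-- `K̂ = Ĝ₀ * Ĝ₀ * Ĝ₀` (convolution on the torus). -/
def Khat (d : ℕ) : UnitAddTorus (Fin d) → ℝ :=
  convolution
    (convolution (greenSymbol d) (greenSymbol d) (ContinuousLinearMap.mul ℝ ℝ) (torusMeasure d))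
    (greenSymbol d) (ContinuousLinearMap.mul ℝ ℝ) (torusMeasure d)

/-- `ρ = 2σ³ - K̂(0)`. -/
def rho (d : ℕ) : ℝ := 2 * sigma d ^ 3 - Khat d 0

/-- The identity matrix on `ℤ^d`. -/
def idK (d : ℕ) : Kernel d := fun n n' => if n = n' then 1 else 0

/-- `G̃₀ = G₀ - σ·1`. -/
def G0t (d : ℕ) : Kernel d := fun n n' => G0 d n n' - sigma d * idK d n n'

/-- `M₄(n₁,n₂) = G̃₀(n₁,n₂)³`. -/
def M4 (d : ℕ) : Kernel d := fun n n' => G0t d n n' ^ 3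

/-- `M = M₄ - (σ³ - ρ)·1`. -/
def M (d : ℕ) : Kernel d := fun n n' => M4 d n n' - (sigma d ^ 3 - rho d) * idK d n n'

/-- `v_n = κ |n|^{-α}`. -/
def v {d : ℕ} (κ α : ℝ) (n : Site d) : ℝ := κ * size n ^ (-α)

/-- `W = v² M v²`. -/
def W (d : ℕ) (κ α : ℝ) : Kernel d := fun n n' => v κ α n ^ 2 * M d n n' * v κ α n' ^ 2

/-- `D₄(n₁) = v_{n₁}² ∑_{n₂} v_{n₂}² G̃₀(n₁,n₂)⁴`. -/
def D4 (d : ℕ) (κ α : ℝ) (n : Site d) : ℝ :=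
  v κ α n ^ 2 * ∑' m : Site d, v κ α m ^ 2 * G0t d n m ^ 4

/-- The matrix product `A B C`, as a sum over the two intermediate indices. -/
def mul3 {d : ℕ} (A B C : Kernel d) : Kernel d := fun n n' =>
  ∑' q : Site d × Site d, A n q.1 * B q.1 q.2 * C q.2 n'

/-- Absolute convergence of every entry of the product `A B C`. -/
def Mul3Summable {d : ℕ} (A B C : Kernel d) : Prop :=
  ∀ n n', Summable fun q : Site d × Site d => A n q.1 * B q.1 q.2 * C q.2 n'

/-! ### Randomness -/

/-- The sample space `{±1}^{ℤ^d}`. -/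
abbrev Sample (d : ℕ) : Type := Site d → ℤˣ

/-- The law of i.i.d. symmetric Bernoulli (`±1`) variables: the product of uniform measures. -/
def P (d : ℕ) : Measure (Sample d) :=
  Measure.infinitePi fun _ : Site d => (PMF.uniformOfFintype ℤˣ).toMeasure

instance (d : ℕ) : IsProbabilityMeasure (P d) := by
  unfold P; infer_instance

/-- The product `ω_{m_1} ⋯ ω_{m_s}` of a tuple of signs. -/
def signProd {d s : ℕ} (m : Fin s → Site d) (ω : Sample d) : ℝ :=
  ∏ j, (((ω (m j) : ℤˣ) : ℤ) : ℝ)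

/-- The randomness of the contiguous sub-tuple `(m_{s₁}, …, m_{s₂})` cancels:
`ℙ(ω_{m_{s₁}} ⋯ ω_{m_{s₂}} = 1) = 1`. -/
def Cancels {d s : ℕ} (m : Fin s → Site d) (s₁ s₂ : Fin s) : Prop :=
  P d {ω : Sample d | ∏ j ∈ Finset.Icc s₁ s₂, ω (m j) = 1} = 1

/-- A tuple is admissible if no contiguous sub-tuple of length at least two has its randomness
cancelled. -/
def Admissible {d s : ℕ} (m : Fin s → Site d) : Prop :=
  ∀ s₁ s₂ : Fin s, s₁ < s₂ → ¬ Cancels m s₁ s₂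

theorem measurable_sign {d : ℕ} (n : Site d) :
    Measurable fun ω : Sample d => (((ω n : ℤˣ) : ℤ) : ℝ) := by
  have h : Measurable fun u : ℤˣ => ((u : ℤ) : ℝ) :=
    (measurable_of_countable fun z : ℤ => (z : ℝ)).comp (comap_measurable _)
  exact h.comp (measurable_pi_apply n)

theorem abs_signProd {d s : ℕ} (m : Fin s → Site d) (ω : Sample d) : |signProd m ω| = 1 := by
  unfold signProd
  rw [Finset.abs_prod]
  refine Finset.prod_eq_one fun j _ => ?_
  rcases Int.units_eq_one_or (ω (m j)) with h | h <;> simp [h]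

theorem memLp_signProd {d s : ℕ} (m : Fin s → Site d) : MemLp (signProd m) 2 (P d) := by
  refine MemLp.of_bound (C := 1) ?_ (Filter.Eventually.of_forall fun ω => ?_)
  · exact (Finset.measurable_prod _ fun j _ => measurable_sign (m j)).aestronglyMeasurable
  · rw [Real.norm_eq_abs, abs_signProd]

/-! ### Admissible products and remainder terms -/

/-- The data of one random term `coef · (A₀ U₁ A₁ U₂ A₂ ⋯ U_s A_s)^{(*)}`, where the `A_j` are
deterministic matrices and `U_j` is the random diagonal matrix with entries `u_j(n) ω_n`
(indices of `u` start at `0`). -/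
structure RandomTerm (d : ℕ) where
  coef : ℝ
  s : ℕ
  A : Fin (s + 1) → Kernel d
  u : Fin s → Site d → ℝ

namespace RandomTerm

variable {d : ℕ}

/-- The deterministic weight of the tuple `m = (m_1, …, m_s)`:
`A₀(n,m_1) A₁(m_1,m_2) ⋯ A_s(m_s,n') · u_1(m_1) ⋯ u_s(m_s)`. -/
def weight (T : RandomTerm d) (n n' : Site d) (m : Fin T.s → Site d) : ℝ :=
  (∏ j : Fin (T.s + 1),
      T.A j ((Fin.cons n m : Fin (T.s + 1) → Site d) j)
        ((Fin.snoc m n' : Fin (T.s + 1) → Site d) j))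
    * ∏ j, T.u j (m j)

/-- The random variable contributed by the admissible tuple `m`, as an element of `L²(ℙ)`. -/
def summand (T : RandomTerm d) (n n' : Site d) (m : {m : Fin T.s → Site d // Admissible m}) :
    Lp ℝ 2 (P d) :=
  T.weight n n' m.1 • (memLp_signProd m.1).toLp (signProd m.1)

/-- The `(n,n')` entry of `coef · (A₀ U₁ A₁ ⋯ U_s A_s)^{(*)}`: the sum over admissible tuples,
as an unconditional sum in `L²(ℙ)`. -/
def value (T : RandomTerm d) (n n' : Site d) : Lp ℝ 2 (P d) :=
  T.coef • ∑' m, T.summand n n' m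

end RandomTerm

/-- The term `c · (G₀ U₁ G₀ U₂ ⋯ U_s G₀)^{(*)}` with `U_j = u_j ω`. -/
def chain {d : ℕ} (c : ℝ) {s : ℕ} (u : Fin s → Site d → ℝ) : RandomTerm d :=
  ⟨c, s, fun _ => G0 d, u⟩

/-- The random terms of exact order `i ≤ 5` in the renormalized resolvent expansion.
With `V = v ω`, one has `v² V = v³ ω` and `v⁴ V = v⁵ ω`. -/
def randomTerms (d : ℕ) (κ α : ℝ) : ℕ → List (RandomTerm d)
  | 1 => [chain (-1) ![v κ α]]
  | 2 => [chain 1 ![v κ α, v κ α]]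
  | 3 => [chain (sigma d ^ 2) ![fun n => v κ α n ^ 3],
          chain (-1) ![v κ α, v κ α, v κ α]]
  | 4 => [chain (-sigma d ^ 2) ![fun n => v κ α n ^ 3, v κ α],
          chain (-sigma d ^ 2) ![v κ α, fun n => v κ α n ^ 3],
          chain 1 ![v κ α, v κ α, v κ α, v κ α]]
  | 5 => [chain (-2 * sigma d * rho d) ![fun n => v κ α n ^ 5],
          chain 1 ![fun n => v κ α n * D4 d κ α n],
          ⟨-1, 1, ![G0 d, mul3 (G0t d) (W d κ α) (G0 d)], ![v κ α]⟩,
          ⟨-1, 1, ![mul3 (G0 d) (W d κ α) (G0t d), G0 d], ![v κ α]⟩,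
          chain (sigma d ^ 2) ![fun n => v κ α n ^ 3, v κ α, v κ α],
          chain (sigma d ^ 2) ![v κ α, fun n => v κ α n ^ 3, v κ α],
          chain (sigma d ^ 2) ![v κ α, v κ α, fun n => v κ α n ^ 3],
          chain (-1) ![v κ α, v κ α, v κ α, v κ α, v κ α]]
  | _ => []

/-- The non-random term of exact order `i ≤ 5`: `G₀` for `i = 0`, `G₀ W G₀` for `i = 4`. -/
def nonrandomTerm (d : ℕ) (κ α : ℝ) : ℕ → Kernel d
  | 0 => G0 d
  | 4 => mul3 (G0 d) (W d κ α) (G0 d)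
  | _ => fun _ _ => 0

/-- The entry `[G₀,i](n,n')` of the `i`-th order remainder term (`0 ≤ i ≤ 5`). -/
def remainder (d : ℕ) (κ α : ℝ) (i : ℕ) (n n' : Site d) : Lp ℝ 2 (P d) :=
  Lp.const 2 (P d) (nonrandomTerm d κ α i n n')
    + ((randomTerms d κ α i).map fun T => T.value n n').sum

end DecayingBernoulli

end

/-!
The bound has a deterministic and a probabilistic half; every estimate is expressed through
`modelKernel d β n n' = (|n| ∧ |n'|)^{-β} |n - n'|^{-(d-2)}`.

*Deterministic half.* Writing `G₀` as the time integral of a product of one-dimensional heat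
kernels, and bounding these by shifting contours, gives `|G₀(n,n')| ≲ |n - n'|^{-(d-2)}` and a
gradient that decays by one more power (`exists_abs_G0_le`, `exists_abs_G0_sub_le`). These bounds
alone do not control `G₀ W G₀`. The constant `ρ` is chosen so that every row of `M` sums to zero
(`hasSum_M`, by Parseval), hence a summation by parts (`tsum_eq_neg_half_differences`) replaces the
two outer factors by their differences, and `exists_abs_G0WG0_le` follows, the loss of locality being
paid by the decay `|·|^{-3(d-2)}` of `M`. The matrix `G̃₀ W G₀` and the diagonal `D₄` are then of the
size of `modelKernel d (4α)` and of `|·|^{-4α}`, so each random term of order `i` is a sum over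
admissible tuples `(m_1, …, m_s)`, `s ≤ 5`, of Walsh functions with coefficients bounded by
`κ^i` times the `pathWeight` of `n, m_1, …, m_s, n'` with exponent `i α ≤ d - 2`.

*Probabilistic half.* A polynomial of bounded degree in independent signs has all its `L^p` norms
dominated by its `L²` norm (`integral_pow_four_le`, iterated in `exists_eLpNorm_le`), so only second
moments matter. By orthogonality of the Walsh functions these are bounded by the sum of
`|c_m c_{m'}|` over pairs of tuples in which the same sites occur an odd number of times
(`exists_eLpNorm_tsum_walsh_le`). A site `x` between neighbours `l` and `r` is removed from a path at
the cost of a factor `bump l r x`, which is square summable in `x` exactly because `2 (d - 2) > d`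
(`greenDecay_mul_le`, `exists_tsum_bump_sq_le`); what is left once all sites are removed is
`modelKernel d (i α) n n'`. A site of multiplicity `k` yields `k` bumps provided no two of its copies
are adjacent when it is removed, and admissibility with `s ≤ 5` guarantees a suitable order of
removal (`Admissible.decomposable`). Sites of even multiplicity then carry at least two bumps and may
be summed freely, while those of odd multiplicity belong to the Walsh function and are summed in
`ℓ²`; this is `exists_tsum_pathWeight_mul_le`.
-/

namespace DecayingBernoulli

/-! ### Sums over the lattice -/

section Size

variable {d : ℕ}

theorem one_le_size (x : Site d) : 1 ≤ size x := le_max_right _ _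

theorem size_pos (x : Site d) : 0 < size x := zero_lt_one.trans_le (one_le_size x)

theorem norm_le_size (x : Site d) : ‖x‖ ≤ size x := le_max_left _ _

theorem size_neg (x : Site d) : size (-x) = size x := by simp [size]

theorem size_sub_comm (x y : Site d) : size (x - y) = size (y - x) := by
  rw [← size_neg, neg_sub]

theorem size_add_le (x y : Site d) : size (x + y) ≤ size x + size y := by
  refine max_le ((norm_add_le x y).trans (add_le_add (norm_le_size x) (norm_le_size y))) ?_
  linarith [one_le_size x, size_pos y]

theorem size_sub_le (x y z : Site d) : size (x - z) ≤ size (x - y) + size (y - z) := by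
  simpa using size_add_le (x - y) (y - z)

theorem size_le_sub (x y : Site d) : size x ≤ size (x - y) + size y := by
  simpa using size_add_le (x - y) y

theorem size_le_sub' (x y : Site d) : size y ≤ size (x - y) + size x := by
  have := size_le_sub y x
  rwa [size_sub_comm] at this

end Size

/-- A decreasing power changes by a bounded factor when its argument shrinks by a factor `c`. -/
theorem rpow_neg_le_of_le_mul {x y c a : ℝ} (hx : 0 < x) (hc : 0 < c) (ha : 0 ≤ a)
    (h : x ≤ c * y) : y ^ (-a) ≤ c ^ a * x ^ (-a) := by
  have hy : 0 < y := by
    by_contra hy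
    have : c * y ≤ 0 := mul_nonpos_of_nonneg_of_nonpos hc.le (not_lt.mp hy)
    linarith
  have h1 : (c * y) ^ (-a) ≤ x ^ (-a) := Real.rpow_le_rpow_of_nonpos hx h (by linarith)
  rw [Real.mul_rpow hc.le hy.le, Real.rpow_neg hc.le] at h1
  have h2 : 0 < c ^ a := Real.rpow_pos_of_pos hc a
  calc y ^ (-a) = c ^ a * ((c ^ a)⁻¹ * y ^ (-a)) := by field_simp
    _ ≤ _ := by gcongr

section Sums

variable (d : ℕ)

theorem tsum_ball_one_le (M : ℝ) (hM : 0 < M) :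
    ∑' q : Site d, ENNReal.ofReal (if size q ≤ M then 1 else 0)
      ≤ ENNReal.ofReal ((3 * M) ^ (d : ℝ)) := by
  by_cases h1 : 1 ≤ M
  · set k : ℤ := ⌊M⌋
    have hk : (k : ℝ) ≤ M := Int.floor_le M
    have hk0 : 0 ≤ k := Int.floor_nonneg.mpr hM.le
    set s : Finset (Site d) := Finset.Icc (fun _ => -k) (fun _ => k)
    have hs : ∀ q : Site d, q ∉ s → ENNReal.ofReal (if size q ≤ M then (1 : ℝ) else 0) = 0 := by
      intro q hq
      rw [if_neg]
      · simp
      · intro hqM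
        apply hq
        rw [Finset.mem_Icc]
        have : ∀ i, |q i| ≤ k := by
          intro i
          apply Int.le_floor.mpr
          have h2 := (norm_le_pi_norm q i).trans ((norm_le_size q).trans hqM)
          rw [Int.norm_eq_abs] at h2
          exact_mod_cast h2
        exact ⟨fun i => (abs_le.mp (this i)).1, fun i => (abs_le.mp (this i)).2⟩
    rw [tsum_eq_sum hs]
    have hcard : (s.card : ℝ) = (2 * (k : ℝ) + 1) ^ d := by
      rw [Pi.card_Icc]
      simp only [Int.card_Icc, Finset.prod_const, Finset.card_univ, Fintype.card_fin]
      push_cast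
      congr 1
      have : ((k + 1 - -k).toNat : ℤ) = 2 * k + 1 := by omega
      exact_mod_cast this
    calc ∑ q ∈ s, ENNReal.ofReal (if size q ≤ M then (1 : ℝ) else 0)
        ≤ ∑ q ∈ s, 1 := by
          refine Finset.sum_le_sum fun q _ => ?_
          split_ifs <;> simp
      _ = ENNReal.ofReal (s.card : ℝ) := by simp
      _ ≤ _ := by
          rw [hcard, Real.rpow_natCast]
          apply ENNReal.ofReal_le_ofReal
          gcongr
          linarith
  · have : ∀ q : Site d, ENNReal.ofReal (if size q ≤ M then (1 : ℝ) else 0) = 0 := by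
      intro q
      rw [if_neg (by linarith [one_le_size q])]
      simp
    simp [this]

theorem tsum_geometric_le {r K : ℝ} (hr : 0 ≤ r) (hr1 : r < 1) (hK : 0 ≤ K) :
    ∑' j : ℕ, ENNReal.ofReal (K * r ^ j) ≤ ENNReal.ofReal (K * (1 - r)⁻¹) := by
  rw [← ENNReal.ofReal_tsum_of_nonneg (fun j => by positivity)
    ((summable_geometric_of_lt_one hr hr1).mul_left K), tsum_mul_left,
    tsum_geometric_of_lt_one hr hr1]

theorem exists_tsum_ball_le {a : ℝ} (ha : 0 ≤ a) (had : a < d) :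
    ∃ C : ℝ, 0 < C ∧ ∀ M : ℝ, 0 < M →
      ∑' q : Site d, ENNReal.ofReal (if size q ≤ M then size q ^ (-a) else 0)
        ≤ ENNReal.ofReal (C * M ^ (d - a)) := by
  set r : ℝ := 2 ^ (-(d - a))
  have hr0 : 0 < r := by positivity
  have hr1 : r < 1 := Real.rpow_lt_one_of_one_lt_of_neg (by norm_num) (by linarith)
  refine ⟨2 ^ a * 3 ^ (d : ℝ) * (1 - r)⁻¹, by have := sub_pos.mpr hr1; positivity, ?_⟩
  intro M hM
  have key : ∀ q : Site d, ENNReal.ofReal (if size q ≤ M then size q ^ (-a) else 0) ≤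
      ∑' j : ℕ, ENNReal.ofReal (2 ^ a * (M / 2 ^ j) ^ (-a)) *
        ENNReal.ofReal (if size q ≤ M / 2 ^ j then 1 else 0) := by
    intro q
    split_ifs with hq
    · have hs := size_pos q
      obtain ⟨j, hj1, hj2⟩ := exists_nat_pow_near (x := M / size q) (y := 2)
        ((one_le_div hs).mpr hq) (by norm_num)
      have h2 : size q ≤ M / 2 ^ j := by
        rw [le_div_iff₀ hs] at hj1
        rw [le_div_iff₀ (by positivity)]; linarith
      refine le_trans ?_ (ENNReal.le_tsum j)
      rw [if_pos h2, ENNReal.ofReal_one, mul_one]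
      apply ENNReal.ofReal_le_ofReal
      refine rpow_neg_le_of_le_mul (by positivity) (by norm_num) ha ?_
      rw [div_lt_iff₀ hs] at hj2
      rw [div_le_iff₀ (by positivity)]
      rw [pow_succ] at hj2
      linarith
    · simp
  calc _ ≤ _ := ENNReal.tsum_le_tsum key
    _ = ∑' j : ℕ, ENNReal.ofReal (2 ^ a * (M / 2 ^ j) ^ (-a)) *
        ∑' q : Site d, ENNReal.ofReal (if size q ≤ M / 2 ^ j then 1 else 0) := by
        rw [ENNReal.tsum_comm]
        simp_rw [ENNReal.tsum_mul_left]
    _ ≤ ∑' j : ℕ, ENNReal.ofReal (2 ^ a * 3 ^ (d : ℝ) * M ^ (d - a) * r ^ j) := by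
        refine ENNReal.tsum_le_tsum fun j => ?_
        refine (mul_le_mul_right (tsum_ball_one_le d (M / 2 ^ j) (by positivity)) _).trans ?_
        rw [← ENNReal.ofReal_mul (by positivity)]
        apply le_of_eq
        congr 1
        have e1 : r ^ j = (2 ^ j) ^ (-(d - a)) := by
          rw [← Real.rpow_natCast, ← Real.rpow_mul (by norm_num), mul_comm,
            Real.rpow_mul (by norm_num), Real.rpow_natCast]
        have hj : (0 : ℝ) < 2 ^ j := by positivity
        rw [e1, Real.mul_rpow (by norm_num) (by positivity), Real.div_rpow hM.le hj.le,
          Real.div_rpow hM.le hj.le, Real.rpow_neg hj.le, Real.rpow_neg hj.le, sub_eq_add_neg,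
          Real.rpow_add hM, Real.rpow_add hj, Real.rpow_neg hj.le]
        have := Real.rpow_pos_of_pos hj a
        have := Real.rpow_pos_of_pos hj d
        field_simp
    _ ≤ _ := by
        refine (tsum_geometric_le hr0.le hr1 (by positivity)).trans ?_
        apply ENNReal.ofReal_le_ofReal
        apply le_of_eq; ring

theorem exists_tsum_tail_le {c : ℝ} (hcd : d < c) :
    ∃ C : ℝ, 0 < C ∧ ∀ M : ℝ, 0 < M →
      ∑' q : Site d, ENNReal.ofReal (if M < size q then size q ^ (-c) else 0)
        ≤ ENNReal.ofReal (C * M ^ (d - c)) := by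
  set r : ℝ := 2 ^ (d - c)
  have hc : 0 < c := lt_of_le_of_lt (Nat.cast_nonneg d) hcd
  have hr0 : 0 < r := by positivity
  have hr1 : r < 1 := Real.rpow_lt_one_of_one_lt_of_neg (by norm_num) (by linarith)
  refine ⟨6 ^ (d : ℝ) * (1 - r)⁻¹, by have := sub_pos.mpr hr1; positivity, ?_⟩
  intro M hM
  have key : ∀ q : Site d, ENNReal.ofReal (if M < size q then size q ^ (-c) else 0) ≤
      ∑' j : ℕ, ENNReal.ofReal ((2 ^ j * M) ^ (-c)) *
        ENNReal.ofReal (if size q ≤ 2 * (2 ^ j * M) then 1 else 0) := by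
    intro q
    split_ifs with hq
    · have hs := size_pos q
      obtain ⟨j, hj1, hj2⟩ := exists_nat_pow_near (x := size q / M) (y := 2)
        ((one_le_div hM).mpr hq.le) (by norm_num)
      rw [le_div_iff₀ hM] at hj1
      rw [div_lt_iff₀ hM, pow_succ] at hj2
      refine le_trans ?_ (ENNReal.le_tsum j)
      rw [if_pos (by linarith), ENNReal.ofReal_one, mul_one]
      apply ENNReal.ofReal_le_ofReal
      exact Real.rpow_le_rpow_of_nonpos (by positivity) hj1 (by linarith)
    · simp
  calc _ ≤ _ := ENNReal.tsum_le_tsum key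
    _ = ∑' j : ℕ, ENNReal.ofReal ((2 ^ j * M) ^ (-c)) *
        ∑' q : Site d, ENNReal.ofReal (if size q ≤ 2 * (2 ^ j * M) then 1 else 0) := by
        rw [ENNReal.tsum_comm]
        simp_rw [ENNReal.tsum_mul_left]
    _ ≤ ∑' j : ℕ, ENNReal.ofReal (6 ^ (d : ℝ) * M ^ (d - c) * r ^ j) := by
        refine ENNReal.tsum_le_tsum fun j => ?_
        refine (mul_le_mul_right (tsum_ball_one_le d (2 * (2 ^ j * M)) (by positivity)) _).trans ?_
        rw [← ENNReal.ofReal_mul (by positivity)]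
        apply le_of_eq
        congr 1
        have hj : (0 : ℝ) < 2 ^ j := by positivity
        have e1 : r ^ j = (2 ^ j) ^ (d - c) := by
          rw [← Real.rpow_natCast, ← Real.rpow_mul (by norm_num), mul_comm,
            Real.rpow_mul (by norm_num), Real.rpow_natCast]
        rw [e1, show 3 * (2 * (2 ^ j * M)) = 6 * (2 ^ j * M) by ring,
          Real.mul_rpow hj.le hM.le,
          Real.mul_rpow (x := 6) (by norm_num) (by positivity), Real.mul_rpow hj.le hM.le,
          sub_eq_add_neg, Real.rpow_add hM, Real.rpow_add hj]
        ring
    _ ≤ _ := by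
        refine (tsum_geometric_le hr0.le hr1 (by positivity)).trans ?_
        apply ENNReal.ofReal_le_ofReal
        apply le_of_eq; ring

theorem exists_tsum_size_rpow_le {c : ℝ} (hcd : d < c) :
    ∃ C : ℝ, 0 < C ∧ ∑' q : Site d, ENNReal.ofReal (size q ^ (-c)) ≤ ENNReal.ofReal C := by
  obtain ⟨C, hC, h⟩ := exists_tsum_tail_le d hcd
  refine ⟨C * (1 / 2) ^ (d - c), by positivity, le_trans ?_ (h (1 / 2) (by norm_num))⟩
  refine ENNReal.tsum_le_tsum fun q => ?_
  rw [if_pos (by linarith [one_le_size q])]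

variable {d} in
theorem tsum_sub_left (n : Site d) (f : Site d → ENNReal) : ∑' q, f (n - q) = ∑' q, f q :=
  (Equiv.subLeft n).tsum_eq f

variable {d} in
theorem tsum_sub_right (n : Site d) (f : Site d → ENNReal) : ∑' q, f (q - n) = ∑' q, f q :=
  (Equiv.subRight n).tsum_eq f

variable {d} in
theorem tsum_ofReal_mul_left {c : ℝ} (hc : 0 ≤ c) (f : Site d → ℝ) :
    ∑' q, ENNReal.ofReal (c * f q) = ENNReal.ofReal c * ∑' q, ENNReal.ofReal (f q) := by
  simp_rw [ENNReal.ofReal_mul hc, ENNReal.tsum_mul_left]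

/-- Convolution of two slowly decaying powers: the exponents `a, b < d` leave no divergence at the
two singularities, and `a + b > d` gives convergence at infinity. -/
theorem exists_tsum_conv_le {a b : ℝ} (ha : 0 ≤ a) (hb : 0 ≤ b) (had : a < d) (hbd : b < d)
    (hab : d < a + b) :
    ∃ C : ℝ, 0 < C ∧ ∀ n : Site d,
      ∑' q : Site d, ENNReal.ofReal (size q ^ (-a) * size (n - q) ^ (-b))
        ≤ ENNReal.ofReal (C * size n ^ (d - a - b)) := by
  obtain ⟨A, hA, hA'⟩ := exists_tsum_ball_le d ha had
  obtain ⟨B, hB, hB'⟩ := exists_tsum_ball_le d hb hbd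
  obtain ⟨T, hT, hT'⟩ := exists_tsum_tail_le d hab
  refine ⟨2 ^ b * A * 2 ^ (d - a) + 2 ^ a * B * 2 ^ (d - b) + 2 ^ b * T * 2 ^ (d - (a + b)),
    by positivity, fun n => ?_⟩
  set N := size n with hN
  have hN0 : 0 < N := size_pos n
  have key : ∀ q : Site d, ENNReal.ofReal (size q ^ (-a) * size (n - q) ^ (-b)) ≤
      ENNReal.ofReal ((2 ^ b * N ^ (-b)) * (if size q ≤ 2 * N then size q ^ (-a) else 0)) +
      ENNReal.ofReal ((2 ^ a * N ^ (-a)) *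
        (if size (n - q) ≤ 2 * N then size (n - q) ^ (-b) else 0)) +
      ENNReal.ofReal (2 ^ b * (if 2 * N < size q then size q ^ (-(a + b)) else 0)) := by
    intro q
    have hq := size_pos q
    have hnq := size_pos (n - q)
    have t1 := size_le_sub n q
    have t2 := size_le_sub' n q
    rw [← ENNReal.ofReal_add (by split_ifs <;> positivity) (by split_ifs <;> positivity),
      ← ENNReal.ofReal_add (by split_ifs <;> positivity) (by split_ifs <;> positivity)]
    apply ENNReal.ofReal_le_ofReal
    have hX : 0 ≤ (2 ^ b * N ^ (-b)) * (if size q ≤ 2 * N then size q ^ (-a) else 0) := by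
      split_ifs <;> positivity
    have hY : 0 ≤ (2 ^ a * N ^ (-a)) *
        (if size (n - q) ≤ 2 * N then size (n - q) ^ (-b) else 0) := by
      split_ifs <;> positivity
    have hZ : 0 ≤ 2 ^ b * (if 2 * N < size q then size q ^ (-(a + b)) else 0) := by
      split_ifs <;> positivity
    by_cases h1 : size q ≤ 2 * N
    · by_cases h2 : N ≤ 2 * size (n - q)
      · have := rpow_neg_le_of_le_mul hN0 (by norm_num) hb h2
        have := mul_le_mul_of_nonneg_left this (Real.rpow_nonneg hq.le (-a))
        rw [if_pos h1] at hX ⊢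
        linarith
      · have h3 : N ≤ 2 * size q := by linarith
        have := rpow_neg_le_of_le_mul hN0 (by norm_num) ha h3
        have := mul_le_mul_of_nonneg_right this (Real.rpow_nonneg hnq.le (-b))
        rw [if_pos (show size (n - q) ≤ 2 * N by linarith)] at hY ⊢
        linarith
    · have h3 : size q ≤ 2 * size (n - q) := by linarith
      have := rpow_neg_le_of_le_mul hq (by norm_num) hb h3
      have := mul_le_mul_of_nonneg_left this (Real.rpow_nonneg hq.le (-a))
      rw [if_pos (show 2 * N < size q by linarith), neg_add, Real.rpow_add hq] at hZ ⊢
      linarith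
  refine (ENNReal.tsum_le_tsum key).trans ?_
  rw [ENNReal.tsum_add, ENNReal.tsum_add,
    tsum_ofReal_mul_left (by positivity), tsum_ofReal_mul_left (by positivity),
    tsum_ofReal_mul_left (by positivity),
    tsum_sub_left n fun q => ENNReal.ofReal (if size q ≤ 2 * N then size q ^ (-b) else 0)]
  refine (add_le_add (add_le_add (mul_le_mul_right (hA' (2 * N) (by positivity)) _)
    (mul_le_mul_right (hB' (2 * N) (by positivity)) _))
    (mul_le_mul_right (hT' (2 * N) (by positivity)) _)).trans ?_
  rw [← ENNReal.ofReal_mul (by positivity), ← ENNReal.ofReal_mul (by positivity),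
    ← ENNReal.ofReal_mul (by positivity), ← ENNReal.ofReal_add (by positivity) (by positivity),
    ← ENNReal.ofReal_add (by positivity) (by positivity)]
  apply ENNReal.ofReal_le_ofReal
  apply le_of_eq
  rw [Real.mul_rpow (by norm_num) hN0.le, Real.mul_rpow (by norm_num) hN0.le,
    Real.mul_rpow (by norm_num) hN0.le]
  have e1 : N ^ (-b) * N ^ (d - a) = N ^ (d - a - b) := by
    rw [← Real.rpow_add hN0]; congr 1; ring
  have e2 : N ^ (-a) * N ^ (d - b) = N ^ (d - a - b) := by
    rw [← Real.rpow_add hN0]; congr 1; ring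
  have e3 : N ^ (d - (a + b)) = N ^ (d - a - b) := by congr 1; ring
  rw [e3]
  linear_combination (2 ^ b * A * 2 ^ (d - a)) * e1 + (2 ^ a * B * 2 ^ (d - b)) * e2

end Sums

theorem summable_of_tsum_ofReal_le {ι : Type*} {f : ι → ℝ} (hf : ∀ i, 0 ≤ f i) {B : ℝ}
    (h : ∑' i, ENNReal.ofReal (f i) ≤ ENNReal.ofReal B) : Summable f := by
  have h1 : ∑' i, ENNReal.ofReal (f i) ≠ ⊤ := ne_top_of_le_ne_top ENNReal.ofReal_ne_top h
  refine (ENNReal.summable_toReal h1).congr fun i => ?_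
  rw [ENNReal.toReal_ofReal (hf i)]

theorem tsum_le_of_tsum_ofReal_le {ι : Type*} {f : ι → ℝ} (hf : ∀ i, 0 ≤ f i) {B : ℝ}
    (hB : 0 ≤ B) (h : ∑' i, ENNReal.ofReal (f i) ≤ ENNReal.ofReal B) : ∑' i, f i ≤ B := by
  rwa [← ENNReal.ofReal_tsum_of_nonneg hf (summable_of_tsum_ofReal_le hf h),
    ENNReal.ofReal_le_ofReal_iff hB] at h

/-! ### The one-dimensional heat kernel -/

/-- The integrand of the heat kernel on `ℤ`, as an entire function of period one. -/
noncomputable def heatFun (t : ℝ) (k : ℤ) (z : ℂ) : ℂ :=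
  Complex.exp (-(2 * Real.pi * Complex.I * k * z) - 2 * t * (1 - Complex.cos (2 * Real.pi * z)))

/-- The heat kernel on `ℤ` at time `t`, as the Fourier coefficient of
`exp (-2t (1 - cos 2πx))`. -/
noncomputable def heat (t : ℝ) (k : ℤ) : ℂ := ∫ x in (-1 / 2 : ℝ)..(1 / 2), heatFun t k x

theorem differentiable_heatFun (t : ℝ) (k : ℤ) : Differentiable ℂ (heatFun t k) := by
  unfold heatFun
  fun_prop

theorem heatFun_add_one (t : ℝ) (k : ℤ) (z : ℂ) : heatFun t k (z + 1) = heatFun t k z := by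
  unfold heatFun
  rw [Complex.exp_eq_exp_iff_exists_int]
  refine ⟨-k, ?_⟩
  rw [mul_add (2 * (Real.pi : ℂ)) z 1, mul_one, Complex.cos_add_two_pi]
  push_cast
  ring

/-- By Cauchy's theorem and periodicity the heat kernel may be computed on any horizontal line. -/
theorem heat_eq_shift (t : ℝ) (k : ℤ) (η : ℝ) :
    heat t k = ∫ x in (-1 / 2 : ℝ)..(1 / 2), heatFun t k (x + η * Complex.I) := by
  have h := Complex.integral_boundary_rect_eq_zero_of_differentiableOn (heatFun t k)
    (((-1 / 2 : ℝ) : ℂ)) (((1 / 2 : ℝ) : ℂ) + η * Complex.I)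
    (differentiable_heatFun t k).differentiableOn
  simp only [Complex.ofReal_re, Complex.ofReal_im, Complex.add_re, Complex.add_im,
    Complex.mul_re, Complex.mul_im, Complex.I_re, Complex.I_im, mul_zero, mul_one, sub_zero,
    zero_add, add_zero, zero_mul, Complex.ofReal_zero] at h
  have hper : ∀ y : ℝ, heatFun t k (((1 / 2 : ℝ) : ℂ) + y * Complex.I) =
      heatFun t k (((-1 / 2 : ℝ) : ℂ) + y * Complex.I) := by
    intro y
    rw [← heatFun_add_one t k (((-1 / 2 : ℝ) : ℂ) + y * Complex.I)]
    congr 1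
    push_cast
    ring
  simp_rw [hper] at h
  rw [heat]
  linear_combination h

theorem re_heatFun_exponent (t : ℝ) (k : ℤ) (x l : ℝ) :
    (-(2 * Real.pi * Complex.I * k * (x + ((-l / (2 * Real.pi) : ℝ) : ℂ) * Complex.I)) - 2 * t *
      (1 - Complex.cos (2 * Real.pi * (x + ((-l / (2 * Real.pi) : ℝ) : ℂ) * Complex.I)))).re
      = -(k * l) - 2 * t * (1 - Real.cos (2 * Real.pi * x) * Real.cosh l) := by
  have hpi : (Real.pi : ℂ) ≠ 0 := by exact_mod_cast Real.pi_ne_zero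
  have e1 : 2 * (Real.pi : ℂ) * Complex.I * k * (x + ((-l / (2 * Real.pi) : ℝ) : ℂ) * Complex.I)
      = ((k * l : ℝ) : ℂ) + ((2 * Real.pi * k * x : ℝ) : ℂ) * Complex.I := by
    push_cast
    field_simp
    linear_combination (-(k : ℂ) * l) * Complex.I_sq
  have e2 : 2 * (Real.pi : ℂ) * (x + ((-l / (2 * Real.pi) : ℝ) : ℂ) * Complex.I)
      = ((2 * Real.pi * x : ℝ) : ℂ) + ((-l : ℝ) : ℂ) * Complex.I := by
    push_cast
    field_simp
  rw [e1, e2, Complex.cos_add_mul_I]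
  rw [← Complex.ofReal_cos, ← Complex.ofReal_cosh, ← Complex.ofReal_sin, ← Complex.ofReal_sinh]
  simp only [Complex.sub_re, Complex.neg_re, Complex.add_re, Complex.ofReal_re, Complex.mul_re,
    Complex.I_re, Complex.I_im, Complex.ofReal_im, Complex.one_re, Complex.re_ofNat,
    Complex.im_ofNat, Real.cosh_neg, Complex.mul_im, Complex.sub_im, Complex.one_im]
  ring

/-- The shift `l`, chosen to make the linear gain `k l` beat the quadratic loss `2 t l ^ 2`. -/
noncomputable def heatShift (t : ℝ) (k : ℤ) : ℝ := k / (4 * (t + |(k : ℝ)|))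

/-- The Gaussian exponent `k² / (t + |k|)`. -/
noncomputable def heatExp (t : ℝ) (k : ℤ) : ℝ := (k : ℝ) ^ 2 / (t + |(k : ℝ)|)

theorem heatExp_nonneg {t : ℝ} (ht : 0 < t) (k : ℤ) : 0 ≤ heatExp t k := by
  unfold heatExp; positivity

theorem abs_heatShift_le {t : ℝ} (ht : 0 < t) (k : ℤ) : |heatShift t k| ≤ 1 := by
  have h0 : 0 < 4 * (t + |(k : ℝ)|) := by positivity
  rw [heatShift, abs_div, abs_of_pos h0, div_le_one h0]
  linarith [abs_nonneg (k : ℝ)]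

theorem heatShift_gain {t : ℝ} (ht : 0 < t) (k : ℤ) :
    -(k * heatShift t k) + 2 * t * heatShift t k ^ 2 ≤ -(heatExp t k / 8) := by
  have h0 : 0 < t + |(k : ℝ)| := by positivity
  have : -(k * heatShift t k) + 2 * t * heatShift t k ^ 2 + heatExp t k / 8 =
      -((k : ℝ) ^ 2 * |(k : ℝ)|) / (8 * (t + |(k : ℝ)|) ^ 2) := by
    unfold heatShift heatExp
    field_simp
    ring
  have h2 : -((k : ℝ) ^ 2 * |(k : ℝ)|) / (8 * (t + |(k : ℝ)|) ^ 2) ≤ 0 :=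
    div_nonpos_of_nonpos_of_nonneg (by have := abs_nonneg (k : ℝ); nlinarith [sq_nonneg (k : ℝ)])
      (by positivity)
  linarith

theorem heatShift_sq_mul_le {t : ℝ} (ht : 0 < t) (k : ℤ) :
    heatShift t k ^ 2 * (1 + t) ≤ heatExp t k / 16 := by
  rcases eq_or_ne k 0 with rfl | hk
  · simp [heatShift, heatExp]
  have h0 : 0 < t + |(k : ℝ)| := by positivity
  have hk1 : (1 : ℝ) ≤ |(k : ℝ)| := by exact_mod_cast Int.one_le_abs hk
  have e : heatShift t k ^ 2 * (1 + t) = heatExp t k / 16 * ((1 + t) / (t + |(k : ℝ)|)) := by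
    unfold heatShift heatExp
    field_simp
    norm_num
  rw [e]
  refine mul_le_of_le_one_right (by have := heatExp_nonneg ht k; positivity) ?_
  rw [div_le_one h0]
  linarith

theorem norm_heatFun_shift_le {t : ℝ} (ht : 0 < t) (k : ℤ) {x : ℝ} (hx : |x| ≤ 1 / 2) :
    ‖heatFun t k (x + ((-heatShift t k / (2 * Real.pi) : ℝ) : ℂ) * Complex.I)‖ ≤
      Real.exp 4 * Real.exp (-(heatExp t k / 8)) * Real.exp (-(16 * (1 + t)) * x ^ 2) := by
  rw [heatFun, Complex.norm_exp, re_heatFun_exponent, ← Real.exp_add, ← Real.exp_add]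
  apply Real.exp_le_exp.mpr
  set l := heatShift t k
  have hl : |l| ≤ 1 := abs_heatShift_le ht k
  have hl2 : l ^ 2 ≤ 1 := by
    rw [← sq_abs]; exact pow_le_one₀ (abs_nonneg _) hl
  have hc : Real.cosh l ≤ 1 + l ^ 2 := by
    have h1 := Real.cosh_le_exp_half_sq l
    have h2 := Real.abs_exp_sub_one_le (x := l ^ 2 / 2)
      (by rw [abs_of_nonneg (by positivity)]; linarith)
    rw [abs_of_nonneg (a := l ^ 2 / 2) (by positivity)] at h2
    linarith [(abs_le.mp h2).2]
  have hc1 : 1 ≤ Real.cosh l := Real.one_le_cosh l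
  have hcos : Real.cos (2 * Real.pi * x) ≤ 1 - 8 * x ^ 2 := by
    have := Real.cos_le_one_sub_mul_cos_sq (x := 2 * Real.pi * x) (by
      rw [abs_mul, abs_of_pos (by positivity)]
      nlinarith [Real.pi_pos])
    have e : 2 / Real.pi ^ 2 * (2 * Real.pi * x) ^ 2 = 8 * x ^ 2 := by
      have := Real.pi_ne_zero
      field_simp
      ring
    linarith
  have hx2 : x ^ 2 ≤ 1 / 4 := by
    rw [← sq_abs]; nlinarith [abs_nonneg x]
  have hg := heatShift_gain ht k
  have h3 : (1 - Real.cos (2 * Real.pi * x)) * 1 ≤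
      (1 - Real.cos (2 * Real.pi * x)) * Real.cosh l :=
    mul_le_mul_of_nonneg_left hc1 (by nlinarith [sq_nonneg x])
  have h4 : 8 * x ^ 2 - l ^ 2 ≤ 1 - Real.cos (2 * Real.pi * x) * Real.cosh l := by linarith
  have h5 := mul_le_mul_of_nonneg_left h4 (show 0 ≤ 2 * t by linarith)
  linarith

theorem intervalIntegral_gaussian_le {b : ℝ} (hb : 0 < b) :
    ∫ x in (-1 / 2 : ℝ)..(1 / 2), Real.exp (-b * x ^ 2) ≤ √(Real.pi / b) := by
  rw [intervalIntegral.integral_of_le (by norm_num), ← integral_gaussian]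
  exact setIntegral_le_integral (integrable_exp_neg_mul_sq hb)
    (Filter.Eventually.of_forall fun x => (Real.exp_pos _).le)

theorem exists_norm_heat_le : ∃ C : ℝ, 0 < C ∧ ∀ t : ℝ, 0 < t → ∀ k : ℤ,
    ‖heat t k‖ ≤ C * (√(1 + t))⁻¹ * Real.exp (-(heatExp t k / 8)) := by
  refine ⟨Real.exp 4 * √(Real.pi / 16), by positivity, fun t ht k => ?_⟩
  rw [heat_eq_shift t k (-heatShift t k / (2 * Real.pi))]
  refine (intervalIntegral.norm_integral_le_of_norm_le (by norm_num)
    (Filter.Eventually.of_forall fun x hx => norm_heatFun_shift_le ht k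
      (abs_le.mpr ⟨by linarith [hx.1], by linarith [hx.2]⟩))
    ((by fun_prop : Continuous fun x : ℝ => Real.exp 4 * Real.exp (-(heatExp t k / 8)) *
      Real.exp (-(16 * (1 + t)) * x ^ 2)).intervalIntegrable _ _)).trans ?_
  rw [intervalIntegral.integral_const_mul]
  have h1 := intervalIntegral_gaussian_le (b := 16 * (1 + t)) (by positivity)
  have e : √(Real.pi / (16 * (1 + t))) = √(Real.pi / 16) * (√(1 + t))⁻¹ := by
    rw [← div_div, Real.sqrt_div (by positivity), div_eq_mul_inv]
  rw [e] at h1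
  calc _ ≤ Real.exp 4 * Real.exp (-(heatExp t k / 8)) * (√(Real.pi / 16) * (√(1 + t))⁻¹) := by
        gcongr
    _ = _ := by ring

theorem mul_exp_neg_half_le (y : ℝ) : √y * Real.exp (-(y / 2)) ≤ 1 := by
  rcases le_or_gt y 0 with h | h
  · rw [Real.sqrt_eq_zero_of_nonpos h]; simp
  have h1 : √y ≤ Real.exp (y / 2) := by
    have h2 := Real.add_one_le_exp (y / 2)
    have h3 : √y ≤ y / 2 + 1 := by nlinarith [Real.sq_sqrt h.le, sq_nonneg (√y - 1)]
    linarith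
  rw [Real.exp_neg, ← div_eq_mul_inv, div_le_one (Real.exp_pos _)]
  exact h1

/-- The discrete gradient of the heat kernel gains a factor `(1 + t) ^ (-1/2)`, at the price of half
of the Gaussian exponent. -/
theorem exists_norm_heat_sub_le : ∃ C : ℝ, 0 < C ∧ ∀ t : ℝ, 0 < t → ∀ k : ℤ,
    ‖heat t (k + 1) - heat t k‖ ≤ C * (1 + t)⁻¹ * Real.exp (-(heatExp t k / 16)) := by
  set K := Real.exp (Real.pi + 1)
  refine ⟨K * Real.exp 4 * (2 * Real.pi + 1) * (√(Real.pi / 8) + √(Real.pi / 16)), by positivity,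
    fun t ht k => ?_⟩
  set s := 1 + t with hs
  have hs0 : 0 < s := by positivity
  set l := heatShift t k with hl
  set η : ℝ := -heatShift t k / (2 * Real.pi) with hη
  have hl1 : |l| ≤ 1 := abs_heatShift_le ht k
  have hint : ∀ j : ℤ, IntervalIntegrable (fun x : ℝ => heatFun t j (x + η * Complex.I)) volume
      (-1 / 2) (1 / 2) := fun j => by
    apply Continuous.intervalIntegrable
    exact (differentiable_heatFun t j).continuous.comp (by fun_prop)
  rw [heat_eq_shift t k η, heat_eq_shift t (k + 1) η, ← intervalIntegral.integral_sub (hint _)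
    (hint _)]
  -- The pointwise bound on the shifted line.
  have hpt : ∀ x : ℝ, |x| ≤ 1 / 2 →
      ‖heatFun t (k + 1) (x + η * Complex.I) - heatFun t k (x + η * Complex.I)‖ ≤
        K * Real.exp 4 * Real.exp (-(heatExp t k / 8)) * (2 * Real.pi + 1) *
          ((√s)⁻¹ * Real.exp (-(8 * s) * x ^ 2) + |l| * Real.exp (-(16 * s) * x ^ 2)) := by
    intro x hx
    set w : ℂ := -(2 * Real.pi * Complex.I * (x + η * Complex.I)) with hw
    have e1 : heatFun t (k + 1) (x + η * Complex.I) - heatFun t k (x + η * Complex.I) =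
        heatFun t k (x + η * Complex.I) * (Complex.exp w - 1) := by
      rw [mul_sub, mul_one, heatFun, heatFun, ← Complex.exp_add]
      congr 2
      rw [hw]; push_cast; ring
    have hwn : ‖w‖ ≤ 2 * Real.pi * |x| + |l| := by
      have : w = ((-(2 * Real.pi * x) : ℝ) : ℂ) * Complex.I + ((-l : ℝ) : ℂ) := by
        rw [hw, hη]
        have hpi : (Real.pi : ℂ) ≠ 0 := by exact_mod_cast Real.pi_ne_zero
        push_cast
        field_simp
        linear_combination (heatShift t k : ℂ) * Complex.I_sq
      rw [this]
      refine (norm_add_le _ _).trans ?_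
      rw [norm_mul, Complex.norm_I, mul_one, Complex.norm_real, Complex.norm_real,
        Real.norm_eq_abs, Real.norm_eq_abs, abs_neg, abs_neg, abs_mul,
        abs_of_pos (by positivity : 0 < 2 * Real.pi)]
    have hexp : ‖Complex.exp w - 1‖ ≤ (2 * Real.pi * |x| + |l|) * K := by
      have h1 := Complex.norm_exp_sub_sum_le_norm_mul_exp w 1
      simp only [Finset.range_one, Finset.sum_singleton, pow_zero, Nat.factorial_zero,
        Nat.cast_one, div_one, pow_one] at h1
      refine h1.trans (mul_le_mul hwn (Real.exp_le_exp.mpr (hwn.trans ?_)) (Real.exp_pos _).le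
        (by positivity))
      nlinarith [Real.pi_pos]
    have hbase := norm_heatFun_shift_le ht k hx
    have hmom : |x| * Real.exp (-(16 * s) * x ^ 2) ≤ (√s)⁻¹ * Real.exp (-(8 * s) * x ^ 2) := by
      have h1 := mul_exp_neg_half_le (16 * s * x ^ 2)
      have e2 : √(16 * s * x ^ 2) = 4 * √s * |x| := by
        rw [Real.sqrt_mul (by positivity), Real.sqrt_sq_eq_abs, Real.sqrt_mul (by norm_num),
          show (16 : ℝ) = 4 ^ 2 by norm_num, Real.sqrt_sq (by norm_num)]
      rw [e2] at h1
      have e3 : Real.exp (-(16 * s) * x ^ 2) =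
          Real.exp (-(16 * s * x ^ 2 / 2)) * Real.exp (-(8 * s) * x ^ 2) := by
        rw [← Real.exp_add]; congr 1; ring
      have hss : 0 < √s := Real.sqrt_pos.mpr hs0
      rw [e3, ← mul_assoc]
      refine mul_le_mul_of_nonneg_right ?_ (Real.exp_pos _).le
      rw [← one_div, le_div_iff₀ hss]
      have := mul_nonneg (mul_nonneg hss.le (abs_nonneg x)) (Real.exp_pos (-(16 * s * x ^ 2 / 2))).le
      linarith
    have hG := Real.exp_pos (-(16 * s) * x ^ 2)
    have hG8 := Real.exp_pos (-(8 * s) * x ^ 2)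
    rw [e1, norm_mul]
    calc _ ≤ (Real.exp 4 * Real.exp (-(heatExp t k / 8)) * Real.exp (-(16 * s) * x ^ 2)) *
          ((2 * Real.pi * |x| + |l|) * K) := by gcongr
      _ = K * Real.exp 4 * Real.exp (-(heatExp t k / 8)) *
          (2 * Real.pi * (|x| * Real.exp (-(16 * s) * x ^ 2)) +
            |l| * Real.exp (-(16 * s) * x ^ 2)) := by ring
      _ ≤ K * Real.exp 4 * Real.exp (-(heatExp t k / 8)) *
          ((2 * Real.pi + 1) * ((√s)⁻¹ * Real.exp (-(8 * s) * x ^ 2)) +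
            (2 * Real.pi + 1) * (|l| * Real.exp (-(16 * s) * x ^ 2))) := by
          have := Real.pi_pos
          have h1 : 2 * Real.pi * (|x| * Real.exp (-(16 * s) * x ^ 2)) ≤
              (2 * Real.pi + 1) * ((√s)⁻¹ * Real.exp (-(8 * s) * x ^ 2)) :=
            mul_le_mul (by linarith) hmom (by positivity) (by positivity)
          have h2 : |l| * Real.exp (-(16 * s) * x ^ 2) ≤
              (2 * Real.pi + 1) * (|l| * Real.exp (-(16 * s) * x ^ 2)) :=
            le_mul_of_one_le_left (by positivity) (by linarith)
          gcongr
      _ = _ := by ring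
  refine (intervalIntegral.norm_integral_le_of_norm_le (by norm_num)
    (Filter.Eventually.of_forall fun x hx => hpt x
      (abs_le.mpr ⟨by linarith [hx.1], by linarith [hx.2]⟩))
    ((by fun_prop : Continuous fun x : ℝ => K * Real.exp 4 * Real.exp (-(heatExp t k / 8)) *
      (2 * Real.pi + 1) * ((√s)⁻¹ * Real.exp (-(8 * s) * x ^ 2) +
      |l| * Real.exp (-(16 * s) * x ^ 2))).intervalIntegrable _ _)).trans ?_
  rw [intervalIntegral.integral_const_mul, intervalIntegral.integral_add
    (Continuous.intervalIntegrable (by fun_prop) _ _)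
    (Continuous.intervalIntegrable (by fun_prop) _ _),
    intervalIntegral.integral_const_mul, intervalIntegral.integral_const_mul]
  have h8 := intervalIntegral_gaussian_le (b := 8 * s) (by positivity)
  have h16 := intervalIntegral_gaussian_le (b := 16 * s) (by positivity)
  have hss : 0 < √s := Real.sqrt_pos.mpr hs0
  have e8 : √(Real.pi / (8 * s)) = √(Real.pi / 8) * (√s)⁻¹ := by
    rw [← div_div, Real.sqrt_div (by positivity), div_eq_mul_inv]
  have e16 : √(Real.pi / (16 * s)) = √(Real.pi / 16) * (√s)⁻¹ := by
    rw [← div_div, Real.sqrt_div (by positivity), div_eq_mul_inv]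
  rw [e8] at h8
  rw [e16] at h16
  have hE : Real.exp (-(heatExp t k / 8)) =
      Real.exp (-(heatExp t k / 16)) * Real.exp (-(heatExp t k / 16)) := by
    rw [← Real.exp_add]; congr 1; ring
  have hE1 : Real.exp (-(heatExp t k / 16)) ≤ 1 :=
    Real.exp_le_one_iff.mpr (by have := heatExp_nonneg ht k; linarith)
  have hlE : |l| * Real.exp (-(heatExp t k / 16)) ≤ (√s)⁻¹ := by
    have h1 : |l| ≤ √(heatExp t k / 16) * (√s)⁻¹ := by
      rw [← div_eq_mul_inv, le_div_iff₀ hss, ← Real.sqrt_sq_eq_abs, ← Real.sqrt_mul (sq_nonneg l)]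
      exact Real.sqrt_le_sqrt (heatShift_sq_mul_le ht k)
    have h2 : √(heatExp t k / 16) * Real.exp (-(heatExp t k / 16)) ≤ 1 := by
      have := mul_exp_neg_half_le (heatExp t k / 16)
      refine le_trans (mul_le_mul_of_nonneg_left (Real.exp_le_exp.mpr ?_)
        (Real.sqrt_nonneg _)) this
      have := heatExp_nonneg ht k
      linarith
    calc |l| * Real.exp (-(heatExp t k / 16))
        ≤ √(heatExp t k / 16) * (√s)⁻¹ * Real.exp (-(heatExp t k / 16)) := by gcongr
      _ = √(heatExp t k / 16) * Real.exp (-(heatExp t k / 16)) * (√s)⁻¹ := by ring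
      _ ≤ 1 * (√s)⁻¹ := by gcongr
      _ = _ := one_mul _
  have hinv : (√s)⁻¹ * (√s)⁻¹ = s⁻¹ := by
    rw [← mul_inv, Real.mul_self_sqrt hs0.le]
  set E := Real.exp (-(heatExp t k / 16))
  have hE0 : 0 < E := Real.exp_pos _
  rw [hE]
  calc _ ≤ K * Real.exp 4 * (E * E) * (2 * Real.pi + 1) *
        ((√s)⁻¹ * (√(Real.pi / 8) * (√s)⁻¹) + |l| * (√(Real.pi / 16) * (√s)⁻¹)) := by
        gcongr
    _ = K * Real.exp 4 * E * (2 * Real.pi + 1) *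
        (E * (√(Real.pi / 8) * ((√s)⁻¹ * (√s)⁻¹)) + (|l| * E) * (√(Real.pi / 16) * (√s)⁻¹)) := by
        ring
    _ ≤ K * Real.exp 4 * E * (2 * Real.pi + 1) *
        (1 * (√(Real.pi / 8) * ((√s)⁻¹ * (√s)⁻¹)) + (√s)⁻¹ * (√(Real.pi / 16) * (√s)⁻¹)) := by
        gcongr
    _ = _ := by
        rw [← hinv]; ring

/-- Gaussian decay turned into power decay, uniformly in time. -/
theorem exists_heat_decay (m : ℕ) : ∃ C : ℝ, 0 < C ∧ ∀ t : ℝ, 0 < t → ∀ k : ℤ,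
    (√(1 + t))⁻¹ ^ m * Real.exp (-(heatExp t k / 16)) ≤ C * (max |(k : ℝ)| 1)⁻¹ ^ m := by
  refine ⟨(2 * (16 * (m + 1))) ^ m, by positivity, fun t ht k => ?_⟩
  set y := heatExp t k with hy
  have hy0 : 0 ≤ y := heatExp_nonneg ht k
  set κ := max |(k : ℝ)| 1 with hκ
  have hκ1 : 1 ≤ κ := le_max_right _ _
  have hs0 : 0 < √(1 + t) := Real.sqrt_pos.mpr (by linarith)
  have hm : (0 : ℝ) < m + 1 := by positivity
  -- Either `t ≥ |k|` and the exponent is `k² / t`, or `t < |k|` and it is comparable to `|k|`.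
  have h1 : κ ≤ 2 * ((1 + y) * √(1 + t)) := by
    rcases eq_or_ne k 0 with rfl | hk
    · have h2 : 1 ≤ √(1 + t) := Real.one_le_sqrt.mpr (by linarith)
      simp [hκ]
      nlinarith
    have hk1 : (1 : ℝ) ≤ |(k : ℝ)| := by exact_mod_cast Int.one_le_abs hk
    have hκk : κ = |(k : ℝ)| := max_eq_left hk1
    rw [hκk]
    apply abs_le_of_sq_le_sq' _ (by positivity) |>.2
    rw [mul_pow, mul_pow, Real.sq_sqrt (by linarith)]
    have hyk : y * (t + |(k : ℝ)|) = |(k : ℝ)| ^ 2 := by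
      rw [hy, heatExp, sq_abs]; field_simp
    set a := |(k : ℝ)|
    rcases le_total a t with h | h
    · have : a ^ 2 ≤ y * (2 * t) := by rw [← hyk]; gcongr; linarith
      nlinarith [mul_nonneg hy0 ht.le, sq_nonneg y, mul_nonneg (sq_nonneg y) ht.le]
    · have h3 : a ≤ 2 * y := by
        by_contra h4
        push Not at h4
        have : y * (t + a) ≤ y * (2 * a) := by gcongr; linarith
        nlinarith
      nlinarith [mul_nonneg hy0 ht.le, sq_nonneg y, mul_nonneg (sq_nonneg y) ht.le]
  have h2 : (1 + y) ^ m * Real.exp (-(y / 16)) ≤ (16 * (m + 1)) ^ m := by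
    have h3 : (1 + y) ≤ (16 * (m + 1)) * Real.exp (y / 16 / (m + 1)) := by
      have h4 := Real.add_one_le_exp (y / 16 / (m + 1))
      have h5 : (16 * ((m : ℝ) + 1)) * (y / 16 / (m + 1) + 1) = y + 16 * (m + 1) := by
        field_simp
      have h6 := mul_le_mul_of_nonneg_left h4 (show 0 ≤ 16 * ((m : ℝ) + 1) by positivity)
      have : (0 : ℝ) ≤ m := Nat.cast_nonneg m
      linarith
    have h7 : (1 + y) ^ m ≤ (16 * (m + 1)) ^ m * Real.exp (y / 16) := by
      refine (pow_le_pow_left₀ (by positivity) h3 m).trans ?_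
      rw [mul_pow, ← Real.exp_nat_mul]
      gcongr
      rw [mul_div_assoc', div_le_iff₀ hm]
      nlinarith
    rw [Real.exp_neg, ← div_eq_mul_inv, div_le_iff₀ (Real.exp_pos _)]
    exact h7
  have h8 : (√(1 + t))⁻¹ ≤ 2 * (1 + y) * κ⁻¹ := by
    rw [inv_eq_one_div, ← div_eq_mul_inv, div_le_div_iff₀ hs0 (by linarith)]
    linarith
  calc _ ≤ (2 * (1 + y) * κ⁻¹) ^ m * Real.exp (-(y / 16)) := by gcongr
    _ = 2 ^ m * κ⁻¹ ^ m * ((1 + y) ^ m * Real.exp (-(y / 16))) := by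
        rw [mul_pow, mul_pow 2 (1 + y)]
        ring
    _ ≤ 2 ^ m * κ⁻¹ ^ m * (16 * (m + 1)) ^ m := by gcongr
    _ = _ := by
        rw [mul_pow 2 (16 * ((m : ℝ) + 1)) m]
        generalize (16 * ((m : ℝ) + 1)) ^ m = z
        ring

/-! ### The heat kernel on the lattice -/

section HeatKernel

variable {d : ℕ}

instance (d : ℕ) : IsProbabilityMeasure (torusMeasure d) := by
  unfold torusMeasure; infer_instance

/-- The symbol of the lattice Laplacian. -/
noncomputable def laplaceSymbol (d : ℕ) (ξ : UnitAddTorus (Fin d)) : ℝ :=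
  ∑ j, 2 * (1 - (fourier 1 (ξ j) : ℂ).re)

theorem greenSymbol_eq (ξ : UnitAddTorus (Fin d)) :
    greenSymbol d ξ = 1 / laplaceSymbol d ξ := by
  rw [greenSymbol, laplaceSymbol, ← Finset.mul_sum, Finset.sum_sub_distrib]
  simp [mul_sub]

theorem norm_fourier_apply (k : ℤ) (θ : UnitAddCircle) : ‖(fourier k θ : ℂ)‖ = 1 := by
  rw [fourier_apply]
  exact Circle.norm_coe _

theorem fourier_re_le_one (θ : UnitAddCircle) : (fourier 1 θ : ℂ).re ≤ 1 := by
  exact (Complex.re_le_norm _).trans (norm_fourier_apply _ _).le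

theorem laplaceSymbol_nonneg (ξ : UnitAddTorus (Fin d)) : 0 ≤ laplaceSymbol d ξ :=
  Finset.sum_nonneg fun j _ => by linarith [fourier_re_le_one (ξ j)]

theorem continuous_laplaceSymbol : Continuous (laplaceSymbol d) := by
  unfold laplaceSymbol
  refine continuous_finsetSum _ fun j _ => ?_
  have : Continuous fun ξ : UnitAddTorus (Fin d) => (fourier 1 (ξ j) : ℂ) :=
    (fourier 1).continuous.comp (continuous_apply j)
  exact continuous_const.mul (continuous_const.sub (Complex.continuous_re.comp this))

theorem integral_circle_heat (t : ℝ) (k : ℤ) :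
    ∫ θ : UnitAddCircle, fourier (-k) θ *
      ((Real.exp (-(t * (2 * (1 - (fourier 1 θ : ℂ).re)))) : ℝ) : ℂ) ∂AddCircle.haarAddCircle
      = heat t k := by
  have h := fourierCoeff_eq_intervalIntegral (T := 1)
    (fun θ : UnitAddCircle => ((Real.exp (-(t * (2 * (1 - (fourier 1 θ : ℂ).re)))) : ℝ) : ℂ)) k
    (-1 / 2)
  rw [fourierCoeff] at h
  simp only [smul_eq_mul] at h
  rw [h, heat, one_div, inv_one, one_smul, show (-1 / 2 : ℝ) + 1 = 1 / 2 by norm_num]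
  refine intervalIntegral.integral_congr fun x _ => ?_
  rw [fourier_coe_apply, fourier_coe_apply, heatFun]
  have e : (Complex.exp (2 * Real.pi * Complex.I * (1 : ℤ) * x / (1 : ℝ))).re =
      Real.cos (2 * Real.pi * x) := by
    rw [show (2 * Real.pi * Complex.I * (1 : ℤ) * x / (1 : ℝ) : ℂ) =
      ((2 * Real.pi * x : ℝ) : ℂ) * Complex.I by push_cast; ring, Complex.exp_ofReal_mul_I_re]
  rw [e, Complex.ofReal_exp, ← Complex.exp_add]
  congr 1
  push_cast
  ring

/-- The heat kernel on `ℤ^d` is the product of one-dimensional ones. -/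
noncomputable def heatProd (t : ℝ) (n : Site d) : ℂ := ∏ j, heat t (n j)

theorem integral_torus_heat (t : ℝ) (n : Site d) :
    ∫ ξ, UnitAddTorus.mFourier (-n) ξ * ((Real.exp (-(t * laplaceSymbol d ξ)) : ℝ) : ℂ)
      ∂torusMeasure d = heatProd t n := by
  have h := integral_fintype_prod_eq_prod (μ := fun _ : Fin d => AddCircle.haarAddCircle (T := 1))
    (fun j (θ : UnitAddCircle) => (fourier (-(n j)) θ *
      ((Real.exp (-(t * (2 * (1 - (fourier 1 θ : ℂ).re)))) : ℝ) : ℂ) : ℂ))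
  simp only [integral_circle_heat] at h
  rw [heatProd, ← h, torusMeasure]
  refine integral_congr_ae (Filter.Eventually.of_forall fun ξ => ?_)
  simp only [Finset.prod_mul_distrib]
  congr 1
  rw [← Complex.ofReal_prod, ← Real.exp_sum, laplaceSymbol, Finset.mul_sum, Finset.sum_neg_distrib]

theorem integral_torus_exp (t : ℝ) :
    ((∫ ξ, Real.exp (-(t * laplaceSymbol d ξ)) ∂torusMeasure d : ℝ) : ℂ)
      = heatProd t (0 : Site d) := by
  rw [← integral_torus_heat, ← integral_complex_ofReal]
  simp [UnitAddTorus.mFourier_zero]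

theorem exists_size_eq (hd : 0 < d) (n : Site d) : ∃ i, size n = max |(n i : ℝ)| 1 := by
  have : Nonempty (Fin d) := ⟨⟨0, hd⟩⟩
  obtain ⟨i, hi⟩ := Finite.exists_max (fun i => ‖n i‖)
  refine ⟨i, ?_⟩
  have : ‖n‖ = ‖n i‖ := le_antisymm ((pi_norm_le_iff_of_nonneg (norm_nonneg _)).mpr hi)
    (norm_le_pi_norm n i)
  rw [size, this, Int.norm_eq_abs]

theorem pow_le_of_two_bounds {X C κ t : ℝ} {m : ℕ} (hC : 0 ≤ C) (ht : 0 < t) (hκ : 1 ≤ κ)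
    (h1 : X ≤ C * κ⁻¹ ^ m) (h2 : X ≤ C * (√(1 + t))⁻¹ ^ m) :
    X ≤ C * 2 ^ m * (t + κ ^ 2) ^ (-(m / 2 : ℝ)) := by
  have hs : 0 < √(t + κ ^ 2) := Real.sqrt_pos.mpr (by positivity)
  have hs1 : 0 < √(1 + t) := Real.sqrt_pos.mpr (by positivity)
  have e : (t + κ ^ 2) ^ (-(m / 2 : ℝ)) = (√(t + κ ^ 2))⁻¹ ^ m := by
    have hx : 0 < t + κ ^ 2 := by positivity
    generalize t + κ ^ 2 = x at hx
    rw [Real.sqrt_eq_rpow, ← Real.rpow_neg hx.le, ← Real.rpow_natCast,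
      ← Real.rpow_mul hx.le]
    congr 1; ring
  rw [e]
  have key : ∀ y : ℝ, 0 < y → √(t + κ ^ 2) ≤ 2 * y → C * y⁻¹ ^ m ≤
      C * 2 ^ m * (√(t + κ ^ 2))⁻¹ ^ m := by
    intro y hy h
    rw [mul_assoc, ← mul_pow]
    gcongr
    rw [← div_eq_mul_inv, inv_eq_one_div, div_le_div_iff₀ hy hs]
    linarith
  rcases le_total (t) (κ ^ 2) with h | h
  · refine h1.trans (key κ (by linarith) ?_)
    rw [Real.sqrt_le_left (by positivity)]
    nlinarith
  · refine h2.trans (key _ hs1 ?_)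
    rw [Real.sqrt_le_left (by positivity), mul_pow, Real.sq_sqrt (by positivity)]
    linarith

theorem prod_exp_le (t : ℝ) (ht : 0 < t) (n : Site d) (i : Fin d) :
    ∏ j, Real.exp (-(heatExp t (n j) / 16)) ≤ Real.exp (-(heatExp t (n i) / 16)) := by
  rw [← Finset.mul_prod_erase _ _ (Finset.mem_univ i)]
  refine mul_le_of_le_one_right (Real.exp_pos _).le
    (Finset.prod_le_one (fun j _ => (Real.exp_pos _).le) fun j _ => ?_)
  exact Real.exp_le_one_iff.mpr (by have := heatExp_nonneg ht (n j); linarith)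

theorem prod_exp_le_one (t : ℝ) (ht : 0 < t) (n : Site d) :
    ∏ j, Real.exp (-(heatExp t (n j) / 16)) ≤ 1 :=
  Finset.prod_le_one (fun j _ => (Real.exp_pos _).le) fun j _ =>
    Real.exp_le_one_iff.mpr (by have := heatExp_nonneg ht (n j); linarith)

/-- A multiple of `(1 + t) ^ (-m/2)` times the Gaussian factors has the parabolic decay
`(t + |n|²) ^ (-m/2)`. -/
theorem exists_parabolic_decay (hd : 0 < d) (m : ℕ) {K : ℝ} (hK : 0 < K) :
    ∃ C : ℝ, 0 < C ∧ ∀ t : ℝ, 0 < t → ∀ (n : Site d) (X : ℝ),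
      X ≤ K * (√(1 + t))⁻¹ ^ m * ∏ j, Real.exp (-(heatExp t (n j) / 16)) →
      X ≤ C * (t + size n ^ 2) ^ (-(m / 2 : ℝ)) := by
  obtain ⟨C, hC, h⟩ := exists_heat_decay m
  refine ⟨K * (C + 1) * 2 ^ m, by positivity, fun t ht n X hX => ?_⟩
  obtain ⟨i, hi⟩ := exists_size_eq hd n
  have hs1 : 0 < √(1 + t) := Real.sqrt_pos.mpr (by positivity)
  refine pow_le_of_two_bounds (by positivity) ht (one_le_size n) ?_ ?_
  · calc X ≤ _ := hX
      _ ≤ K * (√(1 + t))⁻¹ ^ m * Real.exp (-(heatExp t (n i) / 16)) := by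
          gcongr; exact prod_exp_le t ht n i
      _ = K * ((√(1 + t))⁻¹ ^ m * Real.exp (-(heatExp t (n i) / 16))) := by ring
      _ ≤ K * (C * (size n)⁻¹ ^ m) := by
          rw [hi]
          exact mul_le_mul_of_nonneg_left (h t ht (n i)) hK.le
      _ ≤ K * ((C + 1) * (size n)⁻¹ ^ m) := by
          have := size_pos n
          gcongr
          linarith
      _ = _ := by ring
  · calc X ≤ _ := hX
      _ ≤ K * (√(1 + t))⁻¹ ^ m * 1 := by
          gcongr; exact prod_exp_le_one t ht n
      _ = K * 1 * (√(1 + t))⁻¹ ^ m := by ring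
      _ ≤ _ := by gcongr; linarith

theorem exists_norm_heatProd_le_gauss (d : ℕ) : ∃ K : ℝ, 0 < K ∧ ∀ t : ℝ, 0 < t → ∀ n : Site d,
    ‖heatProd t n‖ ≤ K * (√(1 + t))⁻¹ ^ d * ∏ j, Real.exp (-(heatExp t (n j) / 16)) := by
  obtain ⟨A, hA, hA'⟩ := exists_norm_heat_le
  refine ⟨A ^ d, by positivity, fun t ht n => ?_⟩
  rw [heatProd, norm_prod]
  calc ∏ j, ‖heat t (n j)‖ ≤ ∏ j : Fin d, A * (√(1 + t))⁻¹ * Real.exp (-(heatExp t (n j) / 16)) := by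
        refine Finset.prod_le_prod (fun _ _ => norm_nonneg _) fun j _ => (hA' t ht (n j)).trans ?_
        have := heatExp_nonneg ht (n j)
        gcongr
        norm_num
    _ = _ := by
        rw [Finset.prod_mul_distrib, Finset.prod_const, Finset.card_univ, Fintype.card_fin, mul_pow]

theorem exists_norm_heatProd_sub_le_gauss (d : ℕ) :
    ∃ K : ℝ, 0 < K ∧ ∀ t : ℝ, 0 < t → ∀ (n : Site d) (i : Fin d),
    ‖heatProd t (n + Pi.single i 1) - heatProd t n‖ ≤
      K * (√(1 + t))⁻¹ ^ (d + 1) * ∏ j, Real.exp (-(heatExp t (n j) / 16)) := by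
  obtain ⟨A, hA, hA'⟩ := exists_norm_heat_le
  obtain ⟨B, hB, hB'⟩ := exists_norm_heat_sub_le
  refine ⟨B * (A + 1) ^ d, by positivity, fun t ht n i => ?_⟩
  have hs0 : 0 < √(1 + t) := Real.sqrt_pos.mpr (by positivity)
  have e1 : heatProd t (n + Pi.single i 1) - heatProd t n =
      (heat t (n i + 1) - heat t (n i)) * ∏ j ∈ Finset.univ.erase i, heat t (n j) := by
    rw [heatProd, heatProd, ← Finset.mul_prod_erase _ _ (Finset.mem_univ i),
      ← Finset.mul_prod_erase _ (fun j => heat t (n j)) (Finset.mem_univ i), sub_mul]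
    congr 2
    · simp
    · refine Finset.prod_congr rfl fun j hj => ?_
      simp [Finset.ne_of_mem_erase hj]
  have hs : (1 + t)⁻¹ = (√(1 + t))⁻¹ ^ 2 := by
    rw [inv_pow, Real.sq_sqrt (by positivity)]
  have hd : 0 < d := i.pos
  have hcard : (Finset.univ.erase i).card = d - 1 := by
    rw [Finset.card_erase_of_mem (Finset.mem_univ i), Finset.card_univ, Fintype.card_fin]
  rw [e1, norm_mul, norm_prod, ← Finset.mul_prod_erase _ _ (Finset.mem_univ i)]
  calc _ ≤ (B * (1 + t)⁻¹ * Real.exp (-(heatExp t (n i) / 16))) *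
        ∏ j ∈ Finset.univ.erase i, A * (√(1 + t))⁻¹ * Real.exp (-(heatExp t (n j) / 16)) := by
        refine mul_le_mul (hB' t ht (n i)) (Finset.prod_le_prod (fun _ _ => norm_nonneg _)
          fun j _ => (hA' t ht (n j)).trans ?_) (Finset.prod_nonneg fun _ _ => norm_nonneg _)
          (by positivity)
        have := heatExp_nonneg ht (n j)
        gcongr
        norm_num
    _ = B * A ^ (d - 1) * (√(1 + t))⁻¹ ^ (2 + (d - 1)) * (Real.exp (-(heatExp t (n i) / 16)) *
        ∏ j ∈ Finset.univ.erase i, Real.exp (-(heatExp t (n j) / 16))) := by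
        rw [Finset.prod_mul_distrib, Finset.prod_const, hcard, mul_pow, hs, pow_add]
        ring
    _ ≤ _ := by
        rw [show 2 + (d - 1) = d + 1 by omega]
        have : 0 ≤ ∏ j ∈ Finset.univ.erase i, Real.exp (-(heatExp t (n j) / 16)) :=
          Finset.prod_nonneg fun _ _ => (Real.exp_pos _).le
        gcongr
        calc A ^ (d - 1) ≤ (A + 1) ^ (d - 1) := by gcongr; linarith
          _ ≤ (A + 1) ^ d := pow_le_pow_right₀ (by linarith) (by omega)

theorem exists_norm_heatProd_le (hd : 0 < d) : ∃ C : ℝ, 0 < C ∧ ∀ t : ℝ, 0 < t → ∀ n : Site d,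
    ‖heatProd t n‖ ≤ C * (t + size n ^ 2) ^ (-(d / 2 : ℝ)) := by
  obtain ⟨K, hK, h⟩ := exists_norm_heatProd_le_gauss d
  obtain ⟨C, hC, h'⟩ := exists_parabolic_decay hd d hK
  exact ⟨C, hC, fun t ht n => h' t ht n _ (h t ht n)⟩

theorem exists_norm_heatProd_sub_le (hd : 0 < d) :
    ∃ C : ℝ, 0 < C ∧ ∀ t : ℝ, 0 < t → ∀ (n : Site d) (i : Fin d),
    ‖heatProd t (n + Pi.single i 1) - heatProd t n‖ ≤
      C * (t + size n ^ 2) ^ (-((d + 1) / 2 : ℝ)) := by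
  obtain ⟨K, hK, h⟩ := exists_norm_heatProd_sub_le_gauss d
  obtain ⟨C, hC, h'⟩ := exists_parabolic_decay hd (d + 1) hK
  refine ⟨C, hC, fun t ht n i => ?_⟩
  have := h' t ht n _ (h t ht n i)
  push_cast at this
  exact this

theorem integral_Ioi_add_rpow {a m : ℝ} (ha : a < -1) (hm : 0 < m) :
    ∫ t in Set.Ioi (0 : ℝ), (t + m) ^ a = m ^ (a + 1) * (-(a + 1))⁻¹ := by
  have h := integral_Ioi_rpow_of_lt ha hm
  have h2 := (measurePreserving_add_right volume m).setIntegral_preimage_emb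
    (measurableEmbedding_addRight m) (fun t => t ^ a) (Set.Ioi m)
  rw [h] at h2
  have e : (fun x => x + m) ⁻¹' Set.Ioi m = Set.Ioi (0 : ℝ) := by
    ext x; simp
  rw [e] at h2
  rw [h2]
  have : a + 1 ≠ 0 := by linarith
  field_simp

/-! ### The free Green's function -/

theorem integrable_heat_prod (hd : 0 < d) (n : Site d) {w : ℝ → ℝ} (hw : Continuous w)
    (hi : IntegrableOn (fun t => |w t| * (t + 1) ^ (-(d / 2 : ℝ))) (Set.Ioi 0)) :
    Integrable (Function.uncurry fun (ξ : UnitAddTorus (Fin d)) (t : ℝ) =>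
      UnitAddTorus.mFourier (-n) ξ * ((w t * Real.exp (-(t * laplaceSymbol d ξ)) : ℝ) : ℂ))
      ((torusMeasure d).prod (volume.restrict (Set.Ioi 0))) := by
  have hcont : Continuous (Function.uncurry fun (ξ : UnitAddTorus (Fin d)) (t : ℝ) =>
      UnitAddTorus.mFourier (-n) ξ * ((w t * Real.exp (-(t * laplaceSymbol d ξ)) : ℝ) : ℂ)) := by
    have h1 : Continuous fun p : UnitAddTorus (Fin d) × ℝ => laplaceSymbol d p.1 :=
      continuous_laplaceSymbol.comp continuous_fst
    have h2 : Continuous fun p : UnitAddTorus (Fin d) × ℝ => UnitAddTorus.mFourier (-n) p.1 :=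
      (UnitAddTorus.mFourier (-n)).continuous.comp continuous_fst
    exact h2.mul (Complex.continuous_ofReal.comp ((hw.comp continuous_snd).mul
      (Real.continuous_exp.comp (continuous_snd.mul h1).neg)))
  have hnorm : ∀ (ξ : UnitAddTorus (Fin d)) (t : ℝ), ‖UnitAddTorus.mFourier (-n) ξ *
      ((w t * Real.exp (-(t * laplaceSymbol d ξ)) : ℝ) : ℂ)‖ =
      |w t| * Real.exp (-(t * laplaceSymbol d ξ)) := by
    intro ξ t
    have : ‖UnitAddTorus.mFourier (-n) ξ‖ = 1 := by
      simp [UnitAddTorus.mFourier, norm_prod, norm_fourier_apply, -fourier_apply]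
    rw [norm_mul, this, one_mul, Complex.norm_real, Real.norm_eq_abs, abs_mul,
      abs_of_pos (Real.exp_pos _)]
  rw [integrable_prod_iff' hcont.aestronglyMeasurable]
  constructor
  · refine Filter.Eventually.of_forall fun t => ?_
    refine Continuous.integrable_of_hasCompactSupport ?_ (HasCompactSupport.of_compactSpace _)
    exact hcont.comp (continuous_id.prodMk continuous_const)
  · obtain ⟨C, hC, h⟩ := exists_norm_heatProd_le hd
    refine Integrable.mono' (hi.const_mul C) ?_ ?_
    · exact (StronglyMeasurable.integral_prod_left'
        (hcont.norm.stronglyMeasurable)).aestronglyMeasurable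
    · refine (ae_restrict_iff' measurableSet_Ioi).mpr (Filter.Eventually.of_forall fun t ht => ?_)
      simp only [Function.uncurry, hnorm]
      rw [integral_const_mul, Real.norm_eq_abs, abs_mul, abs_abs]
      have h1 := h t ht (0 : Site d)
      rw [← integral_torus_exp, Complex.norm_real, Real.norm_eq_abs] at h1
      have e0 : size (0 : Site d) = 1 := by simp [size]
      rw [e0, one_pow] at h1
      calc _ ≤ |w t| * (C * (t + 1) ^ (-(d / 2 : ℝ))) := by gcongr
        _ = _ := by ring

theorem integrableOn_weight_one (hd : 3 ≤ d) :
    IntegrableOn (fun t : ℝ => |(1 : ℝ)| * (t + 1) ^ (-(d / 2 : ℝ))) (Set.Ioi 0) := by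
  have : (3 : ℝ) ≤ d := by exact_mod_cast hd
  exact (integrableOn_add_rpow_Ioi_of_lt (by linarith) (by norm_num)).const_mul _

theorem integrableOn_weight_id (hd : 5 ≤ d) :
    IntegrableOn (fun t : ℝ => |t| * (t + 1) ^ (-(d / 2 : ℝ))) (Set.Ioi 0) := by
  have : (5 : ℝ) ≤ d := by exact_mod_cast hd
  refine Integrable.mono' (integrableOn_add_rpow_Ioi_of_lt (a := 1 - d / 2) (c := 0) (m := 1)
    (by linarith) (by norm_num)) (by fun_prop) ?_
  refine (ae_restrict_iff' measurableSet_Ioi).mpr (Filter.Eventually.of_forall fun t ht => ?_)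
  have ht : 0 < t := ht
  rw [Real.norm_eq_abs, abs_mul, abs_abs, abs_of_pos ht,
    abs_of_nonneg (by positivity), sub_eq_add_neg, Real.rpow_add (by positivity), Real.rpow_one]
  gcongr
  linarith

theorem ae_laplaceSymbol_pos (hd : 3 ≤ d) : ∀ᵐ ξ ∂torusMeasure d, 0 < laplaceSymbol d ξ := by
  have h := (integrable_heat_prod (by omega) (0 : Site d) continuous_const
    (integrableOn_weight_one hd)).prod_right_ae
  filter_upwards [h] with ξ hξ
  refine lt_of_le_of_ne (laplaceSymbol_nonneg ξ) fun h0 => ?_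
  simp only [Function.uncurry, ← h0, neg_zero, UnitAddTorus.mFourier_zero] at hξ
  have h1 : Integrable (fun _ : ℝ => (1 : ℂ)) (volume.restrict (Set.Ioi 0)) := by
    simpa using hξ
  rw [integrable_const_iff] at h1
  simp [isFiniteMeasure_restrict] at h1

theorem integral_exp_neg_mul {r : ℝ} (hr : 0 < r) :
    ∫ t in Set.Ioi (0 : ℝ), 1 * Real.exp (-(t * r)) = 1 / r := by
  have := Real.integral_rpow_mul_exp_neg_mul_Ioi (a := 1) one_pos hr
  simpa [mul_comm r] using this

theorem integral_mul_exp_neg_mul {r : ℝ} (hr : 0 < r) :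
    ∫ t in Set.Ioi (0 : ℝ), t * Real.exp (-(t * r)) = (1 / r) ^ 2 := by
  have := Real.integral_rpow_mul_exp_neg_mul_Ioi (a := 2) two_pos hr
  simpa [mul_comm r, show (2 : ℝ) - 1 = 1 by norm_num, Real.Gamma_two] using this

theorem integral_exp_ae_eq (hd : 3 ≤ d) (n : Site d) : (fun ξ => ∫ t in Set.Ioi (0 : ℝ),
      UnitAddTorus.mFourier (-n) ξ * ((1 * Real.exp (-(t * laplaceSymbol d ξ)) : ℝ) : ℂ))
      =ᵐ[torusMeasure d] fun ξ => UnitAddTorus.mFourier (-n) ξ • (greenSymbol d ξ : ℂ) := by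
  filter_upwards [ae_laplaceSymbol_pos hd] with ξ hξ
  rw [integral_const_mul, integral_complex_ofReal, integral_exp_neg_mul hξ, greenSymbol_eq,
    smul_eq_mul]

theorem integrable_greenSymbol (hd : 3 ≤ d) : Integrable (greenSymbol d) (torusMeasure d) := by
  have h := (integrable_heat_prod (by omega) (0 : Site d) continuous_const
    (integrableOn_weight_one hd)).integral_prod_left
  have h2 := (h.congr (integral_exp_ae_eq hd 0)).re
  simpa [UnitAddTorus.mFourier_zero] using h2

theorem memLp_greenSymbol (hd : 5 ≤ d) : MemLp (greenSymbol d) 2 (torusMeasure d) := by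
  rw [memLp_two_iff_integrable_sq (integrable_greenSymbol (by omega)).aestronglyMeasurable]
  have h := (integrable_heat_prod (by omega) (0 : Site d) continuous_id
    (integrableOn_weight_id hd)).integral_prod_left.re
  refine h.congr ?_
  filter_upwards [ae_laplaceSymbol_pos (d := d) (by omega)] with ξ hξ
  simp only [Function.uncurry, neg_zero, UnitAddTorus.mFourier_zero, ContinuousMap.one_apply,
    one_mul, id]
  rw [integral_complex_ofReal, integral_mul_exp_neg_mul hξ, greenSymbol_eq]
  exact Complex.ofReal_re _

/-- The Green's function is the time integral of the heat kernel. -/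
theorem mFourierCoeff_greenSymbol (hd : 3 ≤ d) (n : Site d) :
    UnitAddTorus.mFourierCoeff (fun ξ => (greenSymbol d ξ : ℂ)) n =
      ∫ t in Set.Ioi (0 : ℝ), heatProd t n := by
  have h := integral_integral_swap (integrable_heat_prod (by omega) n continuous_const
    (integrableOn_weight_one hd))
  simp only [one_mul, integral_torus_heat] at h
  rw [← h]
  have := integral_exp_ae_eq hd n
  simp only [one_mul] at this
  exact (integral_congr_ae this).symm

theorem integrableOn_heatProd (hd : 3 ≤ d) (n : Site d) :
    IntegrableOn (fun t => heatProd t n) (Set.Ioi 0) := by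
  have h := (integrable_heat_prod (by omega) n continuous_const
    (integrableOn_weight_one hd)).integral_prod_right
  simp only [Function.uncurry, one_mul, integral_torus_heat] at h
  exact h

theorem norm_integral_parabolic_le {f : ℝ → ℂ} {C s : ℝ} {m : ℝ} (hm : 2 < m) (hs : 0 < s)
    (hf : ∀ t, 0 < t → ‖f t‖ ≤ C * (t + s ^ 2) ^ (-(m / 2))) :
    ‖∫ t in Set.Ioi (0 : ℝ), f t‖ ≤ C * (m / 2 - 1)⁻¹ * s ^ (-(m - 2)) := by
  refine (norm_integral_le_of_norm_le ((integrableOn_add_rpow_Ioi_of_lt (a := -(m / 2))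
    (m := s ^ 2) (c := 0) (by linarith) (by simp; positivity)).const_mul C) ?_).trans ?_
  · exact (ae_restrict_iff' measurableSet_Ioi).mpr (Filter.Eventually.of_forall fun t ht => hf t ht)
  · rw [integral_const_mul, integral_Ioi_add_rpow (by linarith) (by positivity)]
    apply le_of_eq
    rw [← Real.rpow_natCast, ← Real.rpow_mul hs.le]
    rw [show ((2 : ℕ) : ℝ) * (-(m / 2) + 1) = -(m - 2) by push_cast; ring,
      show -(-(m / 2) + 1) = m / 2 - 1 by ring]
    ring

theorem exists_abs_G0_le (hd : 3 ≤ d) : ∃ C : ℝ, 0 < C ∧ ∀ n n' : Site d,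
    |G0 d n n'| ≤ C * size (n - n') ^ (-(d - 2 : ℝ)) := by
  have hd' : (3 : ℝ) ≤ d := by exact_mod_cast hd
  obtain ⟨C, hC, h⟩ := exists_norm_heatProd_le (d := d) (by omega)
  refine ⟨C * (d / 2 - 1 : ℝ)⁻¹, mul_pos hC (inv_pos.mpr (by linarith)), fun n n' => ?_⟩
  rw [G0, mFourierCoeff_greenSymbol hd]
  exact (Complex.abs_re_le_norm _).trans (norm_integral_parabolic_le (by linarith) (size_pos _)
    fun t ht => h t ht _)

/-- The unit-step gradient of the Green's function gains one power. -/
theorem exists_abs_G0_step_le (hd : 3 ≤ d) : ∃ C : ℝ, 0 < C ∧ ∀ (n : Site d) (i : Fin d),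
    |G0 d (n + Pi.single i 1) 0 - G0 d n 0| ≤ C * size n ^ (-(d - 1 : ℝ)) := by
  have hd' : (3 : ℝ) ≤ d := by exact_mod_cast hd
  obtain ⟨C, hC, h⟩ := exists_norm_heatProd_sub_le (d := d) (by omega)
  refine ⟨C * ((d + 1) / 2 - 1 : ℝ)⁻¹, mul_pos hC (inv_pos.mpr (by linarith)), fun n i => ?_⟩
  rw [G0, G0, mFourierCoeff_greenSymbol hd, mFourierCoeff_greenSymbol hd, ← Complex.sub_re,
    ← integral_sub (integrableOn_heatProd hd _) (integrableOn_heatProd hd _), sub_zero, sub_zero]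
  refine (Complex.abs_re_le_norm _).trans ((norm_integral_parabolic_le (m := d + 1)
    (by linarith) (size_pos _) fun t ht => h t ht n i).trans (le_of_eq ?_))
  congr 2
  ring

end HeatKernel

section Green

variable {d : ℕ}

theorem heat_neg (t : ℝ) (k : ℤ) : heat t (-k) = heat t k := by
  have h := intervalIntegral.integral_comp_neg (a := (-1 / 2 : ℝ)) (b := 1 / 2)
    (fun x : ℝ => heatFun t k x)
  rw [show -(-1 / 2 : ℝ) = 1 / 2 by norm_num, show -(1 / 2 : ℝ) = -1 / 2 by norm_num] at h
  rw [heat, heat, ← h]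
  refine intervalIntegral.integral_congr fun x _ => ?_
  simp only [heatFun]
  push_cast
  rw [mul_neg (2 * (Real.pi : ℂ)) (x : ℂ), Complex.cos_neg]
  ring_nf

theorem conj_heat (t : ℝ) (k : ℤ) : (starRingEnd ℂ) (heat t k) = heat t k := by
  nth_rewrite 2 [← heat_neg t k]
  unfold heat
  rw [intervalIntegral.integral_of_le (by norm_num),
    intervalIntegral.integral_of_le (by norm_num), ← integral_conj]
  refine integral_congr_ae (Filter.Eventually.of_forall fun x => ?_)
  simp only [heatFun]
  rw [← Complex.exp_conj]
  simp only [map_sub, map_neg, map_mul, map_one, map_ofNat, Complex.conj_I, Complex.conj_ofReal,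
    map_intCast, ← Complex.cos_conj]
  push_cast
  ring_nf

theorem heatProd_neg (t : ℝ) (n : Site d) : heatProd t (-n) = heatProd t n := by
  simp [heatProd, heat_neg]

theorem mFourierCoeff_greenSymbol_eq_G0 (hd : 3 ≤ d) (n : Site d) :
    UnitAddTorus.mFourierCoeff (fun ξ => (greenSymbol d ξ : ℂ)) n = (G0 d n 0 : ℂ) := by
  rw [G0, sub_zero]
  refine (Complex.conj_eq_iff_re.mp ?_).symm
  rw [mFourierCoeff_greenSymbol hd, ← integral_conj]
  refine integral_congr_ae (Filter.Eventually.of_forall fun t => ?_)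
  simp [heatProd, conj_heat]

theorem G0_eq_sub (n n' : Site d) : G0 d n n' = G0 d (n - n') 0 := by
  simp [G0]

theorem G0_neg (hd : 3 ≤ d) (n : Site d) : G0 d (-n) 0 = G0 d n 0 := by
  rw [G0, G0, sub_zero, sub_zero, mFourierCoeff_greenSymbol hd, mFourierCoeff_greenSymbol hd]
  simp_rw [heatProd_neg]

theorem G0_comm (hd : 3 ≤ d) (n n' : Site d) : G0 d n n' = G0 d n' n := by
  rw [G0_eq_sub, G0_eq_sub n', ← G0_neg hd, neg_sub]

/-- A function whose forward unit steps are bounded by `B` near `x` is Lipschitz along the lattice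
path that moves one coordinate at a time. -/
theorem abs_sub_le_of_steps {f : Site d → ℝ} {x : Site d} {ρ B : ℝ}
    (hstep : ∀ z : Site d, (∀ i, |((z i - x i : ℤ) : ℝ)| ≤ ρ) → ∀ i,
      |f (z + Pi.single i 1) - f z| ≤ B) (N : ℕ) :
    ∀ y : Site d, (∀ i, |((y i - x i : ℤ) : ℝ)| ≤ ρ) → ∑ i, (y i - x i).natAbs = N →
      |f y - f x| ≤ N * B := by
  induction N with
  | zero =>
    intro y _ hN
    have : y = x := by
      ext i
      have := Finset.sum_eq_zero_iff.mp hN i (Finset.mem_univ i)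
      omega
    simp [this]
  | succ N ih =>
    intro y hy hN
    obtain ⟨i, hi⟩ : ∃ i, y i ≠ x i := by
      by_contra h
      push Not at h
      simp [h] at hN
    have hsum : ∀ y' : Site d, (∀ j, j ≠ i → y' j = y j) →
        (y' i - x i).natAbs + 1 = (y i - x i).natAbs → ∑ j, (y' j - x j).natAbs = N := by
      intro y' h1 h2
      rw [← Finset.add_sum_erase _ _ (Finset.mem_univ i)] at hN ⊢
      have : ∑ j ∈ Finset.univ.erase i, (y' j - x j).natAbs =
          ∑ j ∈ Finset.univ.erase i, (y j - x j).natAbs :=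
        Finset.sum_congr rfl fun j hj => by rw [h1 j (Finset.ne_of_mem_erase hj)]
      omega
    have hball : ∀ y' : Site d, (∀ j, j ≠ i → y' j = y j) →
        (y' i - x i).natAbs + 1 = (y i - x i).natAbs → ∀ j, |((y' j - x j : ℤ) : ℝ)| ≤ ρ := by
      intro y' h1 h2 j
      by_cases hj : j = i
      · subst hj
        refine le_trans ?_ (hy j)
        rw [← Int.cast_abs, ← Int.cast_abs]
        have : |y' j - x j| ≤ |y j - x j| := by
          rw [Int.abs_eq_natAbs, Int.abs_eq_natAbs]; omega
        exact_mod_cast this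
      · rw [h1 j hj]; exact hy j
    push_cast
    rcases lt_or_gt_of_ne hi with h | h
    · have h1 : ∀ j, j ≠ i → (y + Pi.single i 1 : Site d) j = y j := fun j hj => by simp [hj]
      have h2 : ((y + Pi.single i 1 : Site d) i - x i).natAbs + 1 = (y i - x i).natAbs := by
        simp only [Pi.add_apply, Pi.single_eq_same]; omega
      have e1 := ih _ (hball _ h1 h2) (hsum _ h1 h2)
      have e2 := hstep y hy i
      have e3 := abs_sub_le (f y) (f (y + Pi.single i 1)) (f x)
      rw [abs_sub_comm (f y) (f (y + Pi.single i 1))] at e3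
      linarith
    · have h1 : ∀ j, j ≠ i → (y - Pi.single i 1 : Site d) j = y j := fun j hj => by simp [hj]
      have h2 : ((y - Pi.single i 1 : Site d) i - x i).natAbs + 1 = (y i - x i).natAbs := by
        simp only [Pi.sub_apply, Pi.single_eq_same]; omega
      have e1 := ih _ (hball _ h1 h2) (hsum _ h1 h2)
      have e2 := hstep _ (hball _ h1 h2) i
      rw [sub_add_cancel] at e2
      have e3 := abs_sub_le (f y) (f (y - Pi.single i 1)) (f x)
      linarith

/-- Lipschitz bound for the Green's function, valid at all distances. -/
theorem exists_abs_G0_sub_le (hd : 3 ≤ d) : ∃ C : ℝ, 0 < C ∧ ∀ x y : Site d,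
    |G0 d x 0 - G0 d y 0| ≤
      C * size (x - y) * (size x ^ (-(d - 1 : ℝ)) + size y ^ (-(d - 1 : ℝ))) := by
  have hd' : (3 : ℝ) ≤ d := by exact_mod_cast hd
  obtain ⟨A, hA, hA'⟩ := exists_abs_G0_le (d := d) hd
  obtain ⟨B, hB, hB'⟩ := exists_abs_G0_step_le (d := d) hd
  refine ⟨d * (B * 2 ^ (d - 1 : ℝ)) + 3 * A, by positivity, fun x y => ?_⟩
  set ρ := size (x - y) with hρ
  have hρ0 : 0 < ρ := size_pos _
  have hx := size_pos x
  have hy := size_pos y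
  have hpx := Real.rpow_pos_of_pos hx (-(d - 1 : ℝ))
  have hpy := Real.rpow_pos_of_pos hy (-(d - 1 : ℝ))
  have hp2 : (0 : ℝ) < 2 ^ (d - 1 : ℝ) := by positivity
  rcases le_or_gt (2 * ρ) (size x) with h | h
  · have hstep : ∀ z : Site d, (∀ i, |((z i - x i : ℤ) : ℝ)| ≤ ρ) → ∀ i,
        |G0 d (z + Pi.single i 1) 0 - G0 d z 0| ≤
          B * 2 ^ (d - 1 : ℝ) * size x ^ (-(d - 1 : ℝ)) := by
      intro z hz i
      refine (hB' z i).trans ?_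
      rw [mul_assoc]
      refine mul_le_mul_of_nonneg_left (rpow_neg_le_of_le_mul hx two_pos (by linarith) ?_) hB.le
      have h1 : size (z - x) ≤ ρ := by
        refine max_le ((pi_norm_le_iff_of_nonneg hρ0.le).mpr fun j => ?_) (one_le_size _)
        rw [Int.norm_eq_abs]
        exact hz j
      have := size_le_sub' z x
      linarith
    have hyρ : ∀ i, |((y i - x i : ℤ) : ℝ)| ≤ ρ := by
      intro i
      have := (norm_le_pi_norm (y - x) i).trans (norm_le_size _)
      rw [size_sub_comm, Int.norm_eq_abs] at this
      exact this
    have h1 := abs_sub_le_of_steps (f := fun z => G0 d z 0) hstep _ y hyρ rfl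
    have h2 : ((∑ i, (y i - x i).natAbs : ℕ) : ℝ) ≤ d * ρ := by
      rw [Nat.cast_sum]
      calc ∑ i, (((y i - x i).natAbs : ℕ) : ℝ) ≤ ∑ _i : Fin d, ρ :=
            Finset.sum_le_sum fun i _ => by rw [Nat.cast_natAbs, Int.cast_abs]; exact hyρ i
        _ = d * ρ := by simp
    rw [abs_sub_comm]
    calc _ ≤ _ := h1
      _ ≤ d * ρ * (B * 2 ^ (d - 1 : ℝ) * size x ^ (-(d - 1 : ℝ))) := by gcongr
      _ = d * (B * 2 ^ (d - 1 : ℝ)) * ρ * size x ^ (-(d - 1 : ℝ)) := by ring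
      _ ≤ _ := by
          gcongr
          · linarith
          · linarith
  · have key : ∀ z : Site d, size z ≤ 3 * ρ →
        |G0 d z 0| ≤ 3 * A * ρ * size z ^ (-(d - 1 : ℝ)) := by
      intro z hz
      have hz0 := size_pos z
      have h1 := hA' z 0
      rw [sub_zero] at h1
      have e : size z ^ (-(d - 2 : ℝ)) = size z * size z ^ (-(d - 1 : ℝ)) := by
        nth_rewrite 2 [← Real.rpow_one (size z)]
        rw [← Real.rpow_add hz0]; congr 1; ring
      rw [e] at h1
      calc _ ≤ _ := h1
        _ ≤ A * (3 * ρ * size z ^ (-(d - 1 : ℝ))) := by gcongr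
        _ = _ := by ring
    have h1 := key x (by linarith)
    have h2 := key y (by have := size_le_sub' x y; linarith)
    have h3 := abs_sub (G0 d x 0) (G0 d y 0)
    have h4 : 0 ≤ d * (B * 2 ^ (d - 1 : ℝ)) * ρ *
        (size x ^ (-(d - 1 : ℝ)) + size y ^ (-(d - 1 : ℝ))) := by positivity
    linarith

/-! ### The sum rule for `M` -/

theorem measurePreserving_torus_sub_left (ξ : UnitAddTorus (Fin d)) :
    MeasurePreserving (fun η => ξ - η) (torusMeasure d) (torusMeasure d) := by
  unfold torusMeasure
  refine measurePreserving_pi (fun _ => AddCircle.haarAddCircle)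
    (fun _ => AddCircle.haarAddCircle) (f := fun j (θ : UnitAddCircle) => ξ j - θ) fun j => ?_
  exact Measure.measurePreserving_sub_left _ (ξ j)

theorem integral_torus_sub_left {E : Type*} [NormedAddCommGroup E] [NormedSpace ℝ E]
    (f : UnitAddTorus (Fin d) → E) (ξ : UnitAddTorus (Fin d)) :
    ∫ η, f (ξ - η) ∂torusMeasure d = ∫ η, f η ∂torusMeasure d :=
  (measurePreserving_torus_sub_left ξ).integral_comp
    (MeasurableEquiv.subLeft ξ).measurableEmbedding f

theorem mFourier_sub (n : Site d) (ξ η : UnitAddTorus (Fin d)) :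
    UnitAddTorus.mFourier n (ξ - η) = UnitAddTorus.mFourier n ξ * UnitAddTorus.mFourier (-n) η := by
  simp only [UnitAddTorus.mFourier, ContinuousMap.coe_mk, ← Finset.prod_mul_distrib]
  refine Finset.prod_congr rfl fun j _ => ?_
  simp only [fourier_apply, Pi.sub_apply, Pi.neg_apply]
  rw [smul_sub, sub_eq_add_neg, AddCircle.toCircle_add, ← neg_smul, Circle.coe_mul]

theorem integral_mFourier_greenSymbol_sub (hd : 3 ≤ d) (n : Site d) (ξ : UnitAddTorus (Fin d)) :
    ∫ η, UnitAddTorus.mFourier (-n) η * (greenSymbol d (ξ - η) : ℂ) ∂torusMeasure d =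
      UnitAddTorus.mFourier (-n) ξ * (G0 d n 0 : ℂ) := by
  rw [← integral_torus_sub_left _ ξ]
  simp only [sub_sub_cancel, mFourier_sub, mul_assoc]
  rw [integral_const_mul, ← G0_neg hd, ← mFourierCoeff_greenSymbol_eq_G0 hd]
  rfl

theorem mFourierCoeff_congr {f g : UnitAddTorus (Fin d) → ℂ} (h : f =ᵐ[torusMeasure d] g)
    (n : Site d) : UnitAddTorus.mFourierCoeff f n = UnitAddTorus.mFourierCoeff g n := by
  refine integral_congr_ae (μ := torusMeasure d) ?_
  filter_upwards [h] with ξ hξ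
  rw [hξ]

/-- Parseval: the self-convolution of the Green symbol is the Fourier series of `G₀²`. -/
theorem hasSum_conv_greenSymbol (hd : 5 ≤ d) (ξ : UnitAddTorus (Fin d)) :
    HasSum (fun n : Site d => ((G0 d n 0 ^ 2 : ℝ) : ℂ) * UnitAddTorus.mFourier (-n) ξ)
      ((convolution (greenSymbol d) (greenSymbol d) (ContinuousLinearMap.mul ℝ ℝ)
        (torusMeasure d) ξ : ℝ) : ℂ) := by
  have h1 : MemLp (fun η => (greenSymbol d η : ℂ)) 2 (torusMeasure d) :=
    (memLp_greenSymbol hd).ofReal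
  have h2 : MemLp (fun η => (greenSymbol d (ξ - η) : ℂ)) 2 (torusMeasure d) :=
    h1.comp_measurePreserving (measurePreserving_torus_sub_left ξ)
  have h := UnitAddTorus.hasSum_prod_mFourierCoeff (h1.toLp _) (h2.toLp _)
  have e1 : ∀ n : Site d, UnitAddTorus.mFourierCoeff (h1.toLp _) n = (G0 d n 0 : ℂ) := fun n => by
    rw [mFourierCoeff_congr h1.coeFn_toLp, mFourierCoeff_greenSymbol_eq_G0 (by omega)]
  have e2 : ∀ n : Site d, UnitAddTorus.mFourierCoeff (h2.toLp _) n =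
      UnitAddTorus.mFourier (-n) ξ * (G0 d n 0 : ℂ) := fun n => by
    rw [mFourierCoeff_congr h2.coeFn_toLp, ← integral_mFourier_greenSymbol_sub (by omega)]
    rfl
  have e3 : ∫ η, (starRingEnd ℂ) (h1.toLp _ η) * h2.toLp _ η ∂torusMeasure d =
      ((convolution (greenSymbol d) (greenSymbol d) (ContinuousLinearMap.mul ℝ ℝ)
        (torusMeasure d) ξ : ℝ) : ℂ) := by
    rw [convolution_def, ← integral_complex_ofReal]
    refine integral_congr_ae ?_
    filter_upwards [h1.coeFn_toLp, h2.coeFn_toLp] with η hη1 hη2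
    rw [hη1, hη2]
    simp
  convert h using 1
  · funext n
    refine Eq.trans ?_ (congrArg₂ (fun x y : ℂ => (starRingEnd ℂ) x * y) (e1 n) (e2 n)).symm
    simp only [Complex.conj_ofReal]
    push_cast
    ring
  · exact e3.symm

theorem summable_G0_sq (hd : 5 ≤ d) : Summable fun n : Site d => G0 d n 0 ^ 2 := by
  have h := (hasSum_conv_greenSymbol hd 0).summable
  have e : ∀ n : Site d, UnitAddTorus.mFourier n (0 : UnitAddTorus (Fin d)) = 1 := fun n => by
    simp [UnitAddTorus.mFourier]
  simp only [e, mul_one] at h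
  exact_mod_cast h

/-- The third moment of the Green's function is the value at the origin of `Ĝ₀ * Ĝ₀ * Ĝ₀`. -/
theorem hasSum_G0_cube (hd : 5 ≤ d) : HasSum (fun n : Site d => G0 d n 0 ^ 3) (Khat d 0) := by
  have hg : Integrable (fun ξ => (greenSymbol d (0 - ξ) : ℂ)) (torusMeasure d) :=
    (measurePreserving_torus_sub_left 0).integrable_comp_of_integrable
      ((memLp_greenSymbol hd).integrable (by norm_num)).ofReal
  have hnorm : ∀ (n : Site d) (ξ : UnitAddTorus (Fin d)), ‖UnitAddTorus.mFourier n ξ‖ = 1 := by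
    intro n ξ
    simp [UnitAddTorus.mFourier, norm_prod, norm_fourier_apply, -fourier_apply]
  have hint : ∀ n : Site d, Integrable (fun ξ => ((G0 d n 0 ^ 2 : ℝ) : ℂ) *
      (UnitAddTorus.mFourier (-n) ξ * (greenSymbol d (0 - ξ) : ℂ))) (torusMeasure d) := fun n =>
    (hg.bdd_mul (c := 1) (UnitAddTorus.mFourier (-n)).continuous.aestronglyMeasurable
      (Filter.Eventually.of_forall fun ξ => (hnorm _ ξ).le)).const_mul _
  have h := hasSum_integral_of_summable_integral_norm hint (by
    simp only [norm_mul, hnorm, one_mul, Complex.norm_real, norm_pow, Real.norm_eq_abs, sq_abs]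
    simp_rw [integral_const_mul]
    exact (summable_G0_sq hd).mul_right _)
  have e1 : ∀ n : Site d, ∫ ξ, ((G0 d n 0 ^ 2 : ℝ) : ℂ) *
      (UnitAddTorus.mFourier (-n) ξ * (greenSymbol d (0 - ξ) : ℂ)) ∂torusMeasure d =
      ((G0 d n 0 ^ 3 : ℝ) : ℂ) := by
    intro n
    rw [integral_const_mul, integral_mFourier_greenSymbol_sub (by omega)]
    have e : UnitAddTorus.mFourier (-n) (0 : UnitAddTorus (Fin d)) = 1 := by
      simp [UnitAddTorus.mFourier]
    rw [e]
    push_cast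
    ring
  simp only [e1] at h
  have e2 : ∫ ξ, (∑' n : Site d, ((G0 d n 0 ^ 2 : ℝ) : ℂ) *
      (UnitAddTorus.mFourier (-n) ξ * (greenSymbol d (0 - ξ) : ℂ))) ∂torusMeasure d =
      (Khat d 0 : ℂ) := by
    rw [Khat, convolution_def, ← integral_complex_ofReal]
    refine integral_congr_ae (Filter.Eventually.of_forall fun ξ => ?_)
    simp only [ContinuousLinearMap.mul_apply', Complex.ofReal_mul]
    rw [← (hasSum_conv_greenSymbol hd ξ).tsum_eq, ← tsum_mul_right]
    refine tsum_congr fun n => ?_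
    ring
  rw [e2] at h
  exact_mod_cast h

theorem M_eq_sub (n n' : Site d) : M d n n' = M d (n - n') 0 := by
  have h : idK d n n' = idK d (n - n') 0 := by simp [idK, sub_eq_zero]
  simp only [M, M4, G0t]
  rw [← h, ← G0_eq_sub]

theorem G0t_of_ne {n n' : Site d} (h : n ≠ n') : G0t d n n' = G0 d n n' := by
  simp [G0t, idK, h]

theorem G0t_self (n : Site d) : G0t d n n = 0 := by
  rw [G0t, G0_eq_sub]; simp [idK, sigma]

/-- The constant `σ³ - ρ` is exactly what makes every row of `M` sum to zero. -/
theorem hasSum_M (hd : 5 ≤ d) : HasSum (fun n : Site d => M d n 0) 0 := by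
  have h1 := (hasSum_G0_cube hd).sub (hasSum_ite_eq (0 : Site d) (sigma d ^ 3))
  have h2 := h1.sub (hasSum_ite_eq (0 : Site d) (sigma d ^ 3 - rho d))
  have e : Khat d 0 - sigma d ^ 3 - (sigma d ^ 3 - rho d) = 0 := by rw [rho]; ring
  rw [e] at h2
  have hf : (fun n : Site d => M d n 0) = fun n => (G0 d n 0 ^ 3 -
      if n = 0 then sigma d ^ 3 else 0) - if n = 0 then sigma d ^ 3 - rho d else 0 := by
    funext n
    by_cases hn : n = 0
    · subst hn
      simp [M, M4, G0t_self, idK, sigma]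
    · simp [M, M4, G0t_of_ne hn, idK, hn]
  rw [hf]
  exact h2

theorem M_neg (hd : 3 ≤ d) (n : Site d) : M d (-n) 0 = M d n 0 := by
  have h : idK d (-n) 0 = idK d n 0 := by simp [idK]
  simp only [M, M4, G0t]
  rw [h, G0_neg hd]

theorem M_comm (hd : 3 ≤ d) (n n' : Site d) : M d n n' = M d n' n := by
  rw [M_eq_sub, M_eq_sub n', ← M_neg hd, neg_sub]

/-! ### Size of the deterministic kernels -/

theorem exists_abs_G0t_le (hd : 3 ≤ d) : ∃ C : ℝ, 0 < C ∧ ∀ n n' : Site d,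
    |G0t d n n'| ≤ C * size (n - n') ^ (-(d - 2 : ℝ)) := by
  obtain ⟨C, hC, h⟩ := exists_abs_G0_le (d := d) hd
  refine ⟨C, hC, fun n n' => ?_⟩
  by_cases hn : n = n'
  · subst hn
    have := size_pos (n - n)
    rw [G0t_self, abs_zero]
    positivity
  · rw [G0t_of_ne hn]; exact h n n'

theorem exists_abs_M_le (hd : 3 ≤ d) : ∃ C : ℝ, 0 < C ∧ ∀ n n' : Site d,
    |M d n n'| ≤ C * size (n - n') ^ (-(3 * (d - 2) : ℝ)) := by
  obtain ⟨C, hC, h⟩ := exists_abs_G0t_le (d := d) hd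
  refine ⟨C ^ 3 + |sigma d ^ 3 - rho d|, by positivity, fun n n' => ?_⟩
  have hs := size_pos (n - n')
  by_cases hn : n = n'
  · subst hn
    have : size (n - n) = 1 := by simp [size]
    have e : M d n n = -(sigma d ^ 3 - rho d) := by simp [M, M4, G0t_self, idK]
    rw [e, this, Real.one_rpow, mul_one, abs_neg]
    have : 0 < C ^ 3 := by positivity
    linarith
  · have e : M d n n' = G0t d n n' ^ 3 := by simp [M, M4, idK, hn]
    rw [e, abs_pow]
    calc |G0t d n n'| ^ 3 ≤ (C * size (n - n') ^ (-(d - 2 : ℝ))) ^ 3 := by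
          gcongr; exact h n n'
      _ = C ^ 3 * size (n - n') ^ (-(3 * (d - 2) : ℝ)) := by
          rw [mul_pow, ← Real.rpow_natCast (size (n - n') ^ _), ← Real.rpow_mul hs.le]
          congr 2
          push_cast; ring
      _ ≤ _ := by
          gcongr
          linarith [abs_nonneg (sigma d ^ 3 - rho d)]

end Green

/-! ### Pointwise inequalities between powers of distances -/

theorem two_point_le {a X t Y μ : ℝ} (ha : 0 ≤ a) (hμ : 0 < μ) (ht : μ ≤ t) (hY : μ ≤ Y)
    (hX : 0 < X) (h : X ≤ t + Y) : t ^ (-a) * Y ^ (-a) ≤ 2 ^ a * (X ^ (-a) * μ ^ (-a)) := by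
  wlog htY : t ≤ Y generalizing t Y
  · rw [mul_comm]
    exact this hY ht (by linarith) (by linarith)
  have h1 := rpow_neg_le_of_le_mul (y := Y) hX two_pos ha (by linarith)
  have h2 : t ^ (-a) ≤ μ ^ (-a) := Real.rpow_le_rpow_of_nonpos hμ ht (by linarith)
  have hY0 : 0 < Y := by linarith
  calc t ^ (-a) * Y ^ (-a) ≤ μ ^ (-a) * (2 ^ a * X ^ (-a)) := by gcongr
    _ = _ := by ring

theorem rpow_min_le {a b A : ℝ} (ha : 0 < a) (hb : 0 < b) :
    (min a b) ^ (-A) ≤ a ^ (-A) + b ^ (-A) := by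
  have := Real.rpow_pos_of_pos ha (-A)
  have := Real.rpow_pos_of_pos hb (-A)
  rcases min_cases a b with ⟨h, _⟩ | ⟨h, _⟩ <;> rw [h] <;> linarith

/-- Powers attached to one end `Y, u` of a step of length `t` are carried over to the other end
`X, w`, provided the decay in `t` is at least as strong. -/
theorem three_point_le {A β B X Y t u w : ℝ} (hβ : 0 ≤ β) (hB : 0 ≤ B) (hA : β + B ≤ A)
    (hX : 0 < X) (hY : 0 < Y) (ht : 0 < t) (hu : 0 < u) (hw : 0 < w)
    (h1 : X ≤ t + Y) (h2 : w ≤ t + u) :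
    t ^ (-A) * (Y ^ (-β) * u ^ (-B)) ≤
      2 ^ (β + B) * (X ^ (-β) * w ^ (-B)) * (t ^ (-A) + (Y ^ (-A) + u ^ (-A))) := by
  set μ := min t (min Y u) with hμ
  have hμ0 : 0 < μ := lt_min ht (lt_min hY hu)
  have hμt : μ ≤ t := min_le_left _ _
  have hμY : μ ≤ Y := (min_le_right _ _).trans (min_le_left _ _)
  have hμu : μ ≤ u := (min_le_right _ _).trans (min_le_right _ _)
  have e1 := two_point_le hβ hμ0 hμt hμY hX h1
  have e2 := two_point_le hB hμ0 hμt hμu hw h2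
  have e3 : t ^ (-(A - β - B)) ≤ μ ^ (-(A - β - B)) :=
    Real.rpow_le_rpow_of_nonpos hμ0 hμt (by linarith)
  have e4 : μ ^ (-A) ≤ t ^ (-A) + (Y ^ (-A) + u ^ (-A)) :=
    (rpow_min_le ht (lt_min hY hu)).trans (add_le_add le_rfl (rpow_min_le hY hu))
  calc t ^ (-A) * (Y ^ (-β) * u ^ (-B))
      = (t ^ (-β) * Y ^ (-β)) * (t ^ (-B) * u ^ (-B)) * t ^ (-(A - β - B)) := by
        rw [show -A = -β + -B + -(A - β - B) by ring, Real.rpow_add ht, Real.rpow_add ht]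
        ring
    _ ≤ (2 ^ β * (X ^ (-β) * μ ^ (-β))) * (2 ^ B * (w ^ (-B) * μ ^ (-B))) *
        μ ^ (-(A - β - B)) := by gcongr
    _ = 2 ^ (β + B) * (X ^ (-β) * w ^ (-B)) * μ ^ (-A) := by
        rw [Real.rpow_add two_pos, show -A = -β + -B + -(A - β - B) by ring, Real.rpow_add hμ0,
          Real.rpow_add hμ0]
        ring
    _ ≤ _ := by gcongr

section Deterministic

variable {d : ℕ}

/-- The model kernel `(|n| ∧ |n'|)^{-β} |n - n'|^{-(d-2)}` in which all bounds are expressed. -/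
noncomputable def modelKernel (d : ℕ) (β : ℝ) (n n' : Site d) : ℝ :=
  min (size n) (size n') ^ (-β) * size (n - n') ^ (-(d - 2 : ℝ))

theorem min_size_pos (n n' : Site d) : 0 < min (size n) (size n') :=
  lt_min (size_pos n) (size_pos n')

theorem modelKernel_pos (β : ℝ) (n n' : Site d) : 0 < modelKernel d β n n' :=
  mul_pos (Real.rpow_pos_of_pos (min_size_pos n n') _) (Real.rpow_pos_of_pos (size_pos _) _)

theorem modelKernel_comm (β : ℝ) (n n' : Site d) :
    modelKernel d β n n' = modelKernel d β n' n := by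
  rw [modelKernel, modelKernel, min_comm, size_sub_comm]

theorem size_rpow_le_left {β : ℝ} (hβ : 0 ≤ β) (n n' : Site d) :
    size n ^ (-β) ≤ min (size n) (size n') ^ (-β) :=
  Real.rpow_le_rpow_of_nonpos (min_size_pos n n') (min_le_left _ _) (by linarith)

theorem size_rpow_le_right {β : ℝ} (hβ : 0 ≤ β) (n n' : Site d) :
    size n' ^ (-β) ≤ min (size n) (size n') ^ (-β) :=
  Real.rpow_le_rpow_of_nonpos (min_size_pos n n') (min_le_right _ _) (by linarith)

theorem tsum_ofReal_add_le {ι : Type*} {f g : ι → ℝ} {A B : ℝ} (hA : 0 ≤ A) (hB : 0 ≤ B)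
    (h1 : ∑' i, ENNReal.ofReal (f i) ≤ ENNReal.ofReal A)
    (h2 : ∑' i, ENNReal.ofReal (g i) ≤ ENNReal.ofReal B) :
    ∑' i, ENNReal.ofReal (f i + g i) ≤ ENNReal.ofReal (A + B) := by
  rw [ENNReal.ofReal_add hA hB]
  refine le_trans (ENNReal.tsum_le_tsum fun i => ENNReal.ofReal_add_le) ?_
  rw [ENNReal.tsum_add]
  exact add_le_add h1 h2

theorem tsum_ofReal_const_mul_le {ι : Type*} {f : ι → ℝ} {c A : ℝ} (hc : 0 ≤ c)
    (h1 : ∑' i, ENNReal.ofReal (f i) ≤ ENNReal.ofReal A) :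
    ∑' i, ENNReal.ofReal (c * f i) ≤ ENNReal.ofReal (c * A) := by
  simp_rw [ENNReal.ofReal_mul hc, ENNReal.tsum_mul_left]
  gcongr

theorem tsum_ofReal_mono_le {ι : Type*} {f g : ι → ℝ} {A : ℝ} (hfg : ∀ i, f i ≤ g i)
    (h1 : ∑' i, ENNReal.ofReal (g i) ≤ ENNReal.ofReal A) :
    ∑' i, ENNReal.ofReal (f i) ≤ ENNReal.ofReal A :=
  (ENNReal.tsum_le_tsum fun i => ENNReal.ofReal_le_ofReal (hfg i)).trans h1

theorem exists_tsum_propagate_le {A β B : ℝ} (hAd : d < A) (hβ : 0 ≤ β) (hB : 0 ≤ B)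
    (hA : β + B ≤ A) : ∃ C : ℝ, 0 < C ∧ ∀ x n : Site d,
      ∑' y : Site d, ENNReal.ofReal
        (size (x - y) ^ (-A) * (size y ^ (-β) * size (y - n) ^ (-B))) ≤
        ENNReal.ofReal (C * (size x ^ (-β) * size (x - n) ^ (-B))) := by
  obtain ⟨S, hS, hS'⟩ := exists_tsum_size_rpow_le d hAd
  refine ⟨2 ^ (β + B) * (S + (S + S)), by positivity, fun x n => ?_⟩
  have hx := size_pos x
  have hxn := size_pos (x - n)
  have h3 : ∑' y : Site d, ENNReal.ofReal (size (x - y) ^ (-A) +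
      (size y ^ (-A) + size (y - n) ^ (-A))) ≤ ENNReal.ofReal (S + (S + S)) := by
    refine tsum_ofReal_add_le hS.le (by positivity) ?_ (tsum_ofReal_add_le hS.le hS.le hS' ?_)
    · rw [tsum_sub_left x fun y => ENNReal.ofReal (size y ^ (-A))]; exact hS'
    · rw [tsum_sub_right n fun y => ENNReal.ofReal (size y ^ (-A))]; exact hS'
  have h4 := tsum_ofReal_const_mul_le
    (c := 2 ^ (β + B) * (size x ^ (-β) * size (x - n) ^ (-B))) (by positivity) h3
  refine tsum_ofReal_mono_le (fun y => three_point_le hβ hB hA hx (size_pos y) (size_pos _)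
    (size_pos _) hxn (size_le_sub x y) (size_sub_le x y n)) (h4.trans (le_of_eq ?_))
  congr 1; ring

theorem tsum_ofReal_prod {f : Site d × Site d → ℝ} :
    ∑' q : Site d × Site d, ENNReal.ofReal (f q) = ∑' x, ∑' y, ENNReal.ofReal (f (x, y)) :=
  ENNReal.tsum_prod (f := fun x y => ENNReal.ofReal (f (x, y)))

/-! ### The cancellation in `G₀ W G₀` -/

/-- The size of the discrete gradient of `q ↦ |q|^{-s} G₀(n, q)`. -/
noncomputable def gradWeight (d : ℕ) (s : ℝ) (n q : Site d) : ℝ :=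
  size q ^ (-s) * size (q - n) ^ (-(d - 1 : ℝ)) +
    size q ^ (-(s + 1)) * size (q - n) ^ (-(d - 2 : ℝ))

theorem gradWeight_pos (s : ℝ) (n q : Site d) : 0 < gradWeight d s n q := by
  have := size_pos q
  have := size_pos (q - n)
  unfold gradWeight
  positivity

theorem rpow_neg_sub_le {s X Y : ℝ} (hs1 : s ≤ 1) (hX : 0 < X) (hXY : X ≤ Y) :
    X ^ (-s) - Y ^ (-s) ≤ X ^ (-(s + 1)) * (Y - X) := by
  have hY : 0 < Y := by linarith
  have h1 : X / Y ≤ (X / Y) ^ s := by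
    have := Real.rpow_le_rpow_of_exponent_ge (x := X / Y) (by positivity)
      ((div_le_one hY).mpr hXY) hs1
    rwa [Real.rpow_one] at this
  have h2 : Y ^ (-s) = X ^ (-s) * (X / Y) ^ s := by
    rw [Real.div_rpow hX.le hY.le, Real.rpow_neg hX.le, Real.rpow_neg hY.le]
    have := Real.rpow_pos_of_pos hX s
    field_simp
  have h3 : X ^ (-(s + 1)) = X ^ (-s) * X⁻¹ := by
    rw [neg_add, Real.rpow_add hX, Real.rpow_neg_one]
  rw [h2, h3]
  have h4 : 1 - X / Y ≤ X⁻¹ * (Y - X) := by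
    have e : X⁻¹ * (Y - X) - (1 - X / Y) = (Y - X) ^ 2 / (X * Y) := by field_simp
    have : 0 ≤ (Y - X) ^ 2 / (X * Y) := by positivity
    linarith
  have := Real.rpow_pos_of_pos hX (-s)
  calc X ^ (-s) - X ^ (-s) * (X / Y) ^ s = X ^ (-s) * (1 - (X / Y) ^ s) := by ring
    _ ≤ X ^ (-s) * (X⁻¹ * (Y - X)) := by gcongr; linarith
    _ = _ := by ring

/-- No power is lost, whatever the distance of `x` and `y`: the weight is varied at the farther
point's value of `|·|^{-s}`, the smaller one. -/
theorem exists_weighted_green_sub_le (hd : 3 ≤ d) {s : ℝ} (hs : 0 ≤ s) (hs1 : s ≤ 1) :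
    ∃ C : ℝ, 0 < C ∧ ∀ n x y : Site d,
      |size x ^ (-s) * G0 d (x - n) 0 - size y ^ (-s) * G0 d (y - n) 0| ≤
        C * size (x - y) * (gradWeight d s n x + gradWeight d s n y) := by
  obtain ⟨A, hA, hA'⟩ := exists_abs_G0_le (d := d) hd
  obtain ⟨B, hB, hB'⟩ := exists_abs_G0_sub_le (d := d) hd
  refine ⟨A + B, by positivity, fun n x y => ?_⟩
  wlog hxy : size x ≤ size y generalizing x y
  · rw [abs_sub_comm, size_sub_comm, add_comm (gradWeight d s n x)]
    exact this y x (by linarith)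
  have hx := size_pos x
  have hy := size_pos y
  have hxn := size_pos (x - n)
  have hyn := size_pos (y - n)
  have hρ := size_pos (x - y)
  have h1 : size y ^ (-s) ≤ size x ^ (-s) := Real.rpow_le_rpow_of_nonpos hx hxy (by linarith)
  have h2 := rpow_neg_sub_le hs1 hx hxy
  have h3 : size y - size x ≤ size (x - y) := by linarith [size_le_sub' x y]
  have h4 := hA' (x - n) 0
  rw [sub_zero] at h4
  have h5 := hB' (x - n) (y - n)
  rw [sub_sub_sub_cancel_right] at h5
  have e : size x ^ (-s) * G0 d (x - n) 0 - size y ^ (-s) * G0 d (y - n) 0 =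
      (size x ^ (-s) - size y ^ (-s)) * G0 d (x - n) 0 +
        size y ^ (-s) * (G0 d (x - n) 0 - G0 d (y - n) 0) := by ring
  rw [e]
  have hpx := Real.rpow_pos_of_pos hx (-s)
  have hpy := Real.rpow_pos_of_pos hy (-s)
  have hpx1 := Real.rpow_pos_of_pos hx (-(s + 1))
  have hpy1 := Real.rpow_pos_of_pos hy (-(s + 1))
  have hgx := Real.rpow_pos_of_pos hxn (-(d - 1 : ℝ))
  have hgy := Real.rpow_pos_of_pos hyn (-(d - 1 : ℝ))
  have hgx2 := Real.rpow_pos_of_pos hxn (-(d - 2 : ℝ))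
  have hgy2 := Real.rpow_pos_of_pos hyn (-(d - 2 : ℝ))
  have t1 : |(size x ^ (-s) - size y ^ (-s)) * G0 d (x - n) 0| ≤
      (size x ^ (-(s + 1)) * size (x - y)) * (A * size (x - n) ^ (-(d - 2 : ℝ))) := by
    rw [abs_mul, abs_of_nonneg (by linarith)]
    have : size x ^ (-s) - size y ^ (-s) ≤ size x ^ (-(s + 1)) * size (x - y) :=
      h2.trans (by gcongr)
    gcongr
  have t2 : |size y ^ (-s) * (G0 d (x - n) 0 - G0 d (y - n) 0)| ≤
      B * size (x - y) * (size x ^ (-s) * size (x - n) ^ (-(d - 1 : ℝ)) +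
        size y ^ (-s) * size (y - n) ^ (-(d - 1 : ℝ))) := by
    rw [abs_mul, abs_of_pos hpy]
    calc _ ≤ size y ^ (-s) * (B * size (x - y) *
          (size (x - n) ^ (-(d - 1 : ℝ)) + size (y - n) ^ (-(d - 1 : ℝ)))) := by gcongr
      _ = B * size (x - y) * (size y ^ (-s) * size (x - n) ^ (-(d - 1 : ℝ)) +
        size y ^ (-s) * size (y - n) ^ (-(d - 1 : ℝ))) := by ring
      _ ≤ _ := by gcongr
  refine (abs_add_le _ _).trans ((add_le_add t1 t2).trans ?_)
  unfold gradWeight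
  have k1 : 0 ≤ A * size (x - y) * (size x ^ (-s) * size (x - n) ^ (-(d - 1 : ℝ)) +
      (size y ^ (-s) * size (y - n) ^ (-(d - 1 : ℝ)) +
        size y ^ (-(s + 1)) * size (y - n) ^ (-(d - 2 : ℝ)))) := by positivity
  have k2 : 0 ≤ B * size (x - y) * (size x ^ (-(s + 1)) * size (x - n) ^ (-(d - 2 : ℝ)) +
        size y ^ (-(s + 1)) * size (y - n) ^ (-(d - 2 : ℝ))) := by positivity
  linarith

/-- Pointwise splitting of the product of two gradient weights into summable pieces. -/
theorem gradWeight_mul_le (hd : 3 ≤ d) {s : ℝ} (hs : 0 ≤ s) (n n' q : Site d) :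
    gradWeight d s n q * gradWeight d s n' q ≤
      2 ^ (d - 2 : ℝ) * size (n - n') ^ (-(d - 2 : ℝ)) *
        (2 * (size q ^ (-(2 * s + 2)) * size (n - q) ^ (-(d - 2 : ℝ)) +
          size q ^ (-(2 * s + 2)) * size (n' - q) ^ (-(d - 2 : ℝ))) +
        4 * (size q ^ (-(2 * s + 1)) * size (n - q) ^ (-(d - 1 : ℝ)) +
          size q ^ (-(2 * s + 1)) * size (n' - q) ^ (-(d - 1 : ℝ)))) +
      2 ^ (2 * s) * min (size n) (size n') ^ (-(2 * s)) *
        (size (n - q) ^ (-(d - 1 : ℝ)) * size (n' - q) ^ (-(d - 1 : ℝ))) := by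
  have hd' : (3 : ℝ) ≤ d := by exact_mod_cast hd
  have hN := size_pos (n - n')
  have tri : size (n - n') ≤ size (n - q) + size (n' - q) := by
    rw [size_sub_comm n' q]; exact size_sub_le n q n'
  have hQn := size_le_sub n q
  have hQn' := size_le_sub n' q
  have hR0 := min_size_pos n n'
  have hRn : min (size n) (size n') ≤ size n := min_le_left _ _
  have hRn' : min (size n) (size n') ≤ size n' := min_le_right _ _
  rw [gradWeight, gradWeight, size_sub_comm q n, size_sub_comm q n']
  have hQ := size_pos q
  have hp := size_pos (n - q)
  have hr := size_pos (n' - q)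
  generalize min (size n) (size n') = R at *
  generalize size q = Q at *
  generalize size (n - q) = p at *
  generalize size (n' - q) = r at *
  generalize size (n - n') = N at *
  -- exponents: split off single powers
  have sp : ∀ x : ℝ, 0 < x → x ^ (-(d - 1 : ℝ)) = x ^ (-(d - 2 : ℝ)) * x⁻¹ := fun x hx => by
    rw [← Real.rpow_neg_one x, ← Real.rpow_add hx]; congr 1; ring
  have q1 : Q ^ (-(s + 1)) = Q ^ (-s) * Q⁻¹ := by
    rw [← Real.rpow_neg_one Q, ← Real.rpow_add hQ]; congr 1; ring
  have q2 : Q ^ (-(2 * s + 2)) = Q ^ (-s) * Q ^ (-s) * (Q⁻¹ * Q⁻¹) := by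
    rw [← Real.rpow_neg_one Q, ← Real.rpow_add hQ, ← Real.rpow_add hQ, ← Real.rpow_add hQ]
    congr 1; ring
  have q3 : Q ^ (-(2 * s + 1)) = Q ^ (-s) * Q ^ (-s) * Q⁻¹ := by
    rw [← Real.rpow_neg_one Q, ← Real.rpow_add hQ, ← Real.rpow_add hQ]
    congr 1; ring
  have q4 : Q ^ (-(2 * s)) = Q ^ (-s) * Q ^ (-s) := by
    rw [← Real.rpow_add hQ]; congr 1; ring
  have key : p ^ (-(d - 2 : ℝ)) * r ^ (-(d - 2 : ℝ)) ≤
      2 ^ (d - 2 : ℝ) * N ^ (-(d - 2 : ℝ)) * (p ^ (-(d - 2 : ℝ)) + r ^ (-(d - 2 : ℝ))) := by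
    have h1 := two_point_le (a := (d - 2 : ℝ)) (by linarith) (lt_min hp hr) (min_le_left _ _)
      (min_le_right _ _) hN tri
    refine h1.trans ?_
    rw [mul_assoc]
    have := rpow_min_le (A := (d - 2 : ℝ)) hp hr
    gcongr
  -- Near the origin both distances dominate `Q`.
  have t11 : Q ^ (-(2 * s)) * (p ^ (-(d - 1 : ℝ)) * r ^ (-(d - 1 : ℝ))) ≤
      Q ^ (-(2 * s + 2)) * (p ^ (-(d - 2 : ℝ)) * r ^ (-(d - 2 : ℝ))) +
        2 ^ (2 * s) * R ^ (-(2 * s)) * (p ^ (-(d - 1 : ℝ)) * r ^ (-(d - 1 : ℝ))) := by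
    rcases le_or_gt R (2 * Q) with h | h
    · have h1 := rpow_neg_le_of_le_mul (a := 2 * s) hR0 two_pos (by linarith) h
      have h2 : 0 ≤ Q ^ (-(2 * s + 2)) * (p ^ (-(d - 2 : ℝ)) * r ^ (-(d - 2 : ℝ))) := by
        positivity
      have h3 := mul_le_mul_of_nonneg_right h1
        (show 0 ≤ p ^ (-(d - 1 : ℝ)) * r ^ (-(d - 1 : ℝ)) by positivity)
      linarith
    · have hpQ : p⁻¹ ≤ Q⁻¹ := inv_anti₀ hQ (by linarith)
      have hrQ : r⁻¹ ≤ Q⁻¹ := inv_anti₀ hQ (by linarith)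
      have h2 : 0 ≤ 2 ^ (2 * s) * R ^ (-(2 * s)) * (p ^ (-(d - 1 : ℝ)) * r ^ (-(d - 1 : ℝ))) := by
        positivity
      have h3 : Q ^ (-(2 * s)) * (p ^ (-(d - 1 : ℝ)) * r ^ (-(d - 1 : ℝ))) ≤
          Q ^ (-(2 * s + 2)) * (p ^ (-(d - 2 : ℝ)) * r ^ (-(d - 2 : ℝ))) := by
        rw [sp p hp, sp r hr, q2, q4]
        calc _ = Q ^ (-s) * Q ^ (-s) * (p ^ (-(d - 2 : ℝ)) * r ^ (-(d - 2 : ℝ))) *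
              (p⁻¹ * r⁻¹) := by ring
          _ ≤ Q ^ (-s) * Q ^ (-s) * (p ^ (-(d - 2 : ℝ)) * r ^ (-(d - 2 : ℝ))) *
              (Q⁻¹ * Q⁻¹) := by gcongr
          _ = _ := by ring
      linarith
  have young : ∀ x y : ℝ, 0 < x → 0 < y →
      x⁻¹ * y ^ (-(d - 2 : ℝ)) ≤ x ^ (-(d - 1 : ℝ)) + y ^ (-(d - 1 : ℝ)) := by
    intro x y hx hy
    rcases le_total x y with h | h
    · have h1 : y ^ (-(d - 2 : ℝ)) ≤ x ^ (-(d - 2 : ℝ)) :=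
        Real.rpow_le_rpow_of_nonpos hx h (by linarith)
      have h2 := Real.rpow_pos_of_pos hy (-(d - 1 : ℝ))
      rw [sp x hx]
      have h3 := mul_le_mul_of_nonneg_left h1 (inv_pos.mpr hx).le
      linarith
    · have h1 : x⁻¹ ≤ y⁻¹ := inv_anti₀ hy h
      have h2 := Real.rpow_pos_of_pos hx (-(d - 1 : ℝ))
      rw [sp y hy]
      have h3 := mul_le_mul_of_nonneg_right h1 (Real.rpow_pos_of_pos hy (-(d - 2 : ℝ))).le
      linarith
  have t22 : Q ^ (-(2 * s + 2)) * (p ^ (-(d - 2 : ℝ)) * r ^ (-(d - 2 : ℝ))) ≤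
      2 ^ (d - 2 : ℝ) * N ^ (-(d - 2 : ℝ)) * (Q ^ (-(2 * s + 2)) * p ^ (-(d - 2 : ℝ)) +
        Q ^ (-(2 * s + 2)) * r ^ (-(d - 2 : ℝ))) := by
    have h1 := mul_le_mul_of_nonneg_left key (Real.rpow_pos_of_pos hQ (-(2 * s + 2))).le
    linarith
  have t12 : ∀ x y : ℝ, 0 < x → 0 < y → x ^ (-(d - 2 : ℝ)) * y ^ (-(d - 2 : ℝ)) ≤
      2 ^ (d - 2 : ℝ) * N ^ (-(d - 2 : ℝ)) * (x ^ (-(d - 2 : ℝ)) + y ^ (-(d - 2 : ℝ))) →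
      Q ^ (-(2 * s + 1)) * (x ^ (-(d - 1 : ℝ)) * y ^ (-(d - 2 : ℝ))) ≤
      2 ^ (d - 2 : ℝ) * N ^ (-(d - 2 : ℝ)) * (2 * (Q ^ (-(2 * s + 1)) * x ^ (-(d - 1 : ℝ)) +
        Q ^ (-(2 * s + 1)) * y ^ (-(d - 1 : ℝ)))) := by
    intro x y hx hy hk
    have h1 := young x y hx hy
    have hxx : x⁻¹ * x ^ (-(d - 2 : ℝ)) = x ^ (-(d - 1 : ℝ)) := by rw [sp x hx]; ring
    have hy1 := Real.rpow_pos_of_pos hy (-(d - 1 : ℝ))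
    have hc : 0 < 2 ^ (d - 2 : ℝ) * N ^ (-(d - 2 : ℝ)) := by positivity
    calc _ = Q ^ (-(2 * s + 1)) * x⁻¹ * (x ^ (-(d - 2 : ℝ)) * y ^ (-(d - 2 : ℝ))) := by
          rw [sp x hx]; ring
      _ ≤ Q ^ (-(2 * s + 1)) * x⁻¹ * (2 ^ (d - 2 : ℝ) * N ^ (-(d - 2 : ℝ)) *
          (x ^ (-(d - 2 : ℝ)) + y ^ (-(d - 2 : ℝ)))) := by gcongr
      _ = 2 ^ (d - 2 : ℝ) * N ^ (-(d - 2 : ℝ)) * (Q ^ (-(2 * s + 1)) *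
          (x⁻¹ * x ^ (-(d - 2 : ℝ)) + x⁻¹ * y ^ (-(d - 2 : ℝ)))) := by ring
      _ ≤ 2 ^ (d - 2 : ℝ) * N ^ (-(d - 2 : ℝ)) * (Q ^ (-(2 * s + 1)) *
          (2 * (x ^ (-(d - 1 : ℝ)) + y ^ (-(d - 1 : ℝ))))) := by
          gcongr
          rw [hxx]
          linarith
      _ = _ := by ring
  have a12 := t12 p r hp hr key
  have a21 := t12 r p hr hp (by
    rw [mul_comm, add_comm (r ^ (-(d - 2 : ℝ)))]; exact key)
  have expand : (Q ^ (-s) * p ^ (-(d - 1 : ℝ)) + Q ^ (-(s + 1)) * p ^ (-(d - 2 : ℝ))) *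
      (Q ^ (-s) * r ^ (-(d - 1 : ℝ)) + Q ^ (-(s + 1)) * r ^ (-(d - 2 : ℝ))) =
      Q ^ (-(2 * s)) * (p ^ (-(d - 1 : ℝ)) * r ^ (-(d - 1 : ℝ))) +
      Q ^ (-(2 * s + 1)) * (p ^ (-(d - 1 : ℝ)) * r ^ (-(d - 2 : ℝ))) +
      Q ^ (-(2 * s + 1)) * (r ^ (-(d - 1 : ℝ)) * p ^ (-(d - 2 : ℝ))) +
      Q ^ (-(2 * s + 2)) * (p ^ (-(d - 2 : ℝ)) * r ^ (-(d - 2 : ℝ))) := by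
    rw [q1, q2, q3, q4]; ring
  rw [expand]
  linarith

theorem exists_tsum_gradWeight_mul_le (hd : 5 ≤ d) {s : ℝ} (hs : 0 < s) (hs1 : s ≤ 1) :
    ∃ C : ℝ, 0 < C ∧ ∀ n n' : Site d,
      ∑' q : Site d, ENNReal.ofReal (gradWeight d s n q * gradWeight d s n' q) ≤
        ENNReal.ofReal (C * modelKernel d (2 * s) n n') := by
  have hd' : (5 : ℝ) ≤ d := by exact_mod_cast hd
  obtain ⟨A, hA, hA'⟩ := exists_tsum_conv_le d (a := 2 * s + 2) (b := d - 2) (by linarith)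
    (by linarith) (by linarith) (by linarith) (by linarith)
  obtain ⟨B, hB, hB'⟩ := exists_tsum_conv_le d (a := 2 * s + 1) (b := d - 1) (by linarith)
    (by linarith) (by linarith) (by linarith) (by linarith)
  obtain ⟨D, hD, hD'⟩ := exists_tsum_conv_le d (a := d - 1) (b := d - 1) (by linarith)
    (by linarith) (by linarith) (by linarith) (by linarith)
  refine ⟨2 ^ (d - 2 : ℝ) * (2 * (A + A) + 4 * (B + B)) + 2 ^ (2 * s) * D, by positivity,
    fun n n' => ?_⟩
  have hN := size_pos (n - n')
  have hn := size_pos n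
  have hn' := size_pos n'
  have hR := min_size_pos n n'
  set Rs := min (size n) (size n') ^ (-(2 * s)) with hRs
  have hRs0 : 0 < Rs := Real.rpow_pos_of_pos hR _
  have a1 : ∀ m : Site d, size m ^ (-(2 * s)) ≤ Rs → ∑' q : Site d, ENNReal.ofReal
      (size q ^ (-(2 * s + 2)) * size (m - q) ^ (-(d - 2 : ℝ))) ≤ ENNReal.ofReal (A * Rs) := by
    intro m hm
    refine (hA' m).trans (ENNReal.ofReal_le_ofReal ?_)
    rw [show (d : ℝ) - (2 * s + 2) - (d - 2) = -(2 * s) by ring]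
    gcongr
  have b1 : ∀ m : Site d, size m ^ (-(2 * s)) ≤ Rs → ∑' q : Site d, ENNReal.ofReal
      (size q ^ (-(2 * s + 1)) * size (m - q) ^ (-(d - 1 : ℝ))) ≤ ENNReal.ofReal (B * Rs) := by
    intro m hm
    refine (hB' m).trans (ENNReal.ofReal_le_ofReal ?_)
    rw [show (d : ℝ) - (2 * s + 1) - (d - 1) = -(2 * s) by ring]
    gcongr
  have d1 : ∑' q : Site d, ENNReal.ofReal
      (size (n - q) ^ (-(d - 1 : ℝ)) * size (n' - q) ^ (-(d - 1 : ℝ))) ≤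
      ENNReal.ofReal (D * size (n - n') ^ (-(d - 2 : ℝ))) := by
    have h1 := hD' (n - n')
    rw [← tsum_sub_left n] at h1
    rw [show (d : ℝ) - (d - 1) - (d - 1) = -(d - 2) by ring] at h1
    refine le_trans (le_of_eq ?_) h1
    refine tsum_congr fun q => ?_
    rw [show n - n' - (n - q) = q - n' by abel, size_sub_comm q n']
  have m1 := size_rpow_le_left (β := 2 * s) (by linarith) n n'
  have m2 := size_rpow_le_right (β := 2 * s) (by linarith) n n'
  have s1 := tsum_ofReal_const_mul_le (c := 2) (by norm_num)
    (tsum_ofReal_add_le (by positivity) (by positivity) (a1 n m1) (a1 n' m2))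
  have s2 := tsum_ofReal_const_mul_le (c := 4) (by norm_num)
    (tsum_ofReal_add_le (by positivity) (by positivity) (b1 n m1) (b1 n' m2))
  have s3 := tsum_ofReal_const_mul_le
    (c := 2 ^ (d - 2 : ℝ) * size (n - n') ^ (-(d - 2 : ℝ))) (by positivity)
    (tsum_ofReal_add_le (by positivity) (by positivity) s1 s2)
  have s4 := tsum_ofReal_const_mul_le (c := 2 ^ (2 * s) * Rs) (by positivity) d1
  have s5 := tsum_ofReal_add_le (by positivity) (by positivity) s3 s4
  refine tsum_ofReal_mono_le (fun q => gradWeight_mul_le (by omega) hs.le n n' q)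
    (s5.trans (le_of_eq ?_))
  rw [modelKernel]
  congr 1
  ring

end Deterministic

section Deterministic

variable {d : ℕ}

/-- The `(n₁, n₂)` difference sum controlled by the gradient weights. -/
theorem exists_tsum_difference_le (hd : 5 ≤ d) {s : ℝ} (hs : 0 < s) (hs1 : s ≤ 1) :
    ∃ C : ℝ, 0 < C ∧ ∀ n n' : Site d,
      ∑' q : Site d × Site d, ENNReal.ofReal (size (q.1 - q.2) ^ (-(3 * d - 8 : ℝ)) *
        ((gradWeight d s n q.1 + gradWeight d s n q.2) *
          (gradWeight d s n' q.1 + gradWeight d s n' q.2))) ≤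
        ENNReal.ofReal (C * modelKernel d (2 * s) n n') := by
  have hd' : (5 : ℝ) ≤ d := by exact_mod_cast hd
  obtain ⟨A, hA, hA'⟩ := exists_tsum_gradWeight_mul_le hd hs hs1
  obtain ⟨S, hS, hS'⟩ := exists_tsum_size_rpow_le d (c := 3 * d - 8) (by linarith)
  obtain ⟨P1, hP1, hP1'⟩ := exists_tsum_propagate_le (d := d) (A := 3 * d - 8) (β := s)
    (B := d - 1) (by linarith) hs.le (by linarith) (by linarith)
  obtain ⟨P2, hP2, hP2'⟩ := exists_tsum_propagate_le (d := d) (A := 3 * d - 8) (β := s + 1)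
    (B := d - 2) (by linarith) (by linarith) (by linarith) (by linarith)
  set T : ℝ := P1 + P2
  have hprop : ∀ x n : Site d, ∑' y : Site d, ENNReal.ofReal
      (size (x - y) ^ (-(3 * d - 8 : ℝ)) * gradWeight d s n y) ≤
      ENNReal.ofReal (T * gradWeight d s n x) := by
    intro x n
    have hx := size_pos x
    have hxn := size_pos (x - n)
    have h1 := tsum_ofReal_add_le (by positivity) (by positivity) (hP1' x n) (hP2' x n)
    refine tsum_ofReal_mono_le (fun y => le_of_eq (by rw [gradWeight]; ring)) (h1.trans
      (ENNReal.ofReal_le_ofReal ?_))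
    rw [gradWeight]
    have e1 : 0 ≤ P1 * (size x ^ (-(s + 1)) * size (x - n) ^ (-(d - 2 : ℝ))) := by positivity
    have e2 : 0 ≤ P2 * (size x ^ (-s) * size (x - n) ^ (-(d - 1 : ℝ))) := by positivity
    simp only [T]
    linarith
  refine ⟨S * A + S * A + (T * A + T * A), by positivity, fun n n' => ?_⟩
  set K := modelKernel d (2 * s) n n' with hK
  have hK0 : 0 < K := modelKernel_pos _ _ _
  have h11 : ∑' q : Site d × Site d, ENNReal.ofReal (size (q.1 - q.2) ^ (-(3 * d - 8 : ℝ)) *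
      (gradWeight d s n q.1 * gradWeight d s n' q.1)) ≤ ENNReal.ofReal (S * A * K) := by
    rw [tsum_ofReal_prod]
    calc _ ≤ ∑' x : Site d, ENNReal.ofReal (S * (gradWeight d s n x * gradWeight d s n' x)) := by
          refine ENNReal.tsum_le_tsum fun x => ?_
          have hg : 0 ≤ gradWeight d s n x * gradWeight d s n' x :=
            (mul_pos (gradWeight_pos _ _ _) (gradWeight_pos _ _ _)).le
          have h1 : ∑' y : Site d, ENNReal.ofReal (size (x - y) ^ (-(3 * d - 8 : ℝ))) ≤
              ENNReal.ofReal S := by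
            rw [tsum_sub_left x fun y => ENNReal.ofReal (size y ^ (-(3 * d - 8 : ℝ)))]
            exact hS'
          refine tsum_ofReal_mono_le (fun y => le_of_eq (mul_comm _ _))
            ((tsum_ofReal_const_mul_le hg h1).trans (le_of_eq ?_))
          rw [mul_comm]
      _ ≤ _ := (tsum_ofReal_const_mul_le hS.le (hA' n n')).trans (le_of_eq (by rw [mul_assoc]))
  have h22 : ∑' q : Site d × Site d, ENNReal.ofReal (size (q.1 - q.2) ^ (-(3 * d - 8 : ℝ)) *
      (gradWeight d s n q.2 * gradWeight d s n' q.2)) ≤ ENNReal.ofReal (S * A * K) := by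
    rw [← (Equiv.prodComm (Site d) (Site d)).tsum_eq]
    refine le_trans (le_of_eq (tsum_congr fun q => ?_)) h11
    simp only [Equiv.prodComm_apply, Prod.fst_swap, Prod.snd_swap]
    rw [size_sub_comm]
  have hcross : ∀ m m' : Site d, modelKernel d (2 * s) m m' = K →
      ∑' q : Site d × Site d, ENNReal.ofReal (size (q.1 - q.2) ^ (-(3 * d - 8 : ℝ)) *
      (gradWeight d s m q.1 * gradWeight d s m' q.2)) ≤ ENNReal.ofReal (T * A * K) := by
    intro m m' hm
    rw [tsum_ofReal_prod]
    calc _ ≤ ∑' x : Site d, ENNReal.ofReal (T * (gradWeight d s m x * gradWeight d s m' x)) := by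
          refine ENNReal.tsum_le_tsum fun x => ?_
          refine tsum_ofReal_mono_le (fun y => le_of_eq ?_) ((tsum_ofReal_const_mul_le
            (gradWeight_pos s m x).le (hprop x m')).trans (le_of_eq ?_))
          · simp only; ring
          · congr 1; ring
      _ ≤ _ := (tsum_ofReal_const_mul_le (by positivity) (hA' m m')).trans
          (le_of_eq (by rw [mul_assoc, hm]))
  have h := tsum_ofReal_add_le (by positivity) (by positivity)
    (tsum_ofReal_add_le (by positivity) (by positivity) h11 h22)
    (tsum_ofReal_add_le (by positivity) (by positivity) (hcross n n' rfl)
      (hcross n' n (modelKernel_comm _ _ _)))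
  refine tsum_ofReal_mono_le (fun q => le_of_eq ?_) (h.trans (le_of_eq ?_))
  · ring
  · congr 1; ring

/-- Summation by parts: against a symmetric kernel `k` with vanishing row sums, a bilinear sum only
sees the differences of its two arguments. -/
theorem tsum_eq_neg_half_differences {k : Site d → ℝ} (hk : HasSum k 0) (hka : Summable fun x => |k x|)
    (heven : ∀ x, k (-x) = k x) {E F : Site d → ℝ} (hE : Summable fun x => E x ^ 2)
    (hF : Summable fun x => F x ^ 2) :
    Summable (fun q : Site d × Site d => E q.1 * k (q.1 - q.2) * F q.2) ∧
    ∑' q : Site d × Site d, E q.1 * k (q.1 - q.2) * F q.2 =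
      -(1 / 2) * ∑' q : Site d × Site d,
        k (q.1 - q.2) * ((E q.1 - E q.2) * (F q.1 - F q.2)) := by
  -- Coordinates `(x, z)` with `z = x - y` separate the kernel from the functions.
  let e : Site d × Site d ≃ Site d × Site d :=
    { toFun := fun q => (q.1, q.1 - q.2)
      invFun := fun q => (q.1, q.1 - q.2)
      left_inv := fun q => by simp
      right_inv := fun q => by simp }
  have hsum : ∀ a : Site d → ℝ, Summable (fun x => |a x|) →
      Summable fun q : Site d × Site d => a q.1 * k (q.1 - q.2) := by
    intro a ha
    have h1 : Summable fun q : Site d × Site d => a q.1 * k q.2 :=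
      summable_mul_of_summable_norm (by simpa using ha) (by simpa using hka)
    exact e.summable_iff.mpr h1
  have hswap : ∀ q : Site d × Site d, k (q.2 - q.1) = k (q.1 - q.2) := fun q => by
    rw [← heven, neg_sub]
  have hsum' : ∀ a : Site d → ℝ, Summable (fun x => |a x|) →
      Summable fun q : Site d × Site d => a q.2 * k (q.1 - q.2) := by
    intro a ha
    have := (Equiv.prodComm (Site d) (Site d)).summable_iff.mpr (hsum a ha)
    refine this.congr fun q => ?_
    simp [hswap q]
  have hzero : ∀ a : Site d → ℝ, Summable (fun x => |a x|) →
      ∑' q : Site d × Site d, a q.1 * k (q.1 - q.2) = 0 := by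
    intro a ha
    rw [(hsum a ha).tsum_prod]
    simp_rw [tsum_mul_left]
    have : ∀ x : Site d, ∑' y, k (x - y) = 0 := fun x => by
      exact ((Equiv.subLeft x).tsum_eq k).trans hk.tsum_eq
    simp [this]
  have hzero' : ∀ a : Site d → ℝ, Summable (fun x => |a x|) →
      ∑' q : Site d × Site d, a q.2 * k (q.1 - q.2) = 0 := by
    intro a ha
    rw [← hzero a ha, ← (Equiv.prodComm (Site d) (Site d)).tsum_eq]
    refine tsum_congr fun q => ?_
    simp [← hswap q]
  have hmix : Summable fun q : Site d × Site d => E q.1 * k (q.1 - q.2) * F q.2 := by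
    have h1 := (hsum (fun x => E x ^ 2) (by simpa using hE)).abs
    have h2 := (hsum' (fun x => F x ^ 2) (by simpa using hF)).abs
    refine Summable.of_norm_bounded (h1.add h2) fun q => ?_
    rw [Real.norm_eq_abs, abs_mul, abs_mul, abs_mul, abs_mul, abs_of_nonneg (sq_nonneg (E q.1)),
      abs_of_nonneg (sq_nonneg (F q.2)), ← sq_abs (E q.1), ← sq_abs (F q.2)]
    have : |E q.1| * |F q.2| ≤ |E q.1| ^ 2 + |F q.2| ^ 2 := by
      nlinarith [sq_nonneg (|E q.1| - |F q.2|), sq_nonneg (|E q.1| + |F q.2|)]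
    calc _ = |k (q.1 - q.2)| * (|E q.1| * |F q.2|) := by ring
      _ ≤ |k (q.1 - q.2)| * (|E q.1| ^ 2 + |F q.2| ^ 2) := by gcongr
      _ = _ := by ring
  have hEF : Summable fun x => |E x * F x| := by
    refine Summable.of_nonneg_of_le (fun x => abs_nonneg _) (fun x => ?_) (hE.add hF)
    rw [abs_mul, ← sq_abs (E x), ← sq_abs (F x)]
    nlinarith [sq_nonneg (|E x| - |F x|), sq_nonneg (|E x| + |F x|)]
  have hmix' : Summable fun q : Site d × Site d => E q.2 * k (q.1 - q.2) * F q.1 := by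
    have := (Equiv.prodComm (Site d) (Site d)).summable_iff.mpr hmix
    refine this.congr fun q => ?_
    simp [hswap q]
  have hmix_eq : ∑' q : Site d × Site d, E q.2 * k (q.1 - q.2) * F q.1 =
      ∑' q : Site d × Site d, E q.1 * k (q.1 - q.2) * F q.2 := by
    rw [← (Equiv.prodComm (Site d) (Site d)).tsum_eq]
    refine tsum_congr fun q => ?_
    simp [← hswap q]
  refine ⟨hmix, ?_⟩
  have h1 := hsum _ hEF
  have h2 := hsum' _ hEF
  have e1 : (fun q : Site d × Site d => k (q.1 - q.2) * ((E q.1 - E q.2) * (F q.1 - F q.2))) =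
      fun q => ((E q.1 * F q.1) * k (q.1 - q.2) + (E q.2 * F q.2) * k (q.1 - q.2)) -
        (E q.1 * k (q.1 - q.2) * F q.2 + E q.2 * k (q.1 - q.2) * F q.1) := by
    funext q; ring
  rw [e1, (h1.add h2).tsum_sub (hmix.add hmix'), h1.tsum_add h2, hmix.tsum_add hmix', hmix_eq,
    hzero _ hEF, hzero' _ hEF]
  ring

theorem v_sq (κ α : ℝ) (n : Site d) : v κ α n ^ 2 = κ ^ 2 * size n ^ (-(2 * α)) := by
  rw [v, mul_pow, ← Real.rpow_natCast (size n ^ _), ← Real.rpow_mul (size_pos n).le]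
  congr 2
  push_cast; ring

theorem size_rpow_le_one {a : ℝ} (ha : 0 ≤ a) (n : Site d) : size n ^ (-a) ≤ 1 :=
  Real.rpow_le_one_of_one_le_of_nonpos (one_le_size n) (by linarith)

theorem summable_weighted_green_sq (hd : 5 ≤ d) {s : ℝ} (hs : 0 ≤ s) {A : Site d → ℝ} {C : ℝ}
    {n : Site d} (hA : ∀ x, |A x| ≤ C * size (x - n) ^ (-(d - 2 : ℝ))) :
    Summable fun x : Site d => (size x ^ (-s) * A x) ^ 2 := by
  have hd' : (5 : ℝ) ≤ d := by exact_mod_cast hd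
  obtain ⟨S, hS, hS'⟩ := exists_tsum_size_rpow_le d (c := 2 * (d - 2)) (by linarith)
  have h1 : Summable fun x : Site d => size (x - n) ^ (-(2 * (d - 2) : ℝ)) := by
    refine summable_of_tsum_ofReal_le (B := S)
      (fun x => Real.rpow_nonneg (size_pos _).le _) ?_
    rwa [tsum_sub_right n fun y => ENNReal.ofReal (size y ^ (-(2 * (d - 2) : ℝ)))]
  refine Summable.of_nonneg_of_le (fun x => sq_nonneg _) (fun x => ?_) (h1.mul_left (C ^ 2))
  have hx := size_pos x
  have hxn := size_pos (x - n)
  rw [← sq_abs, abs_mul, abs_of_nonneg (Real.rpow_nonneg hx.le _)]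
  calc (size x ^ (-s) * |A x|) ^ 2 ≤ (1 * (C * size (x - n) ^ (-(d - 2 : ℝ)))) ^ 2 := by
        have := size_rpow_le_one hs x
        have := hA x
        gcongr
    _ = C ^ 2 * size (x - n) ^ (-(2 * (d - 2) : ℝ)) := by
        rw [one_mul, mul_pow, ← Real.rpow_natCast (size (x - n) ^ _), ← Real.rpow_mul hxn.le]
        congr 2
        push_cast; ring

theorem summable_abs_M (hd : 5 ≤ d) : Summable fun x : Site d => |M d x 0| := by
  have hd' : (5 : ℝ) ≤ d := by exact_mod_cast hd
  obtain ⟨C, hC, h⟩ := exists_abs_M_le (d := d) (by omega)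
  obtain ⟨S, hS, hS'⟩ := exists_tsum_size_rpow_le d (c := 3 * (d - 2)) (by linarith)
  have h1 : Summable fun x : Site d => size x ^ (-(3 * (d - 2) : ℝ)) :=
    summable_of_tsum_ofReal_le (fun x => Real.rpow_nonneg (size_pos _).le _) hS'
  refine Summable.of_nonneg_of_le (fun x => abs_nonneg _) (fun x => ?_) (h1.mul_left C)
  simpa using h x 0

theorem mul3_W_apply (κ α : ℝ) (A B : Kernel d) (n n' : Site d) (q : Site d × Site d) :
    A n q.1 * W d κ α q.1 q.2 * B q.2 n' = κ ^ 4 * ((size q.1 ^ (-(2 * α)) * A n q.1) *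
      M d (q.1 - q.2) 0 * (size q.2 ^ (-(2 * α)) * B q.2 n')) := by
  rw [W, v_sq, v_sq, M_eq_sub]
  ring

theorem mul3Summable_W (hd : 5 ≤ d) {κ α C : ℝ} (hα : 0 ≤ α) {A B : Kernel d}
    (hA : ∀ n n', |A n n'| ≤ C * size (n - n') ^ (-(d - 2 : ℝ)))
    (hB : ∀ n n', |B n n'| ≤ C * size (n - n') ^ (-(d - 2 : ℝ))) :
    Mul3Summable A (W d κ α) B := by
  intro n n'
  simp_rw [mul3_W_apply]
  refine Summable.mul_left _ ?_
  exact (tsum_eq_neg_half_differences (hasSum_M hd) (summable_abs_M hd) (M_neg (by omega))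
    (summable_weighted_green_sq hd (by linarith) fun x => by
      rw [size_sub_comm]; exact hA n x)
    (summable_weighted_green_sq hd (by linarith) fun x => hB x n')).1

/-- The key deterministic bound: despite the slow decay of `G₀`, the vanishing row sums of `M` make
`G₀ W G₀` as small off the diagonal as `G₀` itself. -/
theorem exists_abs_G0WG0_le (hd : 5 ≤ d) {α : ℝ} (hα : 0 < α) (hα' : α ≤ 1 / 2) :
    ∃ C : ℝ, 0 < C ∧ ∀ κ : ℝ, ∀ n n' : Site d,
      |mul3 (G0 d) (W d κ α) (G0 d) n n'| ≤ C * κ ^ 4 * modelKernel d (4 * α) n n' := by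
  obtain ⟨A, hA, hA'⟩ := exists_abs_M_le (d := d) (by omega)
  obtain ⟨B, hB, hB'⟩ := exists_weighted_green_sub_le (d := d) (s := 2 * α) (by omega)
    (by linarith) (by linarith)
  obtain ⟨D, hD, hD'⟩ := exists_tsum_difference_le (d := d) (s := 2 * α) hd (by linarith)
    (by linarith)
  obtain ⟨G, hG, hG'⟩ := exists_abs_G0_le (d := d) (by omega)
  refine ⟨A * B ^ 2 * D, by positivity, fun κ n n' => ?_⟩
  have hK := modelKernel_pos (4 * α) n n'
  set E : Site d → ℝ := fun x => size x ^ (-(2 * α)) * G0 d (x - n) 0 with hE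
  set F : Site d → ℝ := fun x => size x ^ (-(2 * α)) * G0 d (x - n') 0 with hF
  have e1 : mul3 (G0 d) (W d κ α) (G0 d) n n' =
      κ ^ 4 * ∑' q : Site d × Site d, E q.1 * M d (q.1 - q.2) 0 * F q.2 := by
    rw [mul3, ← tsum_mul_left]
    refine tsum_congr fun q => ?_
    rw [mul3_W_apply, G0_comm (by omega) n, G0_eq_sub q.1, G0_eq_sub q.2]
  have hbd : ∀ m x : Site d, |G0 d (x - m) 0| ≤ G * size (x - m) ^ (-(d - 2 : ℝ)) := fun m x => by
    simpa using hG' (x - m) 0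
  have e2 := (tsum_eq_neg_half_differences (hasSum_M hd) (summable_abs_M hd) (M_neg (by omega))
    (summable_weighted_green_sq hd (s := 2 * α) (by linarith) (hbd n))
    (summable_weighted_green_sq hd (s := 2 * α) (by linarith) (hbd n'))).2
  have e3 : ∑' q : Site d × Site d,
      |M d (q.1 - q.2) 0 * ((E q.1 - E q.2) * (F q.1 - F q.2))| ≤
      A * B ^ 2 * (D * modelKernel d (4 * α) n n') ∧ Summable fun q : Site d × Site d =>
      |M d (q.1 - q.2) 0 * ((E q.1 - E q.2) * (F q.1 - F q.2))| := by
    have h1 := hD' n n'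
    rw [show 2 * (2 * α) = 4 * α by ring] at h1
    have h2 := tsum_ofReal_const_mul_le (c := A * B ^ 2) (by positivity) h1
    have h3 := tsum_ofReal_mono_le (f := fun q : Site d × Site d =>
      |M d (q.1 - q.2) 0 * ((E q.1 - E q.2) * (F q.1 - F q.2))|) (fun q => ?_) h2
    · exact ⟨tsum_le_of_tsum_ofReal_le (fun q => abs_nonneg _) (by positivity) h3,
        summable_of_tsum_ofReal_le (fun q => abs_nonneg _) h3⟩
    · have hq := size_pos (q.1 - q.2)
      rw [abs_mul, abs_mul]
      have g1 := hA' (q.1 - q.2) 0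
      rw [sub_zero] at g1
      have g2 := hB' n q.1 q.2
      have g3 := hB' n' q.1 q.2
      have p1 := gradWeight_pos (2 * α) n q.1
      have p2 := gradWeight_pos (2 * α) n q.2
      have p3 := gradWeight_pos (2 * α) n' q.1
      have p4 := gradWeight_pos (2 * α) n' q.2
      calc _ ≤ (A * size (q.1 - q.2) ^ (-(3 * (d - 2) : ℝ))) *
            ((B * size (q.1 - q.2) * (gradWeight d (2 * α) n q.1 + gradWeight d (2 * α) n q.2)) *
            (B * size (q.1 - q.2) *
              (gradWeight d (2 * α) n' q.1 + gradWeight d (2 * α) n' q.2))) := by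
            gcongr
        _ = A * B ^ 2 * ((size (q.1 - q.2) ^ (-(3 * (d - 2) : ℝ)) * size (q.1 - q.2) ^ (2 : ℝ)) *
            ((gradWeight d (2 * α) n q.1 + gradWeight d (2 * α) n q.2) *
              (gradWeight d (2 * α) n' q.1 + gradWeight d (2 * α) n' q.2))) := by
            rw [Real.rpow_two]; ring
        _ = _ := by
            rw [← Real.rpow_add hq]
            congr 4
            ring
  rw [e1, e2, abs_mul, abs_mul, abs_of_nonneg (by positivity : 0 ≤ κ ^ 4)]
  have e4 : |∑' q : Site d × Site d,
      M d (q.1 - q.2) 0 * ((E q.1 - E q.2) * (F q.1 - F q.2))| ≤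
      A * B ^ 2 * (D * modelKernel d (4 * α) n n') := by
    have := norm_tsum_le_tsum_norm (f := fun q : Site d × Site d =>
      M d (q.1 - q.2) 0 * ((E q.1 - E q.2) * (F q.1 - F q.2))) e3.2
    exact this.trans e3.1
  have e5 : |(-(1 / 2) : ℝ)| ≤ 1 := by norm_num [abs_of_pos]
  calc _ ≤ κ ^ 4 * (1 * (A * B ^ 2 * (D * modelKernel d (4 * α) n n'))) := by gcongr
    _ = _ := by ring

theorem exists_abs_G0tWG0_le (hd : 5 ≤ d) {α : ℝ} (hα : 0 < α) (hα' : α ≤ 1 / 2) :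
    ∃ C : ℝ, 0 < C ∧ ∀ κ : ℝ, ∀ n n' : Site d,
      |mul3 (G0t d) (W d κ α) (G0 d) n n'| ≤ C * κ ^ 4 * modelKernel d (4 * α) n n' := by
  have hd' : (5 : ℝ) ≤ d := by exact_mod_cast hd
  obtain ⟨A, hA, hA'⟩ := exists_abs_M_le (d := d) (by omega)
  obtain ⟨B, hB, hB'⟩ := exists_abs_G0WG0_le hd hα hα'
  obtain ⟨G, hG, hG'⟩ := exists_abs_G0_le (d := d) (by omega)
  obtain ⟨T, hT, hT'⟩ := exists_tsum_propagate_le (d := d) (A := 3 * (d - 2)) (β := 2 * α)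
    (B := d - 2) (by linarith) (by linarith) (by linarith) (by linarith)
  refine ⟨B + |sigma d| * (A * G * T), by positivity, fun κ n n' => ?_⟩
  have hK := modelKernel_pos (4 * α) n n'
  have hn := size_pos n
  have hN := size_pos (n - n')
  have hR := min_size_pos n n'
  -- The diagonal part `σ W G₀` needs no cancellation.
  have hrow : ∑' q : Site d, ENNReal.ofReal |W d κ α n q * G0 d q n'| ≤
      ENNReal.ofReal (A * G * T * κ ^ 4 * modelKernel d (4 * α) n n') := by
    have h1 := tsum_ofReal_const_mul_le (c := κ ^ 4 * A * G * size n ^ (-(2 * α)))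
      (by positivity) (hT' n n')
    refine tsum_ofReal_mono_le (fun q => ?_) (h1.trans (ENNReal.ofReal_le_ofReal ?_))
    · have hq := size_pos q
      rw [W, v_sq, v_sq]
      have g1 := hA' n q
      have g2 := hG' q n'
      have e : |κ ^ 2 * size n ^ (-(2 * α)) * M d n q * (κ ^ 2 * size q ^ (-(2 * α))) * G0 d q n'| =
          κ ^ 4 * size n ^ (-(2 * α)) * size q ^ (-(2 * α)) * (|M d n q| * |G0 d q n'|) := by
        rw [show κ ^ 2 * size n ^ (-(2 * α)) * M d n q * (κ ^ 2 * size q ^ (-(2 * α))) *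
          G0 d q n' = (κ ^ 4 * size n ^ (-(2 * α)) * size q ^ (-(2 * α))) *
          (M d n q * G0 d q n') by ring,
          abs_mul (κ ^ 4 * size n ^ (-(2 * α)) * size q ^ (-(2 * α))), abs_mul (M d n q),
          abs_of_nonneg (by positivity)]
      rw [e]
      have hnq := size_pos (n - q)
      have hqn := size_pos (q - n')
      calc _ ≤ κ ^ 4 * size n ^ (-(2 * α)) * size q ^ (-(2 * α)) *
            ((A * size (n - q) ^ (-(3 * (d - 2) : ℝ))) *
              (G * size (q - n') ^ (-(d - 2 : ℝ)))) := by gcongr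
        _ = _ := by ring
    · have h2 : size n ^ (-(2 * α)) * size n ^ (-(2 * α)) ≤
          min (size n) (size n') ^ (-(4 * α)) := by
        rw [← Real.rpow_add hn, show -(2 * α) + -(2 * α) = -(4 * α) by ring]
        exact size_rpow_le_left (by linarith) n n'
      rw [modelKernel]
      calc _ = A * G * T * κ ^ 4 * ((size n ^ (-(2 * α)) * size n ^ (-(2 * α))) *
            size (n - n') ^ (-(d - 2 : ℝ))) := by ring
        _ ≤ _ := by gcongr
  have hs1 := mul3Summable_W (κ := κ) hd hα.le hG' hG' n n'
  have hsr : Summable fun q : Site d => W d κ α n q * G0 d q n' :=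
    (summable_of_tsum_ofReal_le (fun q => abs_nonneg _) hrow).of_abs
  let ι : Site d → Site d × Site d := fun y => (n, y)
  have hι : Function.Injective ι := fun a b h => (Prod.mk.inj h).2
  have hoff : ∀ q : Site d × Site d, q ∉ Set.range ι →
      idK d n q.1 * W d κ α q.1 q.2 * G0 d q.2 n' = 0 := by
    intro q hq
    have : n ≠ q.1 := fun h => hq ⟨q.2, by simp [ι, h]⟩
    simp [idK, this]
  have hcomp : (fun q : Site d × Site d => idK d n q.1 * W d κ α q.1 q.2 * G0 d q.2 n') ∘ ι =
      fun q : Site d => W d κ α n q * G0 d q n' := by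
    funext q
    simp [ι, idK]
  have hs2 : HasSum (fun q : Site d × Site d => idK d n q.1 * W d κ α q.1 q.2 * G0 d q.2 n')
      (∑' q : Site d, W d κ α n q * G0 d q n') := by
    rw [← hι.hasSum_iff hoff, hcomp]
    exact hsr.hasSum
  have e1 : mul3 (G0t d) (W d κ α) (G0 d) n n' = mul3 (G0 d) (W d κ α) (G0 d) n n' -
      sigma d * ∑' q : Site d, W d κ α n q * G0 d q n' := by
    have h := hs1.hasSum.sub (hs2.mul_left (sigma d))
    rw [mul3, mul3, ← h.tsum_eq]
    refine tsum_congr fun q => ?_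
    rw [G0t]; ring
  have e2 : |∑' q : Site d, W d κ α n q * G0 d q n'| ≤
      A * G * T * κ ^ 4 * modelKernel d (4 * α) n n' := by
    have := norm_tsum_le_tsum_norm (f := fun q : Site d => W d κ α n q * G0 d q n') hsr.abs
    exact this.trans (tsum_le_of_tsum_ofReal_le (fun q => abs_nonneg _) (by positivity) hrow)
  rw [e1]
  refine (abs_sub _ _).trans ?_
  rw [abs_mul]
  have := mul_le_mul_of_nonneg_left e2 (abs_nonneg (sigma d))
  have := hB' κ n n'
  linarith

theorem W_comm (hd : 3 ≤ d) (κ α : ℝ) (n n' : Site d) : W d κ α n n' = W d κ α n' n := by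
  rw [W, W, M_comm hd]; ring

theorem G0t_comm (hd : 3 ≤ d) (n n' : Site d) : G0t d n n' = G0t d n' n := by
  rw [G0t, G0t, G0_comm hd]; simp [idK, eq_comm]

theorem mul3_G0WG0t (hd : 3 ≤ d) (κ α : ℝ) (n n' : Site d) :
    mul3 (G0 d) (W d κ α) (G0t d) n n' = mul3 (G0t d) (W d κ α) (G0 d) n' n := by
  rw [mul3, mul3, ← (Equiv.prodComm (Site d) (Site d)).tsum_eq]
  refine tsum_congr fun q => ?_
  simp only [Equiv.prodComm_apply, Prod.fst_swap, Prod.snd_swap]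
  rw [G0_comm hd n, G0t_comm hd _ n', W_comm hd]
  ring

theorem exists_tsum_D4_le (hd : 5 ≤ d) {α : ℝ} (hα : 0 < α) (hα' : α ≤ 1 / 2) :
    ∃ C : ℝ, 0 < C ∧ ∀ κ : ℝ, ∀ n : Site d,
      ∑' m : Site d, ENNReal.ofReal (v κ α m ^ 2 * G0t d n m ^ 4) ≤
        ENNReal.ofReal (C * κ ^ 2 * size n ^ (-(2 * α))) := by
  have hd' : (5 : ℝ) ≤ d := by exact_mod_cast hd
  obtain ⟨G, hG, hG'⟩ := exists_abs_G0t_le (d := d) (by omega)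
  obtain ⟨T, hT, hT'⟩ := exists_tsum_propagate_le (d := d) (A := 4 * (d - 2)) (β := 2 * α)
    (B := 0) (by linarith) (by linarith) (by linarith) (by linarith)
  refine ⟨G ^ 4 * T, by positivity, fun κ n => ?_⟩
  have h1 := tsum_ofReal_const_mul_le (c := κ ^ 2 * G ^ 4) (by positivity) (hT' n 0)
  refine tsum_ofReal_mono_le (fun m => ?_) (h1.trans (le_of_eq ?_))
  · have hnm := size_pos (n - m)
    have hm := size_pos m
    have e : G0t d n m ^ 4 = |G0t d n m| ^ 4 := by
      rw [show (4 : ℕ) = 2 * 2 by norm_num, pow_mul, pow_mul, sq_abs]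
    rw [v_sq, e, neg_zero, Real.rpow_zero, mul_one]
    calc _ ≤ κ ^ 2 * size m ^ (-(2 * α)) * (G * size (n - m) ^ (-(d - 2 : ℝ))) ^ 4 := by
          have := hG' n m
          gcongr
      _ = _ := by
          rw [mul_pow, ← Real.rpow_natCast (size (n - m) ^ _), ← Real.rpow_mul hnm.le,
            show -(d - 2 : ℝ) * ((4 : ℕ) : ℝ) = -(4 * (d - 2)) by push_cast; ring]
          ring
  · rw [neg_zero, Real.rpow_zero]
    congr 1; ring

theorem exists_abs_D4_le (hd : 5 ≤ d) {α : ℝ} (hα : 0 < α) (hα' : α ≤ 1 / 2) :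
    ∃ C : ℝ, 0 < C ∧ ∀ κ : ℝ, ∀ n : Site d,
      |D4 d κ α n| ≤ C * κ ^ 4 * size n ^ (-(4 * α)) := by
  obtain ⟨C, hC, h⟩ := exists_tsum_D4_le hd hα hα'
  refine ⟨C, hC, fun κ n => ?_⟩
  have hn := size_pos n
  have hnn : ∀ m : Site d, 0 ≤ v κ α m ^ 2 * G0t d n m ^ 4 := fun m => by positivity
  have h1 := tsum_le_of_tsum_ofReal_le hnn (by positivity) (h κ n)
  rw [D4, abs_of_nonneg (mul_nonneg (sq_nonneg _) (tsum_nonneg hnn)), v_sq]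
  calc _ ≤ κ ^ 2 * size n ^ (-(2 * α)) * (C * κ ^ 2 * size n ^ (-(2 * α))) := by gcongr
    _ = C * κ ^ 4 * (size n ^ (-(2 * α)) * size n ^ (-(2 * α))) := by ring
    _ = _ := by
        rw [← Real.rpow_add hn]
        congr 2
        ring

end Deterministic

/-! ### Walsh functions and hypercontractivity -/

section Walsh

variable {d : ℕ}

/-- The sign `ω_n`, viewed as a real random variable. -/
noncomputable def sgn (n : Site d) (ω : Sample d) : ℝ := (((ω n : ℤˣ) : ℤ) : ℝ)

theorem sgn_sq (n : Site d) (ω : Sample d) : sgn n ω ^ 2 = 1 := by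
  unfold sgn
  rcases Int.units_eq_one_or (ω n) with h | h <;> simp [h]

theorem sgn_mul_self (n : Site d) (ω : Sample d) : sgn n ω * sgn n ω = 1 := by
  rw [← sq, sgn_sq]

theorem abs_sgn (n : Site d) (ω : Sample d) : |sgn n ω| = 1 := by
  unfold sgn
  rcases Int.units_eq_one_or (ω n) with h | h <;> simp [h]

/-- The Walsh function `∏_{n ∈ S} ω_n`. -/
noncomputable def walsh (S : Finset (Site d)) (ω : Sample d) : ℝ := ∏ n ∈ S, sgn n ω

theorem measurable_walsh (S : Finset (Site d)) : Measurable (walsh S) :=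
  Finset.measurable_prod _ fun n _ => measurable_sign n

theorem abs_walsh (S : Finset (Site d)) (ω : Sample d) : |walsh S ω| = 1 := by
  unfold walsh
  rw [Finset.abs_prod]
  exact Finset.prod_eq_one fun n _ => abs_sgn n ω

theorem walsh_insert {S : Finset (Site d)} {a : Site d} (ha : a ∉ S) (ω : Sample d) :
    walsh (insert a S) ω = sgn a ω * walsh S ω := by
  unfold walsh
  rw [Finset.prod_insert ha]

theorem walsh_mul (S T : Finset (Site d)) (ω : Sample d) :
    walsh S ω * walsh T ω = walsh (symmDiff S T) ω := by
  have h1 : walsh S ω = walsh (S \ T) ω * walsh (S ∩ T) ω := by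
    unfold walsh
    rw [mul_comm]
    exact (Finset.prod_inter_mul_prod_sdiff S T _).symm
  have h2 : walsh T ω = walsh (T \ S) ω * walsh (S ∩ T) ω := by
    unfold walsh
    rw [mul_comm, Finset.inter_comm]
    exact (Finset.prod_inter_mul_prod_sdiff T S _).symm
  have h3 : walsh (symmDiff S T) ω = walsh (S \ T) ω * walsh (T \ S) ω := by
    unfold walsh
    rw [symmDiff_def, Finset.sup_eq_union, Finset.prod_union]
    exact disjoint_sdiff_sdiff
  have h4 : walsh (S ∩ T) ω * walsh (S ∩ T) ω = 1 := by
    unfold walsh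
    rw [← Finset.prod_mul_distrib]
    exact Finset.prod_eq_one fun n _ => sgn_mul_self n ω
  rw [h1, h2, h3]
  linear_combination (walsh (S \ T) ω * walsh (T \ S) ω) * h4

/-- The map reversing the sign at `a`. -/
def flip (a : Site d) (ω : Sample d) : Sample d := fun n => if n = a then -ω n else ω n

theorem measurableSingletonClass_units : MeasurableSingletonClass ℤˣ :=
  ⟨fun u => ⟨{(u : ℤ)}, measurableSet_singleton _, by ext w; simp [Units.ext_iff]⟩⟩

theorem measurePreserving_flip (a : Site d) : MeasurePreserving (flip a) (P d) (P d) := by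
  have := measurableSingletonClass_units
  have hneg : Measure.map (fun u : ℤˣ => -u) (PMF.uniformOfFintype ℤˣ).toMeasure
      = (PMF.uniformOfFintype ℤˣ).toMeasure := by
    rw [PMF.toMeasure_map _ _ (measurable_of_finite _)]
    congr 1
    ext u
    rw [PMF.map_apply, tsum_eq_single (-u)]
    · simp
    · intro b hb
      rw [if_neg]
      intro h
      exact hb (by rw [h, neg_neg])
  have hm : ∀ n : Site d, Measurable fun u : ℤˣ => if n = a then -u else u := fun n =>
    measurable_of_finite _
  refine ⟨measurable_pi_lambda _ fun n => ?_, ?_⟩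
  · exact (hm n).comp (measurable_pi_apply n)
  · have := Measure.infinitePi_map_pi (μ := fun _ : Site d => (PMF.uniformOfFintype ℤˣ).toMeasure)
      (f := fun (n : Site d) (u : ℤˣ) => if n = a then -u else u) hm
    unfold P
    refine Eq.trans this ?_
    congr 1
    funext n
    by_cases h : n = a
    · simpa [h] using hneg
    · simp [h]

theorem sgn_flip_self (a : Site d) (ω : Sample d) : sgn a (flip a ω) = -sgn a ω := by
  simp [sgn, flip]

theorem sgn_flip_of_ne {a n : Site d} (h : n ≠ a) (ω : Sample d) :
    sgn n (flip a ω) = sgn n ω := by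
  simp [sgn, flip, h]

theorem integral_sgn_mul {a : Site d} {F : Sample d → ℝ} (hF : Measurable F)
    (hflip : ∀ ω, F (flip a ω) = F ω) : ∫ ω, sgn a ω * F ω ∂P d = 0 := by
  have hmeas : Measurable fun ω => sgn a ω * F ω := (measurable_sign a).mul hF
  have h1 := integral_map (measurePreserving_flip a).measurable.aemeasurable
    (hmeas.aestronglyMeasurable (μ := Measure.map (flip a) (P d)))
  rw [(measurePreserving_flip a).map_eq] at h1
  simp only [sgn_flip_self, hflip, neg_mul] at h1
  rw [integral_neg] at h1
  linarith

theorem walsh_flip {a : Site d} {S : Finset (Site d)} (ha : a ∉ S) (ω : Sample d) :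
    walsh S (flip a ω) = walsh S ω :=
  Finset.prod_congr rfl fun n hn => sgn_flip_of_ne (by rintro rfl; exact ha hn) ω

theorem integral_walsh {S : Finset (Site d)} (hS : S.Nonempty) : ∫ ω, walsh S ω ∂P d = 0 := by
  obtain ⟨a, ha⟩ := hS
  have h : ∀ ω, walsh S ω = sgn a ω * walsh (S.erase a) ω := fun ω => by
    rw [← walsh_insert (Finset.notMem_erase a S), Finset.insert_erase ha]
  simp_rw [h]
  exact integral_sgn_mul (measurable_walsh _) (walsh_flip (Finset.notMem_erase a S))

theorem integral_walsh_mul (S T : Finset (Site d)) :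
    ∫ ω, walsh S ω * walsh T ω ∂P d = if S = T then 1 else 0 := by
  simp_rw [walsh_mul]
  split_ifs with h
  · subst h
    simp [walsh]
  · exact integral_walsh (Finset.nonempty_iff_ne_empty.2 fun h0 => h (symmDiff_eq_bot.1 h0))

/-- Polynomials of degree at most `k` in the signs `ω_n`, `n ∈ B`. -/
noncomputable def chaos (B : Finset (Site d)) (k : ℕ) : Submodule ℝ (Sample d → ℝ) :=
  Submodule.span ℝ {f | ∃ S ⊆ B, S.card ≤ k ∧ walsh S = f}

theorem walsh_mem_chaos {B S : Finset (Site d)} {k : ℕ} (h : S ⊆ B) (hk : S.card ≤ k) :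
    walsh S ∈ chaos B k := Submodule.subset_span ⟨S, h, hk, rfl⟩

theorem chaos_mono {B : Finset (Site d)} {k l : ℕ} (h : k ≤ l) : chaos B k ≤ chaos B l :=
  Submodule.span_mono fun _ ⟨S, hS, hk, e⟩ => ⟨S, hS, hk.trans h, e⟩

theorem mul_mem_chaos {B : Finset (Site d)} {k l : ℕ} {f g : Sample d → ℝ} (hf : f ∈ chaos B k)
    (hg : g ∈ chaos B l) : f * g ∈ chaos B (k + l) := by
  unfold chaos at hf hg
  induction hf, hg using Submodule.span_induction₂ with
  | mem_mem x y hx hy =>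
    obtain ⟨S, hS, hk, rfl⟩ := hx
    obtain ⟨T, hT, hl, rfl⟩ := hy
    have : walsh S * walsh T = walsh (symmDiff S T) := funext fun ω => walsh_mul S T ω
    rw [this]
    have hsub : symmDiff S T ⊆ S ∪ T := symmDiff_le_sup (a := S) (b := T)
    exact walsh_mem_chaos (hsub.trans (Finset.union_subset hS hT))
      ((Finset.card_le_card hsub).trans ((Finset.card_union_le S T).trans (add_le_add hk hl)))
  | zero_left y hy => rw [zero_mul]; exact Submodule.zero_mem _
  | zero_right x hx => rw [mul_zero]; exact Submodule.zero_mem _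
  | add_left x y z _ _ _ h1 h2 => rw [add_mul]; exact Submodule.add_mem _ h1 h2
  | add_right x y z _ _ _ h1 h2 => rw [mul_add]; exact Submodule.add_mem _ h1 h2
  | smul_left r x y _ _ h => rw [smul_mul_assoc]; exact Submodule.smul_mem _ _ h
  | smul_right r x y _ _ h => rw [mul_smul_comm]; exact Submodule.smul_mem _ _ h

theorem pow_mem_chaos {B : Finset (Site d)} {k : ℕ} {f : Sample d → ℝ} (hf : f ∈ chaos B k)
    (j : ℕ) : f ^ j ∈ chaos B (j * k) := by
  induction j with
  | zero =>
    have : (f ^ 0 : Sample d → ℝ) = walsh ∅ := by funext ω; simp [walsh]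
    rw [this]
    exact walsh_mem_chaos (Finset.empty_subset _) (by simp)
  | succ j ih => rw [pow_succ, Nat.succ_mul]; exact mul_mem_chaos ih hf

theorem measurable_of_mem_chaos {B : Finset (Site d)} {k : ℕ} {f : Sample d → ℝ}
    (hf : f ∈ chaos B k) : Measurable f := by
  unfold chaos at hf
  induction hf using Submodule.span_induction with
  | mem x hx => obtain ⟨S, -, -, rfl⟩ := hx; exact measurable_walsh S
  | zero => exact measurable_const
  | add x y _ _ hx hy => exact hx.add hy
  | smul c x _ hx => exact hx.const_smul c

theorem exists_bound_of_mem_chaos {B : Finset (Site d)} {k : ℕ} {f : Sample d → ℝ}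
    (hf : f ∈ chaos B k) : ∃ R, ∀ ω, |f ω| ≤ R := by
  unfold chaos at hf
  induction hf using Submodule.span_induction with
  | mem x hx => obtain ⟨S, -, -, rfl⟩ := hx; exact ⟨1, fun ω => (abs_walsh S ω).le⟩
  | zero => exact ⟨0, fun ω => by simp⟩
  | add x y _ _ hx hy =>
    obtain ⟨R, hR⟩ := hx
    obtain ⟨R', hR'⟩ := hy
    exact ⟨R + R', fun ω => (abs_add_le _ _).trans (add_le_add (hR ω) (hR' ω))⟩
  | smul c x _ hx =>
    obtain ⟨R, hR⟩ := hx
    refine ⟨|c| * R, fun ω => ?_⟩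
    rw [Pi.smul_apply, smul_eq_mul, abs_mul]
    exact mul_le_mul_of_nonneg_left (hR ω) (abs_nonneg c)

theorem integrable_of_mem_chaos {B : Finset (Site d)} {k : ℕ} {f : Sample d → ℝ}
    (hf : f ∈ chaos B k) : Integrable f (P d) := by
  obtain ⟨R, hR⟩ := exists_bound_of_mem_chaos hf
  exact Integrable.of_bound (measurable_of_mem_chaos hf).aestronglyMeasurable R
    (Filter.Eventually.of_forall fun ω => hR ω)

theorem flip_of_mem_chaos {B : Finset (Site d)} {k : ℕ} {f : Sample d → ℝ}
    (hf : f ∈ chaos B k) {a : Site d} (ha : a ∉ B) (ω : Sample d) : f (flip a ω) = f ω := by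
  unfold chaos at hf
  induction hf using Submodule.span_induction with
  | mem x hx => obtain ⟨S, hS, -, rfl⟩ := hx; exact walsh_flip (fun h => ha (hS h)) ω
  | zero => rfl
  | add x y _ _ hx hy => simp [hx, hy]
  | smul c x _ hx => simp [hx]

theorem exists_eq_add_of_mem_chaos {B : Finset (Site d)} {k : ℕ} {f : Sample d → ℝ} {a : Site d}
    (hf : f ∈ chaos (insert a B) (k + 1)) :
    ∃ g ∈ chaos B (k + 1), ∃ h ∈ chaos B k, ∀ ω, f ω = g ω + sgn a ω * h ω := by
  unfold chaos at hf
  induction hf using Submodule.span_induction with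
  | mem x hx =>
    obtain ⟨S, hS, hk, rfl⟩ := hx
    by_cases ha : a ∈ S
    · refine ⟨0, Submodule.zero_mem _, walsh (S.erase a), walsh_mem_chaos ?_ ?_, fun ω => ?_⟩
      · exact Finset.erase_subset_iff_of_mem (Finset.mem_insert_self a B) |>.2 hS |> fun h x hx =>
          (Finset.mem_insert.1 (h hx)).resolve_left (by rintro rfl; simp at hx)
      · rw [Finset.card_erase_of_mem ha]; omega
      · rw [← walsh_insert (Finset.notMem_erase a S), Finset.insert_erase ha]; simp
    · refine ⟨walsh S, walsh_mem_chaos ?_ hk, 0, Submodule.zero_mem _, fun ω => by simp⟩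
      exact fun x hx => (Finset.mem_insert.1 (hS hx)).resolve_left (by rintro rfl; exact ha hx)
  | zero => exact ⟨0, Submodule.zero_mem _, 0, Submodule.zero_mem _, fun ω => by simp⟩
  | add x y _ _ hx hy =>
    obtain ⟨g, hg, h, hh, e⟩ := hx
    obtain ⟨g', hg', h', hh', e'⟩ := hy
    refine ⟨g + g', Submodule.add_mem _ hg hg', h + h', Submodule.add_mem _ hh hh', fun ω => ?_⟩
    simp only [Pi.add_apply, e, e']
    ring
  | smul c x _ hx =>
    obtain ⟨g, hg, h, hh, e⟩ := hx
    refine ⟨c • g, Submodule.smul_mem _ _ hg, c • h, Submodule.smul_mem _ _ hh, fun ω => ?_⟩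
    simp only [Pi.smul_apply, smul_eq_mul, e]
    ring

theorem exists_const_of_mem_chaos {B : Finset (Site d)} {k : ℕ} {f : Sample d → ℝ}
    (hf : f ∈ chaos B k) (h0 : B = ∅ ∨ k = 0) : ∃ c : ℝ, f = fun _ => c := by
  unfold chaos at hf
  induction hf using Submodule.span_induction with
  | mem x hx =>
    obtain ⟨S, hS, hk, rfl⟩ := hx
    have : S = ∅ := by
      rcases h0 with rfl | rfl
      · exact Finset.subset_empty.1 hS
      · exact Finset.card_eq_zero.1 (Nat.le_zero.1 hk)
    exact ⟨1, by subst this; funext ω; simp [walsh]⟩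
  | zero => exact ⟨0, rfl⟩
  | add x y _ _ hx hy =>
    obtain ⟨c, rfl⟩ := hx
    obtain ⟨c', rfl⟩ := hy
    exact ⟨c + c', rfl⟩
  | smul r x _ hx =>
    obtain ⟨c, rfl⟩ := hx
    exact ⟨r * c, rfl⟩

/-- Cauchy–Schwarz for squares of polynomials in the signs. -/
theorem integral_sq_mul_sq_le {B : Finset (Site d)} {k l : ℕ} {g h : Sample d → ℝ}
    (hg : g ∈ chaos B k) (hh : h ∈ chaos B l) :
    (∫ ω, g ω ^ 2 * h ω ^ 2 ∂P d) ^ 2 ≤ (∫ ω, g ω ^ 4 ∂P d) * ∫ ω, h ω ^ 4 ∂P d := by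
  have ig : Integrable (fun ω => g ω ^ 4) (P d) := integrable_of_mem_chaos (pow_mem_chaos hg 4)
  have ih : Integrable (fun ω => h ω ^ 4) (P d) := integrable_of_mem_chaos (pow_mem_chaos hh 4)
  have igh : Integrable (fun ω => g ω ^ 2 * h ω ^ 2) (P d) :=
    integrable_of_mem_chaos (mul_mem_chaos (pow_mem_chaos hg 2) (pow_mem_chaos hh 2))
  have key : ∀ t : ℝ, 0 ≤ (∫ ω, g ω ^ 4 ∂P d) * (t * t) +
      (-2 * ∫ ω, g ω ^ 2 * h ω ^ 2 ∂P d) * t + ∫ ω, h ω ^ 4 ∂P d := by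
    intro t
    have e : (∫ ω, g ω ^ 4 ∂P d) * (t * t) + (-2 * ∫ ω, g ω ^ 2 * h ω ^ 2 ∂P d) * t +
        ∫ ω, h ω ^ 4 ∂P d = ∫ ω, (t * g ω ^ 2 - h ω ^ 2) ^ 2 ∂P d := by
      have : ∀ ω, (t * g ω ^ 2 - h ω ^ 2) ^ 2 =
          t * t * g ω ^ 4 + -2 * t * (g ω ^ 2 * h ω ^ 2) + h ω ^ 4 := fun ω => by ring
      simp_rw [this]
      have i12 : Integrable (fun ω => t * t * g ω ^ 4 + -2 * t * (g ω ^ 2 * h ω ^ 2)) (P d) :=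
        (ig.const_mul _).add (igh.const_mul _)
      rw [integral_add i12 ih,
        integral_add (ig.const_mul _) (igh.const_mul _), integral_const_mul, integral_const_mul]
      ring
    rw [e]
    exact integral_nonneg fun ω => sq_nonneg _
  have := discrim_le_zero key
  unfold discrim at this
  nlinarith

/-- Bonami's inequality: the fourth moment of a polynomial of degree `k` in independent signs is
controlled by its second moment. One sign at a time is split off, `f = g + ω_a h`, and the odd
powers of `ω_a` average out. -/
theorem integral_pow_four_le (B : Finset (Site d)) : ∀ (k : ℕ) (f : Sample d → ℝ), f ∈ chaos B k →
    ∫ ω, f ω ^ 4 ∂P d ≤ 9 ^ k * (∫ ω, f ω ^ 2 ∂P d) ^ 2 := by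
  have hconst : ∀ (k : ℕ) (c : ℝ), ∫ _ω : Sample d, c ^ 4 ∂P d ≤
      9 ^ k * (∫ _ω : Sample d, c ^ 2 ∂P d) ^ 2 := by
    intro k c
    simp only [integral_const, probReal_univ, one_smul]
    have h9 : (1 : ℝ) ≤ 9 ^ k := one_le_pow₀ (by norm_num)
    nlinarith [sq_nonneg (c ^ 2)]
  induction B using Finset.induction_on with
  | empty =>
    intro k f hf
    obtain ⟨c, rfl⟩ := exists_const_of_mem_chaos hf (Or.inl rfl)
    exact hconst k c
  | insert a B ha ih =>
    intro k f hf
    cases k with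
    | zero =>
      obtain ⟨c, rfl⟩ := exists_const_of_mem_chaos hf (Or.inr rfl)
      exact hconst 0 c
    | succ k =>
      obtain ⟨g, hg, h, hh, e⟩ := exists_eq_add_of_mem_chaos hf
      have hgh := mul_mem_chaos hg hh
      have hodd := Submodule.add_mem _
        (chaos_mono (l := 4 * (k + 1) + 4 * k) (by omega)
          (mul_mem_chaos (pow_mem_chaos hg 3) hh))
        (chaos_mono (l := 4 * (k + 1) + 4 * k) (by omega)
          (mul_mem_chaos hg (pow_mem_chaos hh 3)))
      have z1 := integral_sgn_mul (measurable_of_mem_chaos hgh) (flip_of_mem_chaos hgh ha)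
      have z2 := integral_sgn_mul (measurable_of_mem_chaos hodd) (flip_of_mem_chaos hodd ha)
      have hbdd : ∀ {l : ℕ} {F : Sample d → ℝ}, F ∈ chaos B l →
          Integrable (fun ω => sgn a ω * F ω) (P d) := fun {l F} hF => by
        obtain ⟨R, hR⟩ := exists_bound_of_mem_chaos hF
        refine Integrable.of_bound ((measurable_sign a).mul
          (measurable_of_mem_chaos hF)).aestronglyMeasurable R
          (Filter.Eventually.of_forall fun ω => ?_)
        rw [Real.norm_eq_abs, abs_mul, abs_sgn, one_mul]
        exact hR ω
      have i1 := hbdd hgh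
      have i2 := hbdd hodd
      have ig2 : Integrable (fun ω => g ω ^ 2) (P d) :=
        integrable_of_mem_chaos (pow_mem_chaos hg 2)
      have ih2 : Integrable (fun ω => h ω ^ 2) (P d) :=
        integrable_of_mem_chaos (pow_mem_chaos hh 2)
      have ig4 : Integrable (fun ω => g ω ^ 4) (P d) :=
        integrable_of_mem_chaos (pow_mem_chaos hg 4)
      have ih4 : Integrable (fun ω => h ω ^ 4) (P d) :=
        integrable_of_mem_chaos (pow_mem_chaos hh 4)
      have igh : Integrable (fun ω => g ω ^ 2 * h ω ^ 2) (P d) := integrable_of_mem_chaos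
        (mul_mem_chaos (pow_mem_chaos hg 2) (pow_mem_chaos hh 2))
      have e2 : ∫ ω, f ω ^ 2 ∂P d = (∫ ω, g ω ^ 2 ∂P d) + ∫ ω, h ω ^ 2 ∂P d := by
        have : ∀ ω, f ω ^ 2 = g ω ^ 2 + h ω ^ 2 + 2 * (sgn a ω * (g * h) ω) := fun ω => by
          rw [e, Pi.mul_apply]
          linear_combination (h ω ^ 2) * sgn_sq a ω
        simp_rw [this]
        have i12 : Integrable (fun ω => g ω ^ 2 + h ω ^ 2) (P d) := ig2.add ih2
        rw [integral_add i12 (i1.const_mul 2), integral_add ig2 ih2, integral_const_mul,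
          z1, mul_zero, add_zero]
      have e4 : ∫ ω, f ω ^ 4 ∂P d = (∫ ω, g ω ^ 4 ∂P d) +
          6 * (∫ ω, g ω ^ 2 * h ω ^ 2 ∂P d) + ∫ ω, h ω ^ 4 ∂P d := by
        have : ∀ ω, f ω ^ 4 = g ω ^ 4 + 6 * (g ω ^ 2 * h ω ^ 2) + h ω ^ 4 +
            4 * (sgn a ω * (g ^ 3 * h + g * h ^ 3) ω) := fun ω => by
          rw [e]
          simp only [Pi.mul_apply, Pi.add_apply, Pi.pow_apply]
          linear_combination (6 * g ω ^ 2 * h ω ^ 2 + 4 * sgn a ω * g ω * h ω ^ 3 +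
            h ω ^ 4 * (sgn a ω ^ 2 + 1)) * sgn_sq a ω
        simp_rw [this]
        have i12 : Integrable (fun ω => g ω ^ 4 + 6 * (g ω ^ 2 * h ω ^ 2)) (P d) :=
          ig4.add (igh.const_mul 6)
        have i123 : Integrable (fun ω => g ω ^ 4 + 6 * (g ω ^ 2 * h ω ^ 2) + h ω ^ 4) (P d) :=
          i12.add ih4
        rw [integral_add i123 (i2.const_mul 4), integral_add i12 ih4,
          integral_add ig4 (igh.const_mul 6), integral_const_mul, integral_const_mul, z2, mul_zero,
          add_zero]
      have b1 := ih (k + 1) g hg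
      have b2 := ih k h hh
      have cs := integral_sq_mul_sq_le hg hh
      rw [e2, e4]
      set G := ∫ ω, g ω ^ 2 ∂P d
      set H := ∫ ω, h ω ^ 2 ∂P d
      set X := ∫ ω, g ω ^ 2 * h ω ^ 2 ∂P d
      have hG : 0 ≤ G := integral_nonneg fun ω => sq_nonneg _
      have hH : 0 ≤ H := integral_nonneg fun ω => sq_nonneg _
      have hA : 0 ≤ ∫ ω, h ω ^ 4 ∂P d := integral_nonneg fun ω => by positivity
      have hX : X ≤ 3 * 9 ^ k * (G * H) := by
        refine abs_le_of_sq_le_sq' ?_ (by positivity) |>.2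
        calc X ^ 2 ≤ _ := cs
          _ ≤ (9 ^ (k + 1) * G ^ 2) * (9 ^ k * H ^ 2) := by gcongr
          _ = _ := by ring
      have h9 : (0 : ℝ) ≤ 9 ^ k := by positivity
      have : (9 : ℝ) ^ k * H ^ 2 ≤ 9 ^ (k + 1) * H ^ 2 := by
        gcongr
        · norm_num
        · omega
      calc _ ≤ 9 ^ (k + 1) * G ^ 2 + 6 * (3 * 9 ^ k * (G * H)) + 9 ^ (k + 1) * H ^ 2 := by linarith
        _ = _ := by ring

theorem exists_integral_pow_le (k j : ℕ) : ∃ C : ℝ, 0 < C ∧ ∀ (B : Finset (Site d))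
    (f : Sample d → ℝ), f ∈ chaos B k →
    ∫ ω, f ω ^ 2 ^ (j + 1) ∂P d ≤ C * (∫ ω, f ω ^ 2 ∂P d) ^ 2 ^ j := by
  induction j with
  | zero => exact ⟨1, one_pos, fun B f _ => by simp⟩
  | succ j ih =>
    obtain ⟨C, hC, ih⟩ := ih
    refine ⟨9 ^ (2 ^ j * k) * C ^ 2, by positivity, fun B f hf => ?_⟩
    have h1 := integral_pow_four_le B _ _ (pow_mem_chaos hf (2 ^ j))
    simp only [Pi.pow_apply, ← pow_mul] at h1
    have h2 := ih B f hf
    rw [show 2 ^ j * 4 = 2 ^ (j + 1 + 1) by ring, show 2 ^ j * 2 = 2 ^ (j + 1) by ring] at h1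
    have h0 : 0 ≤ ∫ ω, f ω ^ 2 ^ (j + 1) ∂P d :=
      integral_nonneg fun ω => Even.pow_nonneg (by simp [Nat.even_pow]) _
    calc _ ≤ _ := h1
      _ ≤ 9 ^ (2 ^ j * k) * (C * (∫ ω, f ω ^ 2 ∂P d) ^ 2 ^ j) ^ 2 := by gcongr
      _ = _ := by rw [mul_pow, ← pow_mul, ← pow_succ]; ring

/-- Hypercontractivity: on polynomials of bounded degree in the signs, every `L^p` norm is
dominated by the `L²` norm. -/
theorem exists_eLpNorm_le (k : ℕ) (p : ℝ) : ∃ C : ℝ, 0 < C ∧ ∀ (B : Finset (Site d))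
    (f : Sample d → ℝ), f ∈ chaos B k → ∀ q : ℝ, 0 ≤ q → ∫ ω, f ω ^ 2 ∂P d ≤ q ^ 2 →
    eLpNorm f (ENNReal.ofReal p) (P d) ≤ ENNReal.ofReal (C * q) := by
  obtain ⟨j, hj⟩ := pow_unbounded_of_one_lt p (one_lt_two)
  obtain ⟨C, hC, h⟩ := exists_integral_pow_le (d := d) k j
  set N : ℕ := 2 ^ (j + 1) with hN
  have hN0 : N ≠ 0 := by positivity
  refine ⟨C ^ ((N : ℝ)⁻¹), by positivity, fun B f hf q hq hfq => ?_⟩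
  have hm := (measurable_of_mem_chaos hf).aestronglyMeasurable (μ := P d)
  have hpN : ENNReal.ofReal p ≤ (N : ENNReal) := by
    rw [← ENNReal.ofReal_natCast]
    refine ENNReal.ofReal_le_ofReal (hj.le.trans ?_)
    rw [hN]
    push_cast
    gcongr
    · norm_num
    · omega
  refine (eLpNorm_le_eLpNorm_of_exponent_le hpN hm).trans ?_
  have hint := integrable_of_mem_chaos (pow_mem_chaos hf N)
  have hev : Even N := by simp [hN, Nat.even_pow]
  have hl : ∫⁻ ω, ‖f ω‖ₑ ^ (N : ℝ) ∂P d = ENNReal.ofReal (∫ ω, f ω ^ N ∂P d) := by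
    rw [ofReal_integral_eq_lintegral_ofReal (f := fun ω => f ω ^ N) hint
      (Filter.Eventually.of_forall fun ω => hev.pow_nonneg _)]
    refine lintegral_congr fun ω => ?_
    rw [ENNReal.rpow_natCast, ← hev.pow_abs, ENNReal.ofReal_pow (abs_nonneg _),
      Real.enorm_eq_ofReal_abs]
  rw [eLpNorm_eq_lintegral_rpow_enorm_toReal (by exact_mod_cast hN0) (by simp)]
  simp only [ENNReal.toReal_natCast, one_div]
  rw [hl, ENNReal.ofReal_rpow_of_nonneg (integral_nonneg fun ω => hev.pow_nonneg _) (by positivity)]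
  refine ENNReal.ofReal_le_ofReal ?_
  have hq2 : (∫ ω, f ω ^ 2 ∂P d) ^ 2 ^ j ≤ q ^ N := by
    rw [hN, pow_succ', pow_mul]
    exact pow_le_pow_left₀ (integral_nonneg fun ω => sq_nonneg _) hfq _
  calc _ ≤ (C * q ^ N) ^ ((N : ℝ)⁻¹) := by
        refine Real.rpow_le_rpow (integral_nonneg fun ω => hev.pow_nonneg _) ?_ (by positivity)
        exact (h B f hf).trans (by gcongr)
    _ = _ := by
        rw [Real.mul_rpow hC.le (by positivity), Real.pow_rpow_inv_natCast hq hN0]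

end Walsh

/-! ### Unconditional sums of Walsh functions in `L²` -/

section WalshSums

variable {d : ℕ}

/-- The sites that occur an odd number of times in a list. -/
def oddSites (L : List (Site d)) : Finset (Site d) := L.toFinset.filter fun x => Odd (L.count x)

theorem mem_oddSites {L : List (Site d)} {x : Site d} : x ∈ oddSites L ↔ Odd (L.count x) := by
  unfold oddSites
  rw [Finset.mem_filter, List.mem_toFinset, and_iff_right_iff_imp]
  intro h
  exact List.count_pos_iff.1 h.pos

theorem card_oddSites_le (L : List (Site d)) : (oddSites L).card ≤ L.length :=
  (Finset.card_filter_le _ _).trans (List.toFinset_card_le L)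

theorem signProd_eq_walsh {s : ℕ} (m : Fin s → Site d) (ω : Sample d) :
    signProd m ω = walsh (oddSites (List.ofFn m)) ω := by
  have h1 : signProd m ω = ((List.ofFn m).map fun x => sgn x ω).prod := by
    rw [List.map_ofFn, List.prod_ofFn]
    rfl
  rw [h1, Finset.prod_list_map_count]
  unfold walsh oddSites
  rw [Finset.prod_filter]
  refine Finset.prod_congr rfl fun x _ => ?_
  split_ifs with h
  · obtain ⟨k, hk⟩ := h
    rw [hk, pow_succ, pow_mul, sgn_sq, one_pow, one_mul]
  · obtain ⟨k, hk⟩ := Nat.not_odd_iff_even.1 h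
    rw [hk, ← two_mul, pow_mul, sgn_sq, one_pow]

variable {ι : Type*} {F : ι → Lp ℝ 2 (P d)} {c : ι → ℝ} {g : ι → Finset (Site d)}

theorem sum_coeFn_ae (hF : ∀ i, F i =ᵐ[P d] fun ω => c i * walsh (g i) ω) (t : Finset ι) :
    (∑ i ∈ t, F i : Lp ℝ 2 (P d)) =ᵐ[P d] fun ω => ∑ i ∈ t, c i * walsh (g i) ω := by
  classical
  induction t using Finset.induction_on with
  | empty =>
    simp only [Finset.sum_empty]
    exact Lp.coeFn_zero ℝ 2 (P d)
  | insert i t hi ih =>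
    rw [Finset.sum_insert hi]
    filter_upwards [Lp.coeFn_add (F i) (∑ j ∈ t, F j), hF i, ih] with ω h1 h2 h3
    rw [h1, Pi.add_apply, h2, h3, Finset.sum_insert hi]

theorem integral_sum_walsh_sq (c : ι → ℝ) (g : ι → Finset (Site d)) (t : Finset ι) :
    ∫ ω, (∑ i ∈ t, c i * walsh (g i) ω) ^ 2 ∂P d =
      ∑ i ∈ t, ∑ j ∈ t, if g i = g j then c i * c j else 0 := by
  have hint : ∀ i j, Integrable (fun ω => c i * c j * (walsh (g i) ω * walsh (g j) ω)) (P d) := by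
    intro i j
    refine Integrable.const_mul (Integrable.of_bound (C := 1)
      ((measurable_walsh _).mul (measurable_walsh _)).aestronglyMeasurable
      (Filter.Eventually.of_forall fun ω => ?_)) _
    rw [Real.norm_eq_abs, Pi.mul_apply, abs_mul, abs_walsh, abs_walsh, one_mul]
  have e : ∀ ω, (∑ i ∈ t, c i * walsh (g i) ω) ^ 2 =
      ∑ i ∈ t, ∑ j ∈ t, c i * c j * (walsh (g i) ω * walsh (g j) ω) := by
    intro ω
    rw [sq, Finset.sum_mul_sum]
    refine Finset.sum_congr rfl fun i _ => Finset.sum_congr rfl fun j _ => by ring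
  simp_rw [e]
  rw [integral_finsetSum _ fun i _ => integrable_finsetSum _ fun j _ => hint i j]
  refine Finset.sum_congr rfl fun i _ => ?_
  rw [integral_finsetSum _ fun j _ => hint i j]
  refine Finset.sum_congr rfl fun j _ => ?_
  rw [integral_const_mul, integral_walsh_mul]
  simp

theorem ofReal_integral_sum_walsh_sq_le (c : ι → ℝ) (g : ι → Finset (Site d)) (t : Finset ι) :
    ENNReal.ofReal (∫ ω, (∑ i ∈ t, c i * walsh (g i) ω) ^ 2 ∂P d) ≤
      ∑ i ∈ t, ∑' j, if g i = g j then ENNReal.ofReal (|c i| * |c j|) else 0 := by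
  rw [integral_sum_walsh_sq]
  calc _ ≤ ENNReal.ofReal (∑ i ∈ t, ∑ j ∈ t, if g i = g j then |c i| * |c j| else 0) := by
        refine ENNReal.ofReal_le_ofReal (Finset.sum_le_sum fun i _ => Finset.sum_le_sum fun j _ => ?_)
        split_ifs
        · rw [← abs_mul]; exact le_abs_self _
        · exact le_rfl
    _ = ∑ i ∈ t, ∑ j ∈ t, if g i = g j then ENNReal.ofReal (|c i| * |c j|) else 0 := by
        have h0 : ∀ i j, 0 ≤ if g i = g j then |c i| * |c j| else 0 := fun i j => by
          split_ifs <;> positivity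
        rw [ENNReal.ofReal_sum_of_nonneg fun i _ => Finset.sum_nonneg fun j _ => h0 i j]
        refine Finset.sum_congr rfl fun i _ => ?_
        rw [ENNReal.ofReal_sum_of_nonneg fun j _ => h0 i j]
        refine Finset.sum_congr rfl fun j _ => ?_
        split_ifs <;> simp
    _ ≤ _ := Finset.sum_le_sum fun i _ => ENNReal.sum_le_tsum t

theorem norm_sq_eq_integral {X : Lp ℝ 2 (P d)} {f : Sample d → ℝ} (h : X =ᵐ[P d] f) :
    ‖X‖ ^ 2 = ∫ ω, f ω ^ 2 ∂P d := by
  rw [← real_inner_self_eq_norm_sq, L2.inner_def]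
  refine integral_congr_ae ?_
  filter_upwards [h] with ω hω
  rw [hω]
  simp [sq]

/-- A family of multiples of Walsh functions, several of which may be equal, is summable in `L²` as
soon as the sum over all pairs with the same Walsh function is finite. -/
theorem summable_walsh (hF : ∀ i, F i =ᵐ[P d] fun ω => c i * walsh (g i) ω)
    (hQ : ∑' i, ∑' j, (if g i = g j then ENNReal.ofReal (|c i| * |c j|) else 0) ≠ ⊤) :
    Summable F := by
  rw [summable_iff_vanishing_norm]
  intro ε hε
  have hs := ENNReal.summable_toReal hQ
  obtain ⟨s, hs⟩ := summable_iff_vanishing_norm.1 hs (ε ^ 2) (by positivity)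
  refine ⟨s, fun t ht => ?_⟩
  have h1 := hs t ht
  have h2 := ofReal_integral_sum_walsh_sq_le c g t
  rw [← norm_sq_eq_integral (sum_coeFn_ae hF t)] at h2
  have hfin : ∀ i ∈ t, ∑' j, (if g i = g j then ENNReal.ofReal (|c i| * |c j|) else 0) ≠ ⊤ :=
    fun i _ => ENNReal.ne_top_of_tsum_ne_top hQ i
  rw [← ENNReal.toReal_sum hfin, Real.norm_eq_abs, abs_of_nonneg ENNReal.toReal_nonneg] at h1
  have h3 := (ENNReal.ofReal_le_iff_le_toReal (ENNReal.sum_ne_top.2 hfin)).1 h2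
  exact lt_of_pow_lt_pow_left₀ 2 hε.le (h3.trans_lt h1)

/-- Moment bound for a sum of multiples of Walsh functions of bounded degree. -/
theorem exists_eLpNorm_tsum_walsh_le (d k : ℕ) (p : ℝ) : ∃ C : ℝ, 0 < C ∧
    ∀ {ι : Type} [Countable ι] {F : ι → Lp ℝ 2 (P d)} {c : ι → ℝ} {g : ι → Finset (Site d)},
    (∀ i, F i =ᵐ[P d] fun ω => c i * walsh (g i) ω) → (∀ i, (g i).card ≤ k) → ∀ q : ℝ, 0 ≤ q →
    ∑' i, ∑' j, (if g i = g j then ENNReal.ofReal (|c i| * |c j|) else 0) ≤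
      ENNReal.ofReal (q ^ 2) →
    Summable F ∧ eLpNorm (∑' i, F i : Lp ℝ 2 (P d)) (ENNReal.ofReal p) (P d) ≤
      ENNReal.ofReal (C * q) := by
  obtain ⟨C, hC, h⟩ := exists_eLpNorm_le (d := d) k p
  refine ⟨C, hC, fun {ι} _ {F c g} hF hg q hq hQ => ?_⟩
  have hsum := summable_walsh hF (ne_top_of_le_ne_top ENNReal.ofReal_ne_top hQ)
  refine ⟨hsum, ?_⟩
  refine eLpNorm_le_of_tendstoInMeasure (Filter.Eventually.of_forall fun t => ?_)
    (tendstoInMeasure_of_tendsto_Lp hsum.hasSum) fun t => Lp.aestronglyMeasurable _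
  rw [eLpNorm_congr_ae (sum_coeFn_ae hF t)]
  classical
  refine h (t.biUnion g) _ ?_ q hq ?_
  · have : (fun ω => ∑ i ∈ t, c i * walsh (g i) ω) = ∑ i ∈ t, c i • walsh (g i) := by
      funext ω; simp
    rw [this]
    exact Submodule.sum_mem _ fun i hi => Submodule.smul_mem _ _
      (walsh_mem_chaos (Finset.subset_biUnion_of_mem g hi) (hg i))
  · refine (ENNReal.ofReal_le_ofReal_iff (by positivity)).1 ?_
    exact (ofReal_integral_sum_walsh_sq_le c g t).trans ((ENNReal.sum_le_tsum t).trans hQ)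

end WalshSums

/-! ### Admissible tuples -/

section Admissible

variable {d : ℕ}

theorem cancels_of_prod_eq_one {s : ℕ} {m : Fin s → Site d} {s₁ s₂ : Fin s}
    (h : ∀ ω : Sample d, ∏ j ∈ Finset.Icc s₁ s₂, ω (m j) = 1) : Cancels m s₁ s₂ := by
  unfold Cancels
  rw [show {ω : Sample d | ∏ j ∈ Finset.Icc s₁ s₂, ω (m j) = 1} = Set.univ from
    Set.eq_univ_of_forall h]
  exact measure_univ

theorem Admissible.ne {s : ℕ} {m : Fin s → Site d} (hm : Admissible m) {i j : Fin s}
    (hij : (j : ℕ) = i + 1) : m i ≠ m j := by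
  intro h
  refine hm i j (by rw [Fin.lt_def]; omega) (cancels_of_prod_eq_one fun ω => ?_)
  have : Finset.Icc i j = {i, j} := by
    ext x
    simp only [Finset.mem_Icc, Finset.mem_insert, Finset.mem_singleton, Fin.le_def, Fin.ext_iff]
    omega
  rw [this, Finset.prod_pair (by rw [Ne, Fin.ext_iff]; omega), h]
  exact Int.units_mul_self _

theorem Admissible.not_alternating {s : ℕ} {m : Fin s → Site d} (hm : Admissible m)
    {i j k l : Fin s} (hij : (j : ℕ) = i + 1) (hjk : (k : ℕ) = i + 2) (hkl : (l : ℕ) = i + 3) :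
    ¬ (m i = m k ∧ m j = m l) := by
  rintro ⟨h, h'⟩
  refine hm i l (by rw [Fin.lt_def]; omega) (cancels_of_prod_eq_one fun ω => ?_)
  have : Finset.Icc i l = {i, j, k, l} := by
    ext x
    simp only [Finset.mem_Icc, Finset.mem_insert, Finset.mem_singleton, Fin.le_def, Fin.ext_iff]
    omega
  rw [this, Finset.prod_insert, Finset.prod_insert, Finset.prod_pair, h, h']
  · have e1 := Int.units_mul_self (ω (m k))
    have e2 := Int.units_mul_self (ω (m l))
    calc _ = (ω (m k) * ω (m k)) * (ω (m l) * ω (m l)) := by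
          rw [mul_left_comm (ω (m l)), ← mul_assoc]
      _ = 1 := by rw [e1, e2, one_mul]
  all_goals
    simp only [Finset.mem_insert, Finset.mem_singleton, Fin.ext_iff, Ne]
    omega

end Admissible

/-! ### Removing a site from a path -/

section Paths

variable {d : ℕ}

/-- The decay `|x|^{-(d-2)}` of the free Green's function. -/
noncomputable def greenDecay (x : Site d) : ℝ := size x ^ (-(d - 2 : ℝ))

theorem greenDecay_pos (x : Site d) : 0 < greenDecay x := Real.rpow_pos_of_pos (size_pos x) _

theorem greenDecay_le_one (hd : 2 ≤ d) (x : Site d) : greenDecay x ≤ 1 := by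
  have : (2 : ℝ) ≤ d := by exact_mod_cast hd
  exact Real.rpow_le_one_of_one_le_of_nonpos (one_le_size x) (by linarith)

/-- What remains of a site `x` once it is removed from between its neighbours `l` and `r`: a
function of `x` that is square summable uniformly in `l` and `r` when `d ≥ 5`. -/
noncomputable def bump (l r x : Site d) : ℝ :=
  (greenDecay (l - x) + greenDecay (x - r) + greenDecay x) / 3

theorem bump_pos (l r x : Site d) : 0 < bump l r x := by
  have := greenDecay_pos (l - x)
  have := greenDecay_pos (x - r)
  have := greenDecay_pos x
  unfold bump
  positivity

theorem bump_le_one (hd : 2 ≤ d) (l r x : Site d) : bump l r x ≤ 1 := by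
  have := greenDecay_le_one hd (l - x)
  have := greenDecay_le_one hd (x - r)
  have := greenDecay_le_one hd x
  unfold bump
  linarith

theorem exists_tsum_bump_sq_le (hd : 5 ≤ d) : ∃ C : ℝ, 0 < C ∧ ∀ l r : Site d,
    ∑' x, ENNReal.ofReal (bump l r x ^ 2) ≤ ENNReal.ofReal C := by
  have hdR : (5 : ℝ) ≤ d := by exact_mod_cast hd
  obtain ⟨C, hC, h⟩ := exists_tsum_size_rpow_le (d := d) (c := 2 * (d - 2 : ℝ)) (by linarith)
  have e : ∀ x : Site d, greenDecay x ^ 2 = size x ^ (-(2 * (d - 2 : ℝ))) := fun x => by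
    unfold greenDecay
    rw [← Real.rpow_natCast, ← Real.rpow_mul (size_pos x).le]
    congr 1
    push_cast
    ring
  simp_rw [← e] at h
  refine ⟨C + C + C, by positivity, fun l r => ?_⟩
  refine (tsum_ofReal_mono_le (g := fun x => greenDecay (l - x) ^ 2 + greenDecay (x - r) ^ 2 +
    greenDecay x ^ 2) (fun x => ?_) ?_)
  · unfold bump
    nlinarith [sq_nonneg (greenDecay (l - x) - greenDecay (x - r)), sq_nonneg (greenDecay x),
      sq_nonneg (greenDecay (l - x) - greenDecay x), sq_nonneg (greenDecay x - greenDecay (x - r)),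
      sq_nonneg (greenDecay (l - x)), sq_nonneg (greenDecay (x - r))]
  · refine tsum_ofReal_add_le (by positivity) hC.le (tsum_ofReal_add_le hC.le hC.le ?_ ?_) h
    · rw [tsum_sub_left l fun y => ENNReal.ofReal (greenDecay y ^ 2)]; exact h
    · rw [tsum_sub_right r fun y => ENNReal.ofReal (greenDecay y ^ 2)]; exact h

/-- Removing a site `x` between `l` and `r`. If `|x|` is not small compared with `ν`, a lower bound
for `|l|` and `|r|`, then its weight is harmless; otherwise both steps are at least `ν / 2` and part
of their decay pays for replacing `|x|` by `ν`. -/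
theorem greenDecay_mul_le (hd : 2 ≤ d) {B ν : ℝ} (hB : 0 ≤ B) (hBd : B ≤ d - 2) (hν : 0 < ν)
    {l r : Site d} (hl : ν ≤ size l) (hr : ν ≤ size r) (x : Site d) :
    greenDecay (l - x) * greenDecay (x - r) * min (size x) ν ^ (-B) ≤
      3 * (2 ^ (d - 2 : ℝ) * 2 ^ B) * (greenDecay (l - r) * ν ^ (-B) * bump l r x) := by
  have hb : (0 : ℝ) ≤ d - 2 := by
    have : (2 : ℝ) ≤ d := by exact_mod_cast hd
    linarith
  set b : ℝ := d - 2 with hbdef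
  have ht := size_pos (l - x)
  have hu := size_pos (x - r)
  have hx := size_pos x
  set D := min (size (l - x)) (size (x - r)) with hD
  have hD0 : 0 < D := lt_min ht hu
  have h1 : greenDecay (l - x) * greenDecay (x - r) ≤ 2 ^ b * (greenDecay (l - r) * D ^ (-b)) :=
    two_point_le hb hD0 (min_le_left _ _) (min_le_right _ _) (size_pos _) (size_sub_le l x r)
  have g1 := greenDecay_pos (l - r)
  have g2 := greenDecay_pos (l - x)
  have g3 := greenDecay_pos (x - r)
  have g4 := greenDecay_pos x
  have h2 : D ^ (-b) * min (size x) ν ^ (-B) ≤ 2 ^ B * (ν ^ (-B) * (3 * bump l r x)) := by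
    rcases le_or_gt ν (2 * size x) with h | h
    · have e1 : min (size x) ν ^ (-B) ≤ 2 ^ B * ν ^ (-B) := by
        refine rpow_neg_le_of_le_mul hν two_pos hB ?_
        rw [mul_min_of_nonneg _ _ zero_le_two]
        exact le_min h (by linarith)
      have e2 : D ^ (-b) ≤ 3 * bump l r x := by
        have : D ^ (-b) ≤ greenDecay (l - x) + greenDecay (x - r) := rpow_min_le ht hu
        unfold bump
        linarith
      have e3 := (bump_pos l r x).le
      calc _ ≤ (3 * bump l r x) * (2 ^ B * ν ^ (-B)) := by gcongr
        _ = _ := by ring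
    · have a1 := size_le_sub l x
      have a2 := size_le_sub' x r
      have hDν : ν ≤ 2 * D := by
        rw [hD, mul_min_of_nonneg _ _ zero_le_two]
        exact le_min (by linarith) (by linarith)
      have e1 : D ^ (-B) ≤ 2 ^ B * ν ^ (-B) := rpow_neg_le_of_le_mul hν two_pos hB hDν
      have e2 : D ^ (-(b - B)) ≤ size x ^ (-(b - B)) :=
        Real.rpow_le_rpow_of_nonpos hx (by linarith) (by linarith)
      have e3 : greenDecay x ≤ 3 * bump l r x := by unfold bump; linarith
      rw [min_eq_left (by linarith)]
      calc D ^ (-b) * size x ^ (-B) = D ^ (-B) * D ^ (-(b - B)) * size x ^ (-B) := by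
            rw [← Real.rpow_add hD0]; congr 2; ring
        _ ≤ (2 ^ B * ν ^ (-B)) * size x ^ (-(b - B)) * size x ^ (-B) := by gcongr
        _ = 2 ^ B * (ν ^ (-B) * greenDecay x) := by
            rw [mul_assoc, ← Real.rpow_add hx, mul_assoc]
            unfold greenDecay
            congr 4
            ring
        _ ≤ _ := by gcongr
  have hm := Real.rpow_nonneg (le_min hx.le hν.le) (-B)
  calc _ ≤ 2 ^ b * (greenDecay (l - r) * D ^ (-b)) * min (size x) ν ^ (-B) := by gcongr
    _ = 2 ^ b * greenDecay (l - r) * (D ^ (-b) * min (size x) ν ^ (-B)) := by ring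
    _ ≤ 2 ^ b * greenDecay (l - r) * (2 ^ B * (ν ^ (-B) * (3 * bump l r x))) := by gcongr
    _ = _ := by ring

/-- The product of `|x - y|^{-(d-2)}` over the steps `(x, y)` of a path. -/
noncomputable def pathDecay (n : Site d) : List (Site d) → Site d → ℝ
  | [], n' => greenDecay (n - n')
  | x :: L, n' => greenDecay (n - x) * pathDecay x L n'

theorem pathDecay_pos (n : Site d) (L : List (Site d)) (n' : Site d) : 0 < pathDecay n L n' := by
  induction L generalizing n with
  | nil => exact greenDecay_pos _
  | cons x L ih => exact mul_pos (greenDecay_pos _) (ih x)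

/-- The minimum of `R` and of the sizes of the sites in a list. -/
noncomputable def minSize (R : ℝ) : List (Site d) → ℝ
  | [] => R
  | x :: L => min (size x) (minSize R L)

theorem minSize_pos {R : ℝ} (hR : 0 < R) (L : List (Site d)) : 0 < minSize R L := by
  induction L with
  | nil => exact hR
  | cons x L ih => exact lt_min (size_pos x) ih

theorem minSize_le (R : ℝ) (L : List (Site d)) : minSize R L ≤ R := by
  induction L with
  | nil => exact le_rfl
  | cons x L ih => exact (min_le_right _ _).trans ih

theorem minSize_le_size (R : ℝ) {L : List (Site d)} {x : Site d} (hx : x ∈ L) :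
    minSize R L ≤ size x := by
  induction L with
  | nil => simp at hx
  | cons y L ih =>
    rcases List.mem_cons.1 hx with rfl | h
    · exact min_le_left _ _
    · exact (min_le_right _ _).trans (ih h)

/-- Insert the site `a` into a list, in front of the `i`-th entry (or at the end) when the `i`-th
entry of the mask is `true`. Two inserted copies of `a` are never adjacent when `a` is new. -/
def insertAt : List Bool → Site d → List (Site d) → List (Site d)
  | [], _, L => L
  | b :: _, a, [] => if b then [a] else []
  | b :: μ, a, x :: L => if b then a :: x :: insertAt μ a L else x :: insertAt μ a L

/-- The product of the `bump`s of all copies of `a` inserted by `insertAt` (and `0` if the mask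
does not fit). -/
noncomputable def bumpProd (n : Site d) : List Bool → Site d → List (Site d) → Site d → ℝ
  | [], _, _, _ => 1
  | b :: μ, a, [], n' => (if b then bump n n' a else 1) * if μ = [] then 1 else 0
  | b :: μ, a, x :: L, n' => (if b then bump n x a else 1) * bumpProd x μ a L n'

/-- The sum of the squared `bump`s of all copies of `a` inserted by `insertAt`. -/
noncomputable def bumpSum (n : Site d) : List Bool → Site d → List (Site d) → Site d → ℝ
  | [], _, _, _ => 0
  | b :: _, a, [], n' => if b then bump n n' a ^ 2 else 0
  | b :: μ, a, x :: L, n' => (if b then bump n x a ^ 2 else 0) + bumpSum x μ a L n'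

theorem bumpProd_nonneg (n : Site d) (μ : List Bool) (a : Site d) (L : List (Site d))
    (n' : Site d) : 0 ≤ bumpProd n μ a L n' := by
  induction L generalizing n μ with
  | nil =>
    cases μ with
    | nil => exact zero_le_one
    | cons b μ =>
      refine mul_nonneg ?_ (by split_ifs <;> simp)
      split_ifs
      exacts [(bump_pos _ _ _).le, zero_le_one]
  | cons x L ih =>
    cases μ with
    | nil => exact zero_le_one
    | cons b μ =>
      refine mul_nonneg ?_ (ih x μ)
      split_ifs
      exacts [(bump_pos _ _ _).le, zero_le_one]

theorem bumpProd_le_one (hd : 2 ≤ d) (n : Site d) (μ : List Bool) (a : Site d) (L : List (Site d))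
    (n' : Site d) : bumpProd n μ a L n' ≤ 1 := by
  induction L generalizing n μ with
  | nil =>
    cases μ with
    | nil => exact le_rfl
    | cons b μ =>
      refine mul_le_one₀ ?_ (by split_ifs <;> simp) (by split_ifs <;> simp)
      split_ifs
      exacts [bump_le_one hd _ _ _, le_rfl]
  | cons x L ih =>
    cases μ with
    | nil => exact le_rfl
    | cons b μ =>
      refine mul_le_one₀ ?_ (bumpProd_nonneg _ _ _ _ _) (ih x μ)
      split_ifs
      exacts [bump_le_one hd _ _ _, le_rfl]

theorem bumpSum_nonneg (n : Site d) (μ : List Bool) (a : Site d) (L : List (Site d))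
    (n' : Site d) : 0 ≤ bumpSum n μ a L n' := by
  induction L generalizing n μ with
  | nil =>
    cases μ with
    | nil => exact le_rfl
    | cons b μ => unfold bumpSum; split_ifs <;> positivity
  | cons x L ih =>
    cases μ with
    | nil => exact le_rfl
    | cons b μ =>
      refine add_nonneg ?_ (ih x μ)
      split_ifs <;> positivity

theorem bumpProd_sq_le (hd : 2 ≤ d) {n : Site d} {μ : List Bool} {a : Site d} {L : List (Site d)}
    {n' : Site d} (h : 1 ≤ μ.count true) : bumpProd n μ a L n' ^ 2 ≤ bumpSum n μ a L n' := by
  induction L generalizing n μ with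
  | nil =>
    cases μ with
    | nil => simp at h
    | cons b μ =>
      unfold bumpProd bumpSum
      cases b with
      | true =>
        by_cases hm : μ = []
        · simp [hm]
        · simp [hm, sq_nonneg]
      | false =>
        have : μ ≠ [] := by rintro rfl; simp at h
        simp [this]
  | cons x L ih =>
    cases μ with
    | nil => simp at h
    | cons b μ =>
      unfold bumpProd bumpSum
      cases b with
      | true =>
        have h1 := bumpProd_le_one hd x μ a L n'
        have h0 := bumpProd_nonneg x μ a L n'
        have h2 := bumpSum_nonneg x μ a L n'
        have h3 : bumpProd x μ a L n' ^ 2 ≤ 1 := pow_le_one₀ h0 h1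
        simp only [if_true, mul_pow]
        nlinarith [sq_nonneg (bump n x a)]
      | false =>
        simp only [Bool.false_eq_true, if_false, one_mul, zero_add]
        exact ih (by simpa using h)

theorem bumpProd_le (hd : 2 ≤ d) {n : Site d} {μ : List Bool} {a : Site d} {L : List (Site d)}
    {n' : Site d} (h : 2 ≤ μ.count true) : bumpProd n μ a L n' ≤ bumpSum n μ a L n' := by
  induction L generalizing n μ with
  | nil =>
    cases μ with
    | nil => simp at h
    | cons b μ =>
      have : μ ≠ [] := by
        rintro rfl
        cases b <;> simp at h
      have h0 := bumpSum_nonneg n (b :: μ) a [] n'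
      unfold bumpProd
      rw [if_neg this, mul_zero]
      exact h0
  | cons x L ih =>
    cases μ with
    | nil => simp at h
    | cons b μ =>
      unfold bumpProd bumpSum
      cases b with
      | true =>
        have h1 := bumpProd_sq_le hd (n := x) (a := a) (L := L) (n' := n') (μ := μ)
          (by simpa using h)
        simp only [if_true]
        nlinarith [sq_nonneg (bump n x a - bumpProd x μ a L n'), sq_nonneg (bump n x a),
          bumpSum_nonneg x μ a L n']
      | false =>
        simp only [Bool.false_eq_true, if_false, one_mul, zero_add]
        exact ih (by simpa using h)

theorem tsum_bumpSum_le {C : ℝ} (hC : 0 ≤ C)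
    (h : ∀ l r : Site d, ∑' x, ENNReal.ofReal (bump l r x ^ 2) ≤ ENNReal.ofReal C)
    (n : Site d) (μ : List Bool) (L : List (Site d)) (n' : Site d) :
    ∑' a, ENNReal.ofReal (bumpSum n μ a L n') ≤ ENNReal.ofReal (μ.length * C) := by
  have h' : ∀ (b : Bool) (l r : Site d),
      ∑' x, ENNReal.ofReal (if b then bump l r x ^ 2 else 0) ≤ ENNReal.ofReal C := by
    intro b l r
    cases b
    · simp
    · simpa using h l r
  induction L generalizing n μ with
  | nil =>
    cases μ with
    | nil => simp [bumpSum]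
    | cons b μ =>
      unfold bumpSum
      refine (h' b n n').trans (ENNReal.ofReal_le_ofReal ?_)
      have : (0 : ℝ) ≤ μ.length := by positivity
      rw [List.length_cons]
      push_cast
      nlinarith
  | cons x L ih =>
    cases μ with
    | nil => simp [bumpSum]
    | cons b μ =>
      unfold bumpSum
      rw [List.length_cons]
      push_cast
      rw [add_comm (μ.length : ℝ), add_mul, one_mul]
      exact tsum_ofReal_add_le hC (by positivity) (h' b n x) (ih x μ)

theorem mem_insertAt {μ : List Bool} {a x : Site d} {L : List (Site d)}
    (h : x ∈ insertAt μ a L) : x = a ∨ x ∈ L := by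
  induction L generalizing μ with
  | nil =>
    cases μ with
    | nil => exact Or.inr h
    | cons b μ => cases b <;> simp_all [insertAt]
  | cons y L ih =>
    cases μ with
    | nil => exact Or.inr h
    | cons b μ =>
      cases b
      · simp only [insertAt, Bool.false_eq_true, if_false, List.mem_cons] at h ⊢
        rcases h with h | h
        · tauto
        · rcases ih h with h | h <;> tauto
      · simp only [insertAt, if_true, List.mem_cons] at h ⊢
        rcases h with h | h | h
        · tauto
        · tauto
        · rcases ih h with h | h <;> tauto

theorem le_minSize {R c : ℝ} {L : List (Site d)} (hR : c ≤ R) (h : ∀ x ∈ L, c ≤ size x) :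
    c ≤ minSize R L := by
  induction L with
  | nil => exact hR
  | cons x L ih =>
    exact le_min (h x List.mem_cons_self) (ih fun y hy => h y (List.mem_cons_of_mem _ hy))

theorem length_insertAt {μ : List Bool} {a : Site d} {L : List (Site d)}
    (h : μ.length ≤ L.length + 1) :
    (insertAt μ a L).length = L.length + μ.count true := by
  induction L generalizing μ with
  | nil =>
    cases μ with
    | nil => rfl
    | cons b μ =>
      have : μ = [] := List.eq_nil_of_length_eq_zero (by simpa using h)
      subst this
      cases b <;> rfl
  | cons y L ih =>
    cases μ with
    | nil => rfl
    | cons b μ =>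
      have := ih (μ := μ) (by simpa using h)
      cases b <;> simp [insertAt, this] <;> omega

theorem count_insertAt_of_ne {μ : List Bool} {a x : Site d} (hx : x ≠ a) (L : List (Site d)) :
    (insertAt μ a L).count x = L.count x := by
  have hx' : a ≠ x := hx.symm
  induction L generalizing μ with
  | nil =>
    cases μ with
    | nil => rfl
    | cons b μ => cases b <;> simp [insertAt, hx']
  | cons y L ih =>
    cases μ with
    | nil => rfl
    | cons b μ => cases b <;> simp [insertAt, List.count_cons, ih, hx']

theorem count_insertAt_self {μ : List Bool} {a : Site d} {L : List (Site d)} (ha : a ∉ L)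
    (h : μ.length ≤ L.length + 1) : (insertAt μ a L).count a = μ.count true := by
  induction L generalizing μ with
  | nil =>
    cases μ with
    | nil => rfl
    | cons b μ =>
      have : μ = [] := List.eq_nil_of_length_eq_zero (by simpa using h)
      subst this
      cases b <;> simp [insertAt]
  | cons y L ih =>
    rw [List.mem_cons, not_or] at ha
    cases μ with
    | nil =>
      simp only [insertAt, List.count_nil]
      exact List.count_eq_zero.2 (by simp [ha.1, ha.2])
    | cons b μ =>
      have := ih (μ := μ) ha.2 (by simpa using h)
      have hy : y ≠ a := fun h => ha.1 h.symm
      cases b <;> simp [insertAt, this, hy]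

/-- Removing from a path all copies of a site, no two of which are adjacent. -/
theorem pathDecay_insertAt_le {C θ ν : ℝ} (hC : 0 ≤ C) (hθ : 0 ≤ θ) {a n' : Site d}
    (hn' : ν ≤ size n')
    (h : ∀ l r : Site d, ν ≤ size l → ν ≤ size r →
      greenDecay (l - a) * greenDecay (a - r) * θ ≤ C * (greenDecay (l - r) * bump l r a))
    {n : Site d} (hn : ν ≤ size n) {μ : List Bool} {L : List (Site d)}
    (hL : ∀ x ∈ L, ν ≤ size x) (hμ : μ.length ≤ L.length + 1) :
    pathDecay n (insertAt μ a L) n' * θ ^ μ.count true ≤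
      C ^ μ.count true * (pathDecay n L n' * bumpProd n μ a L n') := by
  induction L generalizing n μ with
  | nil =>
    cases μ with
    | nil => simp [insertAt, bumpProd]
    | cons b μ =>
      have : μ = [] := List.eq_nil_of_length_eq_zero (by simpa using hμ)
      subst this
      cases b
      · simp [insertAt, bumpProd]
      · simpa [insertAt, bumpProd, pathDecay] using h n n' hn hn'
  | cons x L ih =>
    cases μ with
    | nil => simp [insertAt, bumpProd]
    | cons b μ =>
      have hx : ν ≤ size x := hL x List.mem_cons_self
      have key := ih hx (μ := μ) (fun y hy => hL y (List.mem_cons_of_mem _ hy)) (by simpa using hμ)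
      have g := greenDecay_pos (n - x)
      have p1 := pathDecay_pos x (insertAt μ a L) n'
      cases b
      · simp only [insertAt, bumpProd, pathDecay, Bool.false_eq_true, if_false, one_mul,
          ne_eq, not_false_eq_true, List.count_cons_of_ne]
        calc _ = greenDecay (n - x) * (pathDecay x (insertAt μ a L) n' * θ ^ μ.count true) := by
              ring
          _ ≤ greenDecay (n - x) *
              (C ^ μ.count true * (pathDecay x L n' * bumpProd x μ a L n')) := by gcongr
          _ = _ := by ring
      · simp only [insertAt, bumpProd, pathDecay, if_true, List.count_cons_self]
        have h0 := h n x hn hx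
        have b0 := bump_pos n x a
        calc _ = (greenDecay (n - a) * greenDecay (a - x) * θ) *
              (pathDecay x (insertAt μ a L) n' * θ ^ μ.count true) := by ring
          _ ≤ (C * (greenDecay (n - x) * bump n x a)) *
              (C ^ μ.count true * (pathDecay x L n' * bumpProd x μ a L n')) := by gcongr
          _ = _ := by ring

/-- The decay of a path together with the weight `|·|^{-B}` of its site closest to the origin. -/
noncomputable def pathWeight (B : ℝ) (n : Site d) (L : List (Site d)) (n' : Site d) : ℝ :=
  pathDecay n L n' * minSize (min (size n) (size n')) L ^ (-B)

theorem pathWeight_insertAt_le (hd : 2 ≤ d) {B : ℝ} (hB : 0 ≤ B) (hBd : B ≤ d - 2) {n n' a : Site d}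
    {μ : List Bool} {L : List (Site d)} (hμ : μ.length ≤ L.length + 1) (h1 : 1 ≤ μ.count true) :
    pathWeight B n (insertAt μ a L) n' ≤ (3 * (2 ^ (d - 2 : ℝ) * 2 ^ B)) ^ μ.count true *
      (pathWeight B n L n' * bumpProd n μ a L n') := by
  set R := min (size n) (size n') with hR
  have hR0 : 0 < R := lt_min (size_pos n) (size_pos n')
  set ν := minSize R L with hνdef
  have hν : 0 < ν := minSize_pos hR0 L
  have hνn : ν ≤ size n := (minSize_le R L).trans (min_le_left _ _)
  have hνn' : ν ≤ size n' := (minSize_le R L).trans (min_le_right _ _)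
  have hm : 0 < min (size a) ν := lt_min (size_pos a) hν
  set θ := min (size a) ν ^ (-B) * ν ^ B with hθ
  have hνB : ν ^ (-B) * ν ^ B = 1 := by rw [← Real.rpow_add hν]; simp
  have hνp : 0 < ν ^ B := Real.rpow_pos_of_pos hν B
  have hνp' : 0 < ν ^ (-B) := Real.rpow_pos_of_pos hν _
  have hθ1 : 1 ≤ θ := by
    rw [← hνB]
    exact mul_le_mul_of_nonneg_right
      (Real.rpow_le_rpow_of_nonpos hm (min_le_right _ _) (by linarith)) hνp.le
  have key := pathDecay_insertAt_le (C := 3 * (2 ^ (d - 2 : ℝ) * 2 ^ B)) (θ := θ) (ν := ν)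
    (by positivity) (by positivity) hνn' (a := a) (fun l r hl hr => by
      have := mul_le_mul_of_nonneg_right (greenDecay_mul_le hd hB hBd hν hl hr a) hνp.le
      calc _ = greenDecay (l - a) * greenDecay (a - r) * min (size a) ν ^ (-B) * ν ^ B := by
            rw [hθ]; ring
        _ ≤ _ := this
        _ = 3 * (2 ^ (d - 2 : ℝ) * 2 ^ B) * (greenDecay (l - r) * bump l r a) *
            (ν ^ (-B) * ν ^ B) := by ring
        _ = _ := by rw [hνB, mul_one]) hνn (μ := μ) (L := L)
      (fun x hx => minSize_le_size R hx) hμ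
  have hmin : minSize R (insertAt μ a L) ^ (-B) ≤ θ ^ μ.count true * ν ^ (-B) := by
    have e1 : min (size a) ν ≤ minSize R (insertAt μ a L) := by
      refine le_minSize ((min_le_right _ _).trans (minSize_le R L)) fun x hx => ?_
      rcases mem_insertAt hx with rfl | hx
      · exact min_le_left _ _
      · exact (min_le_right _ _).trans (minSize_le_size R hx)
    calc _ ≤ min (size a) ν ^ (-B) := Real.rpow_le_rpow_of_nonpos hm e1 (by linarith)
      _ = θ * ν ^ (-B) := by rw [hθ, mul_assoc, mul_comm (ν ^ B), hνB, mul_one]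
      _ ≤ _ := by
        gcongr
        exact le_self_pow₀ hθ1 (by omega)
  unfold pathWeight
  have p1 := pathDecay_pos n (insertAt μ a L) n'
  calc _ ≤ pathDecay n (insertAt μ a L) n' * (θ ^ μ.count true * ν ^ (-B)) := by gcongr
    _ = pathDecay n (insertAt μ a L) n' * θ ^ μ.count true * ν ^ (-B) := by ring
    _ ≤ _ := mul_le_mul_of_nonneg_right key hνp'.le
    _ = _ := by ring

end Paths

/-! ### Decomposing words letter by letter -/

section Words

variable {d : ℕ}

/-- The word obtained by inserting the letters `z (k-1), …, z 0` one after the other, with masks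
`σ (k-1), …, σ 0`. -/
def word : (k : ℕ) → (Fin k → List Bool) → (Fin k → Site d) → List (Site d)
  | 0, _, _ => []
  | k + 1, σ, z => insertAt (σ 0) (z 0) (word k (Fin.tail σ) (Fin.tail z))

/-- Each letter is new, is inserted at least once, and its mask fits. -/
def IsDecomposition : (k : ℕ) → (Fin k → List Bool) → (Fin k → Site d) → Prop
  | 0, _, _ => True
  | k + 1, σ, z => 1 ≤ (σ 0).count true ∧
      (σ 0).length ≤ (word k (Fin.tail σ) (Fin.tail z)).length + 1 ∧
      z 0 ∉ word k (Fin.tail σ) (Fin.tail z) ∧ IsDecomposition k (Fin.tail σ) (Fin.tail z)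

/-- The product over the letters of a function of the mask, of the letter and of the word into
which it is inserted. -/
noncomputable def letterProd (φ : List Bool → Site d → List (Site d) → ℝ) :
    (k : ℕ) → (Fin k → List Bool) → (Fin k → Site d) → ℝ
  | 0, _, _ => 1
  | k + 1, σ, z => φ (σ 0) (z 0) (word k (Fin.tail σ) (Fin.tail z)) *
      letterProd φ k (Fin.tail σ) (Fin.tail z)

theorem letterProd_nonneg {φ : List Bool → Site d → List (Site d) → ℝ} (h : ∀ μ a L, 0 ≤ φ μ a L)
    (k : ℕ) (σ : Fin k → List Bool) (z : Fin k → Site d) : 0 ≤ letterProd φ k σ z := by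
  induction k with
  | zero => exact zero_le_one
  | succ k ih => exact mul_nonneg (h _ _ _) (ih _ _)

theorem letterProd_mul (φ ψ : List Bool → Site d → List (Site d) → ℝ)
    (k : ℕ) (σ : Fin k → List Bool) (z : Fin k → Site d) :
    letterProd φ k σ z * letterProd ψ k σ z =
      letterProd (fun μ a L => φ μ a L * ψ μ a L) k σ z := by
  induction k with
  | zero => simp [letterProd]
  | succ k ih =>
    unfold letterProd
    rw [← ih]
    ring

theorem tsum_letterProd_le {φ : List Bool → Site d → List (Site d) → ℝ}
    (h0 : ∀ μ a L, 0 ≤ φ μ a L) {C : ℝ} (hC : 0 ≤ C) (k : ℕ) (σ : Fin k → List Bool)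
    (h : ∀ i L, ∑' a, ENNReal.ofReal (φ (σ i) a L) ≤ ENNReal.ofReal C) :
    ∑' z, ENNReal.ofReal (letterProd φ k σ z) ≤ ENNReal.ofReal (C ^ k) := by
  induction k with
  | zero => simp [letterProd, tsum_fintype]
  | succ k ih =>
    rw [← (Fin.consEquiv fun _ : Fin (k + 1) => Site d).tsum_eq, ENNReal.tsum_prod',
      ENNReal.tsum_comm]
    have e : ∀ (z : Fin k → Site d) (a : Site d),
        ENNReal.ofReal (letterProd φ (k + 1) σ (Fin.consEquiv (fun _ => Site d) (a, z))) =
          ENNReal.ofReal (letterProd φ k (Fin.tail σ) z) *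
            ENNReal.ofReal (φ (σ 0) a (word k (Fin.tail σ) z)) := by
      intro z a
      rw [← ENNReal.ofReal_mul (letterProd_nonneg h0 _ _ _), mul_comm]
      rfl
    simp_rw [e, ENNReal.tsum_mul_left]
    calc _ ≤ ∑' z, ENNReal.ofReal (letterProd φ k (Fin.tail σ) z) * ENNReal.ofReal C :=
          ENNReal.tsum_le_tsum fun z => mul_le_mul_right (h 0 _) _
      _ ≤ ENNReal.ofReal (C ^ k) * ENNReal.ofReal C := by
          rw [ENNReal.tsum_mul_right]
          exact mul_le_mul_left (ih (Fin.tail σ) fun i L => h i.succ L) _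
      _ = _ := by rw [← ENNReal.ofReal_mul (by positivity), pow_succ]

theorem IsDecomposition.one_le_count {k : ℕ} {σ : Fin k → List Bool} {z : Fin k → Site d}
    (h : IsDecomposition k σ z) (i : Fin k) : 1 ≤ (σ i).count true := by
  induction k with
  | zero => exact i.elim0
  | succ k ih => exact Fin.cases h.1 (fun i => ih h.2.2.2 i) i

theorem IsDecomposition.count_eq {k : ℕ} {σ : Fin k → List Bool} {z : Fin k → Site d}
    (h : IsDecomposition k σ z) (i : Fin k) : (word k σ z).count (z i) = (σ i).count true := by
  induction k with
  | zero => exact i.elim0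
  | succ k ih =>
    obtain ⟨-, h2, h3, h4⟩ := h
    refine Fin.cases ?_ (fun i => ?_) i
    · exact count_insertAt_self h3 h2
    · have e := ih h4 i
      have h1 : 1 ≤ (Fin.tail σ i).count true := h4.one_le_count i
      have hmem : Fin.tail z i ∈ word k (Fin.tail σ) (Fin.tail z) :=
        List.count_pos_iff.1 (by omega)
      refine Eq.trans (count_insertAt_of_ne (fun h => h3 ?_) _) e
      rw [← h]
      exact hmem

theorem IsDecomposition.le_length {k : ℕ} {σ : Fin k → List Bool} {z : Fin k → Site d}
    (h : IsDecomposition k σ z) : k ≤ (word k σ z).length := by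
  induction k with
  | zero => exact Nat.zero_le _
  | succ k ih =>
    obtain ⟨h1, h2, -, h4⟩ := h
    have := ih h4
    have e := length_insertAt (a := z 0) h2
    unfold word
    omega

theorem IsDecomposition.length_le {k : ℕ} {σ : Fin k → List Bool} {z : Fin k → Site d}
    (h : IsDecomposition k σ z) (i : Fin k) : (σ i).length ≤ (word k σ z).length + 1 := by
  induction k with
  | zero => exact i.elim0
  | succ k ih =>
    obtain ⟨h1, h2, -, h4⟩ := h
    have e := length_insertAt (a := z 0) h2
    unfold word
    refine Fin.cases ?_ (fun i => ?_) i
    · omega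
    · have : (σ i.succ).length ≤ _ := ih h4 i
      omega

theorem IsDecomposition.pathWeight_le (hd : 2 ≤ d) {B : ℝ} (hB : 0 ≤ B) (hBd : B ≤ d - 2)
    (n n' : Site d) {k : ℕ} {σ : Fin k → List Bool} {z : Fin k → Site d}
    (h : IsDecomposition k σ z) :
    pathWeight B n (word k σ z) n' ≤
      (3 * (2 ^ (d - 2 : ℝ) * 2 ^ B)) ^ (word k σ z).length *
        (modelKernel d B n n' * letterProd (fun μ a L => bumpProd n μ a L n') k σ z) := by
  induction k with
  | zero =>
    simp only [word, letterProd, List.length_nil, pow_zero, one_mul, mul_one]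
    unfold pathWeight pathDecay minSize modelKernel greenDecay
    rw [mul_comm]
  | succ k ih =>
    obtain ⟨h1, h2, -, h4⟩ := h
    set C : ℝ := 3 * (2 ^ (d - 2 : ℝ) * 2 ^ B)
    have e := length_insertAt (a := z 0) h2
    have b0 := bumpProd_nonneg n (σ 0) (z 0) (word k (Fin.tail σ) (Fin.tail z)) n'
    have := ih h4
    unfold word letterProd
    rw [e, pow_add]
    calc _ ≤ C ^ (σ 0).count true * (pathWeight B n (word k (Fin.tail σ) (Fin.tail z)) n' *
          bumpProd n (σ 0) (z 0) (word k (Fin.tail σ) (Fin.tail z)) n') :=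
          pathWeight_insertAt_le hd hB hBd h2 h1
      _ ≤ C ^ (σ 0).count true * ((C ^ (word k (Fin.tail σ) (Fin.tail z)).length *
          (modelKernel d B n n' * letterProd (fun μ a L => bumpProd n μ a L n') k (Fin.tail σ)
            (Fin.tail z))) *
          bumpProd n (σ 0) (z 0) (word k (Fin.tail σ) (Fin.tail z)) n') := by gcongr
      _ = _ := by ring

/-- The word `L` can be emptied by removing its letters one after the other, no two copies of a
letter being adjacent when it is removed. -/
def Decomposable (L : List (Site d)) : Prop :=
  ∃ (k : ℕ) (σ : Fin k → List Bool) (z : Fin k → Site d), IsDecomposition k σ z ∧ word k σ z = L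

theorem decomposable_nil : Decomposable ([] : List (Site d)) :=
  ⟨0, Fin.elim0, Fin.elim0, trivial, rfl⟩

theorem Decomposable.insertAt {L : List (Site d)} (hL : Decomposable L) {a : Site d} (ha : a ∉ L)
    {μ : List Bool} (h1 : 1 ≤ μ.count true) (h2 : μ.length ≤ L.length + 1) :
    Decomposable (insertAt μ a L) := by
  obtain ⟨k, σ, z, h, rfl⟩ := hL
  exact ⟨k + 1, Fin.cons μ σ, Fin.cons a z, ⟨h1, h2, ha, h⟩, rfl⟩

theorem Decomposable.cons {L : List (Site d)} (hL : Decomposable L) {a : Site d} (ha : a ∉ L) :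
    Decomposable (a :: L) := by
  cases L with
  | nil => exact hL.insertAt (μ := [true]) ha (by simp) (by simp)
  | cons x L => exact hL.insertAt (μ := [true]) ha (by simp) (by simp)

theorem decomposable_two {a b : Site d} (h : a ≠ b) : Decomposable [a, b] :=
  (decomposable_nil.cons (a := b) (by simp)).cons (by simpa using h)

theorem decomposable_three {a b c : Site d} (h : a ≠ b) (h' : b ≠ c) : Decomposable [a, b, c] := by
  by_cases hac : a = c
  · subst hac
    exact (decomposable_nil.cons (a := b) (by simp)).insertAt (μ := [true, true]) (a := a)
      (by simpa using h) (by simp) (by simp)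
  · exact (decomposable_two h').cons (by simp [h, hac])

theorem decomposable_four {a b c e : Site d} (h : a ≠ b) (h' : b ≠ c) (h'' : c ≠ e)
    (hab : ¬ (a = c ∧ b = e)) : Decomposable [a, b, c, e] := by
  by_cases hac : a = c
  · subst hac
    have hbe : b ≠ e := fun hh => hab ⟨rfl, hh⟩
    exact (decomposable_two hbe).insertAt (μ := [true, true]) (a := a) (by simp [h, h''])
      (by simp) (by simp)
  · by_cases hae : a = e
    · subst hae
      exact (decomposable_two h').insertAt (μ := [true, false, true]) (a := a) (by simp [h, hac])
        (by simp) (by simp)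
    · exact (decomposable_three h' h'').cons (by simp [h, hac, hae])

/-- Among the words of length five with distinct neighbours and without alternating block `abab`,
the only ones whose first letter cannot be removed first are of the form `abcac`. -/
theorem decomposable_five {a b c e f : Site d} (h1 : a ≠ b) (h2 : b ≠ c) (h3 : c ≠ e) (h4 : e ≠ f)
    (ha : ¬ (a = c ∧ b = e)) (hb : ¬ (b = e ∧ c = f)) : Decomposable [a, b, c, e, f] := by
  by_cases hac : a = c
  · subst hac
    have hbe : b ≠ e := fun hh => ha ⟨rfl, hh⟩
    by_cases haf : a = f
    · subst haf
      exact (decomposable_two hbe).insertAt (μ := [true, true, true]) (a := a) (by simp [h1, h3])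
        (by simp) (by simp)
    · exact (decomposable_three hbe h4).insertAt (μ := [true, true]) (a := a)
        (by simp [h1, h3, haf]) (by simp) (by simp)
  · by_cases hae : a = e
    · subst hae
      by_cases hcf : c = f
      · subst hcf
        exact (decomposable_three h1 h1.symm).insertAt (μ := [false, false, true, true]) (a := c)
          (by simp [h2.symm, h3]) (by simp) (by simp)
      · exact (decomposable_three h2 hcf).insertAt (μ := [true, false, true]) (a := a)
          (by simp [h1, hac, h4]) (by simp) (by simp)
    · by_cases haf : a = f
      · subst haf
        exact (decomposable_three h2 h3).insertAt (μ := [true, false, false, true]) (a := a)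
          (by simp [h1, hac, hae]) (by simp) (by simp)
      · exact (decomposable_four h2 h3 h4 hb).cons (by simp [h1, hac, hae, haf])

theorem Admissible.decomposable {s : ℕ} (hs : s ≤ 5) {m : Fin s → Site d} (hm : Admissible m) :
    Decomposable (List.ofFn m) := by
  interval_cases s
  · exact decomposable_nil
  · exact decomposable_nil.cons (by simp)
  · exact decomposable_two (hm.ne (i := 0) (j := 1) rfl)
  · exact decomposable_three (hm.ne (i := 0) (j := 1) rfl) (hm.ne (i := 1) (j := 2) rfl)
  · exact decomposable_four (hm.ne (i := 0) (j := 1) rfl) (hm.ne (i := 1) (j := 2) rfl)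
      (hm.ne (i := 2) (j := 3) rfl)
      (hm.not_alternating (i := 0) (j := 1) (k := 2) (l := 3) rfl rfl rfl)
  · exact decomposable_five (hm.ne (i := 0) (j := 1) rfl) (hm.ne (i := 1) (j := 2) rfl)
      (hm.ne (i := 2) (j := 3) rfl) (hm.ne (i := 3) (j := 4) rfl)
      (hm.not_alternating (i := 0) (j := 1) (k := 2) (l := 3) rfl rfl rfl)
      (hm.not_alternating (i := 1) (j := 2) (k := 3) (l := 4) rfl rfl rfl)

end Words

/-! ### Summation over admissible tuples -/

section AdmissibleSums

variable {d : ℕ}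

/-- The masks that occur in decompositions of words of length `s`. -/
abbrev Mask (s : ℕ) : Type := {μ : List Bool // μ.length ≤ s + 1 ∧ 1 ≤ μ.count true}

instance (s : ℕ) : Finite (Mask s) :=
  ((List.finite_length_le Bool (s + 1)).subset fun _ h => h.1 :
    {μ : List Bool | μ.length ≤ s + 1 ∧ 1 ≤ μ.count true}.Finite)

/-- The number of letters and the masks in decompositions of words of length `s`. -/
abbrev Shape (s : ℕ) : Type := Σ k : Fin (s + 1), Fin k → Mask s

theorem exists_decomposition {s : ℕ} (hs : s ≤ 5) (m : {m : Fin s → Site d // Admissible m}) :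
    ∃ t : (Σ t : Shape s, Fin t.1 → Site d),
      IsDecomposition _ (fun i => (t.1.2 i).1) t.2 ∧
      word _ (fun i => (t.1.2 i).1) t.2 = List.ofFn m.1 := by
  obtain ⟨k, σ, z, h, e⟩ := m.2.decomposable hs
  have hl : (word k σ z).length = s := by rw [e, List.length_ofFn]
  have hk : k < s + 1 := by
    have := h.le_length
    omega
  exact ⟨⟨⟨⟨k, hk⟩, fun i => ⟨σ i, by have := h.length_le i; omega, h.one_le_count i⟩⟩, z⟩, h, e⟩

/-- A choice of decomposition of each admissible tuple. -/
noncomputable def decomposition {s : ℕ} (hs : s ≤ 5) (m : {m : Fin s → Site d // Admissible m}) :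
    Σ t : Shape s, Fin t.1 → Site d :=
  (exists_decomposition hs m).choose

/-- `letterProd` for the chosen decomposition. -/
noncomputable def tupleProd {s : ℕ} (hs : s ≤ 5) (φ : List Bool → Site d → List (Site d) → ℝ)
    (m : {m : Fin s → Site d // Admissible m}) : ℝ :=
  letterProd φ _ (fun i => ((decomposition hs m).1.2 i).1) (decomposition hs m).2

theorem decomposition_injective {s : ℕ} (hs : s ≤ 5) :
    Function.Injective (decomposition (d := d) hs) := by
  intro m m' h
  have e := (exists_decomposition hs m).choose_spec.2
  have e' := (exists_decomposition hs m').choose_spec.2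
  have : List.ofFn m.1 = List.ofFn m'.1 := by
    rw [← e, ← e']
    change word _ (fun i => ((decomposition hs m).1.2 i).1) (decomposition hs m).2 =
      word _ (fun i => ((decomposition hs m').1.2 i).1) (decomposition hs m').2
    rw [h]
  exact Subtype.ext (List.ofFn_injective this)

theorem tsum_tupleProd_le {s : ℕ} (hs : s ≤ 5) {φ : List Bool → Site d → List (Site d) → ℝ}
    (h0 : ∀ μ a L, 0 ≤ φ μ a L) {C : ℝ} (hC : 1 ≤ C)
    (h : ∀ (μ : Mask s) L, ∑' a, ENNReal.ofReal (φ μ.1 a L) ≤ ENNReal.ofReal C) :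
    ∑' m, ENNReal.ofReal (tupleProd hs φ m) ≤ ENNReal.ofReal (Nat.card (Shape s) * C ^ s) := by
  have := Fintype.ofFinite (Shape s)
  calc _ ≤ ∑' t : (Σ t : Shape s, Fin t.1 → Site d),
        ENNReal.ofReal (letterProd φ _ (fun i => (t.1.2 i).1) t.2) :=
        ENNReal.tsum_comp_le_tsum_of_injective (decomposition_injective hs)
          fun t => ENNReal.ofReal (letterProd φ _ (fun i => (t.1.2 i).1) t.2)
    _ = ∑ t : Shape s, ∑' z, ENNReal.ofReal (letterProd φ t.1 (fun i => (t.2 i).1) z) := by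
        rw [ENNReal.tsum_sigma', tsum_fintype]
    _ ≤ ∑ _t : Shape s, ENNReal.ofReal (C ^ s) := by
        refine Finset.sum_le_sum fun t _ => ?_
        refine (tsum_letterProd_le h0 (by linarith) t.1 _ fun i L => h (t.2 i) L).trans ?_
        exact ENNReal.ofReal_le_ofReal (pow_le_pow_right₀ hC (by omega))
    _ = _ := by
        rw [Finset.sum_const, Finset.card_univ, Nat.card_eq_fintype_card, nsmul_eq_mul,
          ENNReal.ofReal_mul (by positivity), ENNReal.ofReal_natCast]

theorem letterProd_congr {φ ψ : List Bool → Site d → List (Site d) → ℝ} {k : ℕ}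
    {σ : Fin k → List Bool} {z : Fin k → Site d}
    (h : ∀ i L, φ (σ i) (z i) L = ψ (σ i) (z i) L) : letterProd φ k σ z = letterProd ψ k σ z := by
  induction k with
  | zero => rfl
  | succ k ih =>
    unfold letterProd
    rw [h 0, ih (σ := Fin.tail σ) (z := Fin.tail z) fun i L => h i.succ L]

/-- Summing the path weights over all pairs of admissible tuples with the same Walsh function.
Letters of odd multiplicity are sites of the Walsh function and only need square summability,
while a letter of even multiplicity comes with at least two `bump`s and is summed freely. -/
theorem exists_tsum_pathWeight_mul_le (hd : 5 ≤ d) {B : ℝ} (hB : 0 ≤ B) (hBd : B ≤ d - 2)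
    {s : ℕ} (hs : s ≤ 5) : ∃ C : ℝ, 0 < C ∧ ∀ n n' : Site d,
    ∑' m : {m : Fin s → Site d // Admissible m}, ∑' m' : {m : Fin s → Site d // Admissible m},
      (if oddSites (List.ofFn m.1) = oddSites (List.ofFn m'.1) then
        ENNReal.ofReal (pathWeight B n (List.ofFn m.1) n' * pathWeight B n (List.ofFn m'.1) n')
        else 0) ≤ ENNReal.ofReal ((C * modelKernel d B n n') ^ 2) := by
  obtain ⟨C0, hC0, hbump⟩ := exists_tsum_bump_sq_le hd
  set C1 : ℝ := 3 * (2 ^ (d - 2 : ℝ) * 2 ^ B) with hC1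
  set D : ℝ := Nat.card (Shape s) * ((s + 1 : ℝ) * (C0 + 1)) ^ s with hD
  have hD0 : 0 ≤ D := by positivity
  refine ⟨C1 ^ s * (2 * (D + 1)), by positivity, fun n n' => ?_⟩
  set K := C1 ^ s * modelKernel d B n n' with hK
  have hK0 : 0 ≤ K := mul_nonneg (by positivity) (modelKernel_pos _ _ _).le
  set φe : List Bool → Site d → List (Site d) → ℝ :=
    fun μ a L => if Even (μ.count true) then bumpProd n μ a L n' else 1 with hφe
  set φo : List Bool → Site d → List (Site d) → ℝ :=
    fun μ a L => if Even (μ.count true) then 1 else bumpProd n μ a L n' with hφo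
  have hφe0 : ∀ μ a L, 0 ≤ φe μ a L := fun μ a L => by
    simp only [hφe]; split_ifs
    exacts [bumpProd_nonneg _ _ _ _ _, zero_le_one]
  have hφo0 : ∀ μ a L, 0 ≤ φo μ a L := fun μ a L => by
    simp only [hφo]; split_ifs
    exacts [zero_le_one, bumpProd_nonneg _ _ _ _ _]
  have hEven : ∀ (μ : Mask s) (a : Site d) L, Even (μ.1.count true) →
      bumpProd n μ.1 a L n' ≤ bumpSum n μ.1 a L n' := fun μ a L h => by
    refine bumpProd_le (by omega) ?_
    obtain ⟨j, hj⟩ := h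
    have := μ.2.2
    omega
  have hsum : ∀ (μ : Mask s) L, ∑' a, ENNReal.ofReal (bumpSum n μ.1 a L n') ≤
      ENNReal.ofReal ((s + 1 : ℝ) * (C0 + 1)) := fun μ L => by
    refine (tsum_bumpSum_le hC0.le hbump n μ.1 L n').trans (ENNReal.ofReal_le_ofReal ?_)
    have : ((μ.1.length : ℕ) : ℝ) ≤ s + 1 := by exact_mod_cast μ.2.1
    gcongr
    linarith
  have hone : (1 : ℝ) ≤ (s + 1 : ℝ) * (C0 + 1) := by
    have : (0 : ℝ) ≤ s := Nat.cast_nonneg s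
    nlinarith
  have hA : ∑' m, ENNReal.ofReal (tupleProd hs (fun μ a L => φo μ a L * φo μ a L * φe μ a L) m) ≤
      ENNReal.ofReal D := by
    refine tsum_tupleProd_le hs (fun μ a L => mul_nonneg (mul_self_nonneg _) (hφe0 _ _ _)) hone
      fun μ L => tsum_ofReal_mono_le (fun a => ?_) (hsum μ L)
    simp only [hφe, hφo]
    split_ifs with h
    · simpa using hEven μ a L h
    · simpa [sq] using bumpProd_sq_le (by omega : 2 ≤ d) (n := n) (a := a) (L := L) (n' := n') μ.2.2
  have hE : ∀ S : Finset (Site d), S.card ≤ s →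
      ∑' m : {m : Fin s → Site d // Admissible m},
        (if S = oddSites (List.ofFn m.1) then ENNReal.ofReal (tupleProd hs φe m) else 0) ≤
      ENNReal.ofReal D := by
    intro S hS
    set φS : List Bool → Site d → List (Site d) → ℝ :=
      fun μ a L => if Even (μ.count true) then bumpProd n μ a L n' else if a ∈ S then 1 else 0
      with hφS
    have hφS0 : ∀ μ a L, 0 ≤ φS μ a L := fun μ a L => by
      simp only [hφS]; split_ifs
      exacts [bumpProd_nonneg _ _ _ _ _, zero_le_one, le_rfl]
    calc _ ≤ ∑' m, ENNReal.ofReal (tupleProd hs φS m) := by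
          refine ENNReal.tsum_le_tsum fun m => ?_
          split_ifs with h
          · refine (congrArg ENNReal.ofReal (letterProd_congr fun i L => ?_)).le
            simp only [hφe, hφS]
            split_ifs with h1 h2
            · rfl
            · rfl
            · obtain ⟨g1, g2⟩ := (exists_decomposition hs m).choose_spec
              refine absurd ?_ h2
              rw [h, mem_oddSites, ← g2]
              have := g1.count_eq i
              rw [← Nat.not_even_iff_odd]
              intro h3
              exact h1 (this ▸ h3)
          · exact zero_le
      _ ≤ _ := by
          refine tsum_tupleProd_le hs hφS0 hone fun μ L => ?_
          by_cases h : Even (μ.1.count true)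
          · refine tsum_ofReal_mono_le (fun a => ?_) (hsum μ L)
            simp only [hφS, if_pos h]
            exact hEven μ a L h
          · simp only [hφS, if_neg h]
            rw [tsum_eq_sum (s := S) fun a ha => by simp [ha]]
            rw [Finset.sum_congr rfl fun a ha => by rw [if_pos ha], Finset.sum_const,
              ENNReal.ofReal_one, nsmul_eq_mul, mul_one, ← ENNReal.ofReal_natCast]
            refine ENNReal.ofReal_le_ofReal ?_
            have : (S.card : ℝ) ≤ s := by exact_mod_cast hS
            have : (0 : ℝ) ≤ s := Nat.cast_nonneg s
            nlinarith
  set Φ1 := fun m => tupleProd hs (fun μ a L => φo μ a L * φo μ a L * φe μ a L) m with hΦ1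
  set Φe := fun m => tupleProd hs φe m with hΦe
  set Φo := fun m => tupleProd hs φo m with hΦo
  have hΦe0 : ∀ m, 0 ≤ Φe m := fun m => letterProd_nonneg hφe0 _ _ _
  have hΦo0 : ∀ m, 0 ≤ Φo m := fun m => letterProd_nonneg hφo0 _ _ _
  have hΦ10 : ∀ m, Φ1 m = Φo m * Φo m * Φe m := fun m => by
    simp only [hΦ1, hΦe, hΦo, tupleProd, letterProd_mul]
  have hw : ∀ m : {m : Fin s → Site d // Admissible m},
      pathWeight B n (List.ofFn m.1) n' ≤ K * (Φo m * Φe m) := by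
    intro m
    obtain ⟨g1, g2⟩ := (exists_decomposition hs m).choose_spec
    have := g1.pathWeight_le (by omega) hB hBd n n'
    rw [g2, List.length_ofFn] at this
    refine this.trans (le_of_eq ?_)
    simp only [hΦe, hΦo, tupleProd, letterProd_mul]
    rw [hK, mul_assoc]
    congr 2
    refine letterProd_congr fun i L => ?_
    simp only [hφe, hφo]
    split_ifs <;> simp
  have hwpos : ∀ L, 0 ≤ pathWeight B n L n' := fun L =>
    mul_nonneg (pathDecay_pos _ _ _).le (Real.rpow_nonneg (minSize_pos (min_size_pos n n') L).le _)
  have hterm : ∀ m m' : {m : Fin s → Site d // Admissible m},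
      ENNReal.ofReal (pathWeight B n (List.ofFn m.1) n' * pathWeight B n (List.ofFn m'.1) n') ≤
        ENNReal.ofReal (K ^ 2) * (ENNReal.ofReal (Φ1 m) * ENNReal.ofReal (Φe m') +
          ENNReal.ofReal (Φ1 m') * ENNReal.ofReal (Φe m)) := by
    intro m m'
    have p1 : 0 ≤ Φ1 m := letterProd_nonneg
      (fun μ a L => mul_nonneg (mul_self_nonneg _) (hφe0 _ _ _)) _ _ _
    have p2 : 0 ≤ Φ1 m' := letterProd_nonneg
      (fun μ a L => mul_nonneg (mul_self_nonneg _) (hφe0 _ _ _)) _ _ _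
    rw [← ENNReal.ofReal_mul p1, ← ENNReal.ofReal_mul p2,
      ← ENNReal.ofReal_add (mul_nonneg p1 (hΦe0 _)) (mul_nonneg p2 (hΦe0 _)),
      ← ENNReal.ofReal_mul (sq_nonneg K)]
    refine ENNReal.ofReal_le_ofReal ?_
    have q := mul_nonneg (hΦe0 m) (hΦe0 m')
    calc _ ≤ (K * (Φo m * Φe m)) * (K * (Φo m' * Φe m')) :=
          mul_le_mul (hw m) (hw m') (hwpos _)
            (mul_nonneg hK0 (mul_nonneg (hΦo0 m) (hΦe0 m)))
      _ = K ^ 2 * (Φo m * Φo m' * (Φe m * Φe m')) := by ring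
      _ ≤ K ^ 2 * ((Φo m * Φo m + Φo m' * Φo m') * (Φe m * Φe m')) := by
          gcongr
          nlinarith [sq_nonneg (Φo m - Φo m'), mul_self_nonneg (Φo m), mul_self_nonneg (Φo m')]
      _ = _ := by rw [hΦ10, hΦ10]; ring
  have hcard : ∀ m : {m : Fin s → Site d // Admissible m}, (oddSites (List.ofFn m.1)).card ≤ s :=
    fun m => (card_oddSites_le _).trans (by rw [List.length_ofFn])
  have half : ∑' m : {m : Fin s → Site d // Admissible m},
      ∑' m' : {m : Fin s → Site d // Admissible m},
      (if oddSites (List.ofFn m.1) = oddSites (List.ofFn m'.1) then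
        ENNReal.ofReal (Φ1 m) * ENNReal.ofReal (Φe m') else 0) ≤
      ENNReal.ofReal D * ENNReal.ofReal D := by
    calc _ ≤ ∑' m, ENNReal.ofReal (Φ1 m) * ENNReal.ofReal D := by
          refine ENNReal.tsum_le_tsum fun m => ?_
          refine le_trans ?_ (mul_le_mul_right (hE _ (hcard m)) (ENNReal.ofReal (Φ1 m)))
          rw [← ENNReal.tsum_mul_left]
          refine ENNReal.tsum_le_tsum fun m' => ?_
          split_ifs <;> simp [hΦe]
      _ ≤ _ := by
          rw [ENNReal.tsum_mul_right]
          exact mul_le_mul_left hA _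
  calc _ ≤ ∑' m : {m : Fin s → Site d // Admissible m},
        ∑' m' : {m : Fin s → Site d // Admissible m}, ENNReal.ofReal (K ^ 2) *
        ((if oddSites (List.ofFn m.1) = oddSites (List.ofFn m'.1) then
          ENNReal.ofReal (Φ1 m) * ENNReal.ofReal (Φe m') else 0) +
        (if oddSites (List.ofFn m'.1) = oddSites (List.ofFn m.1) then
          ENNReal.ofReal (Φ1 m') * ENNReal.ofReal (Φe m) else 0)) := by
        refine ENNReal.tsum_le_tsum fun m => ENNReal.tsum_le_tsum fun m' => ?_
        by_cases h : oddSites (List.ofFn m.1) = oddSites (List.ofFn m'.1)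
        · rw [if_pos h, if_pos h, if_pos h.symm]
          exact hterm m m'
        · rw [if_neg h]
          exact zero_le
    _ ≤ ENNReal.ofReal (K ^ 2) * (ENNReal.ofReal D * ENNReal.ofReal D +
          ENNReal.ofReal D * ENNReal.ofReal D) := by
        simp_rw [ENNReal.tsum_mul_left, ENNReal.tsum_add]
        refine mul_le_mul_right (add_le_add half ?_) _
        rw [ENNReal.tsum_comm]
        exact half
    _ ≤ _ := by
        rw [← ENNReal.ofReal_mul hD0, ← ENNReal.ofReal_add (by positivity) (by positivity),
          ← ENNReal.ofReal_mul (sq_nonneg K)]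
        refine ENNReal.ofReal_le_ofReal ?_
        have : (C1 ^ s * (2 * (D + 1)) * modelKernel d B n n') ^ 2 = K ^ 2 * (2 * (D + 1)) ^ 2 := by
          rw [hK]; ring
        rw [this]
        gcongr
        nlinarith

end AdmissibleSums

/-! ### Moment bounds for the remainder terms -/

section Terms

variable {d : ℕ}

theorem pathDecay_ofFn {s : ℕ} (n n' : Site d) (m : Fin s → Site d) :
    pathDecay n (List.ofFn m) n' = ∏ j : Fin (s + 1),
      greenDecay ((Fin.cons n m : Fin (s + 1) → Site d) j -
        (Fin.snoc m n' : Fin (s + 1) → Site d) j) := by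
  induction s generalizing n with
  | zero => simp [pathDecay, Fin.snoc]
  | succ s ih =>
    rw [List.ofFn_succ, Fin.prod_univ_succ]
    unfold pathDecay
    have h0 : (Fin.snoc m n' : Fin (s + 2) → Site d) 0 = m 0 :=
      Fin.snoc_castSucc (α := fun _ => Site d) n' m 0
    rw [h0, Fin.cons_zero]
    congr 1
    rw [ih (m 0) fun i => m i.succ]
    refine Finset.prod_congr rfl fun j _ => ?_
    congr 2
    · refine Fin.cases ?_ (fun i => ?_) j <;> simp
    · refine Fin.lastCases ?_ (fun i => ?_) j
      · rw [Fin.snoc_last, Fin.succ_last, Fin.snoc_last]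
      · rw [Fin.snoc_castSucc, Fin.succ_castSucc, Fin.snoc_castSucc]

theorem abs_weight_le {s : ℕ} {α κ a b coef : ℝ} (hκ : 0 ≤ κ) (hα : 0 ≤ α) (ha : 0 ≤ a)
    (hb : 0 ≤ b) {A : Fin (s + 1) → Kernel d} {u : Fin s → Site d → ℝ} {f : Fin (s + 1) → ℕ}
    {e : Fin s → ℕ} {i : ℕ} (hi : ∑ j, f j + ∑ j, e j = i)
    (hA : ∀ j x y, |A j x y| ≤ a * κ ^ f j * modelKernel d (f j * α) x y)
    (hu : ∀ j x, |u j x| ≤ b * κ ^ e j * size x ^ (-(e j * α)))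
    (n n' : Site d) (m : Fin s → Site d) :
    |(⟨coef, s, A, u⟩ : RandomTerm d).weight n n' m| ≤
      a ^ (s + 1) * b ^ s * κ ^ i * pathWeight (i * α) n (List.ofFn m) n' := by
  set ν := minSize (min (size n) (size n')) (List.ofFn m) with hν
  have hν0 : 0 < ν := minSize_pos (min_size_pos n n') _
  have hm : ∀ j, ν ≤ size (m j) := fun j => minSize_le_size _ (List.mem_ofFn.2 ⟨j, rfl⟩)
  have hn : ν ≤ size n := (minSize_le _ _).trans (min_le_left _ _)
  have hn' : ν ≤ size n' := (minSize_le _ _).trans (min_le_right _ _)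
  have hneg : ∀ k : ℕ, -((k : ℝ) * α) ≤ 0 := fun k => by
    have : 0 ≤ (k : ℝ) * α := by positivity
    linarith
  have hA' : ∀ j, |A j ((Fin.cons n m : Fin (s + 1) → Site d) j)
      ((Fin.snoc m n' : Fin (s + 1) → Site d) j)| ≤ a * (κ ^ f j * ν ^ (-(f j * α))) *
        greenDecay ((Fin.cons n m : Fin (s + 1) → Site d) j -
          (Fin.snoc m n' : Fin (s + 1) → Site d) j) := by
    intro j
    refine (hA j _ _).trans ?_
    have h1 : ν ≤ size ((Fin.cons n m : Fin (s + 1) → Site d) j) :=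
      Fin.cases (motive := fun j => ν ≤ size ((Fin.cons n m : Fin (s + 1) → Site d) j))
        (by simpa using hn) (fun j => by simpa using hm j) j
    have h2 : ν ≤ size ((Fin.snoc m n' : Fin (s + 1) → Site d) j) :=
      Fin.lastCases (motive := fun j => ν ≤ size ((Fin.snoc m n' : Fin (s + 1) → Site d) j))
        (by rw [Fin.snoc_last]; exact hn')
        (fun j => by rw [Fin.snoc_castSucc]; exact hm j) j
    have h3 := Real.rpow_le_rpow_of_nonpos hν0 (le_min h1 h2) (hneg (f j))
    have h4 := greenDecay_pos ((Fin.cons n m : Fin (s + 1) → Site d) j -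
          (Fin.snoc m n' : Fin (s + 1) → Site d) j)
    unfold modelKernel
    calc _ = a * (κ ^ f j * min (size ((Fin.cons n m : Fin (s + 1) → Site d) j))
          (size ((Fin.snoc m n' : Fin (s + 1) → Site d) j)) ^ (-(f j * α))) *
          greenDecay ((Fin.cons n m : Fin (s + 1) → Site d) j -
          (Fin.snoc m n' : Fin (s + 1) → Site d) j) := by unfold greenDecay; ring
      _ ≤ _ := by gcongr
  have hu' : ∀ j, |u j (m j)| ≤ b * (κ ^ e j * ν ^ (-(e j * α))) := fun j => by
    have h3 := Real.rpow_le_rpow_of_nonpos hν0 (hm j) (hneg (e j))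
    calc _ ≤ _ := hu j (m j)
      _ = b * (κ ^ e j * size (m j) ^ (-(e j * α))) := by ring
      _ ≤ _ := by gcongr
  unfold RandomTerm.weight
  simp only [abs_mul, Finset.abs_prod]
  calc _ ≤ (∏ j, a * (κ ^ f j * ν ^ (-(f j * α))) *
        greenDecay ((Fin.cons n m : Fin (s + 1) → Site d) j -
          (Fin.snoc m n' : Fin (s + 1) → Site d) j)) * ∏ j, b * (κ ^ e j * ν ^ (-(e j * α))) := by
        gcongr with j _ j _
        · exact Finset.prod_nonneg fun j _ => (abs_nonneg _).trans (hA' j)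
        · exact hA' j
        · exact hu' j
    _ = _ := by
        rw [Finset.prod_mul_distrib, ← pathDecay_ofFn, Finset.prod_mul_distrib,
          Finset.prod_mul_distrib, Finset.prod_mul_distrib, Finset.prod_mul_distrib,
          Finset.prod_const, Finset.prod_const, Finset.prod_pow_eq_pow_sum,
          Finset.prod_pow_eq_pow_sum, ← Real.rpow_sum_of_pos hν0, ← Real.rpow_sum_of_pos hν0,
          Finset.card_univ, Finset.card_univ, Fintype.card_fin, Fintype.card_fin, ← hi, pow_add]
        unfold pathWeight
        rw [← hν]
        have : -(((∑ j, f j + ∑ j, e j : ℕ) : ℝ) * α) =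
            (∑ j, -((f j : ℝ) * α)) + ∑ j, -((e j : ℝ) * α) := by
          push_cast
          simp only [Finset.sum_neg_distrib, ← Finset.sum_mul]
          ring
        rw [this, Real.rpow_add hν0]
        ring

/-- A family of random terms is of order `i`: its entries converge unconditionally and obey the
moment bound `C κ^i (|n| ∧ |n'|)^{-iα} |n - n'|^{-(d-2)}`. -/
def TermBounded (α p : ℝ) (i : ℕ) (T : ℝ → RandomTerm d) : Prop :=
  ∃ C : ℝ, 0 < C ∧ ∀ κ : ℝ, 0 ≤ κ → ∀ n n' : Site d, Summable ((T κ).summand n n') ∧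
    eLpNorm ((T κ).value n n') (ENNReal.ofReal p) (P d) ≤
      ENNReal.ofReal (C * κ ^ i * modelKernel d (i * α) n n')

/-- The random terms of a family of lists converge, and their sum obeys the bound of order `i`. -/
def ListBounded (α p : ℝ) (i : ℕ) (L : ℝ → List (RandomTerm d)) : Prop :=
  ∃ C : ℝ, 0 < C ∧ ∀ κ : ℝ, 0 ≤ κ → ∀ n n' : Site d,
    (∀ T ∈ L κ, Summable (T.summand n n')) ∧
    eLpNorm (((L κ).map fun T => T.value n n').sum : Lp ℝ 2 (P d)) (ENNReal.ofReal p) (P d) ≤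
      ENNReal.ofReal (C * κ ^ i * modelKernel d (i * α) n n')

theorem termBounded (hd : 5 ≤ d) {α a b p : ℝ} (hα : 0 ≤ α) (ha : 0 < a) (hb : 0 < b)
    {s i : ℕ} (hs : s ≤ 5) (hiα : i * α ≤ d - 2) (coef : ℝ) {f : Fin (s + 1) → ℕ} {e : Fin s → ℕ}
    (hi : ∑ j, f j + ∑ j, e j = i) {A : ℝ → Fin (s + 1) → Kernel d} {u : ℝ → Fin s → Site d → ℝ}
    (hA : ∀ κ, 0 ≤ κ → ∀ j x y, |A κ j x y| ≤ a * κ ^ f j * modelKernel d (f j * α) x y)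
    (hu : ∀ κ, 0 ≤ κ → ∀ j x, |u κ j x| ≤ b * κ ^ e j * size x ^ (-(e j * α))) :
    TermBounded α p i fun κ => ⟨coef, s, A κ, u κ⟩ := by
  obtain ⟨C, hC, hpair⟩ := exists_tsum_pathWeight_mul_le hd (B := i * α) (by positivity) hiα hs
  obtain ⟨C', hC', hLp⟩ := exists_eLpNorm_tsum_walsh_le d s p
  set c := a ^ (s + 1) * b ^ s with hc
  have hc0 : 0 < c := by positivity
  refine ⟨(|coef| + 1) * (C' * (c * C)), by positivity, fun κ hκ n n' => ?_⟩
  set T : RandomTerm d := ⟨coef, s, A κ, u κ⟩ with hT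
  have hw : ∀ m : {m : Fin s → Site d // Admissible m}, |T.weight n n' m.1| ≤
      c * κ ^ i * pathWeight (i * α) n (List.ofFn m.1) n' := fun m =>
    abs_weight_le hκ hα ha.le hb.le hi (hA κ hκ) (hu κ hκ) n n' m.1
  have hmk := modelKernel_pos (i * α) n n'
  have hF : ∀ m : {m : Fin s → Site d // Admissible m},
      T.summand n n' m =ᵐ[P d] fun ω => T.weight n n' m.1 * walsh (oddSites (List.ofFn m.1)) ω := by
    intro m
    filter_upwards [Lp.coeFn_smul (T.weight n n' m.1) ((memLp_signProd m.1).toLp (signProd m.1)),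
      (memLp_signProd m.1).coeFn_toLp] with ω h1 h2
    refine h1.trans ?_
    rw [Pi.smul_apply, h2, signProd_eq_walsh, smul_eq_mul]
  obtain ⟨h1, h2⟩ := hLp hF (fun m => (card_oddSites_le _).trans (by rw [List.length_ofFn]))
    (c * κ ^ i * (C * modelKernel d (i * α) n n')) (by positivity) (by
      rw [mul_pow, ENNReal.ofReal_mul (by positivity)]
      refine le_trans ?_ (mul_le_mul_right (hpair n n') _)
      rw [← ENNReal.tsum_mul_left]
      refine ENNReal.tsum_le_tsum fun m => ?_
      rw [← ENNReal.tsum_mul_left]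
      refine ENNReal.tsum_le_tsum fun m' => ?_
      split_ifs
      · rw [← ENNReal.ofReal_mul (by positivity)]
        refine ENNReal.ofReal_le_ofReal ?_
        calc _ ≤ (c * κ ^ i * pathWeight (i * α) n (List.ofFn m.1) n') *
              (c * κ ^ i * pathWeight (i * α) n (List.ofFn m'.1) n') :=
              mul_le_mul (hw m) (hw m') (abs_nonneg _) ((abs_nonneg _).trans (hw m))
          _ = _ := by ring
      · exact zero_le)
  refine ⟨h1, ?_⟩
  have e1 : eLpNorm (T.value n n') (ENNReal.ofReal p) (P d) =
      ‖coef‖ₑ * eLpNorm (∑' m, T.summand n n' m : Lp ℝ 2 (P d)) (ENNReal.ofReal p) (P d) := by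
    rw [← eLpNorm_const_smul]
    exact eLpNorm_congr_ae (Lp.coeFn_smul _ _)
  rw [e1, Real.enorm_eq_ofReal_abs]
  calc _ ≤ ENNReal.ofReal |coef| *
        ENNReal.ofReal (C' * (c * κ ^ i * (C * modelKernel d (i * α) n n'))) :=
        mul_le_mul_right h2 _
    _ ≤ _ := by
        rw [← ENNReal.ofReal_mul (abs_nonneg _)]
        refine ENNReal.ofReal_le_ofReal ?_
        calc _ = |coef| * (C' * (c * C) * κ ^ i * modelKernel d (i * α) n n') := by ring
          _ ≤ (|coef| + 1) * (C' * (c * C) * κ ^ i * modelKernel d (i * α) n n') := by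
              gcongr
              linarith
          _ = _ := by ring

theorem eLpNorm_coeFn_add_le {p : ℝ} (hp : 1 ≤ p) (X Y : Lp ℝ 2 (P d)) {a b : ℝ} (ha : 0 ≤ a)
    (hb : 0 ≤ b) (hX : eLpNorm X (ENNReal.ofReal p) (P d) ≤ ENNReal.ofReal a)
    (hY : eLpNorm Y (ENNReal.ofReal p) (P d) ≤ ENNReal.ofReal b) :
    eLpNorm (X + Y : Lp ℝ 2 (P d)) (ENNReal.ofReal p) (P d) ≤ ENNReal.ofReal (a + b) := by
  rw [eLpNorm_congr_ae (Lp.coeFn_add X Y), ENNReal.ofReal_add ha hb]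
  exact (eLpNorm_add_le (Lp.aestronglyMeasurable X) (Lp.aestronglyMeasurable Y)
    (ENNReal.one_le_ofReal.2 hp)).trans (add_le_add hX hY)

theorem listBounded_nil (α p : ℝ) (i : ℕ) : ListBounded (d := d) α p i fun _ => [] := by
  refine ⟨1, one_pos, fun κ _ n n' => ⟨by simp, ?_⟩⟩
  rw [List.map_nil, List.sum_nil, eLpNorm_congr_ae (Lp.coeFn_zero ℝ 2 (P d)), eLpNorm_zero]
  exact zero_le

theorem TermBounded.cons {α p : ℝ} (hp : 1 ≤ p) {i : ℕ} {T : ℝ → RandomTerm d}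
    {L : ℝ → List (RandomTerm d)} (hT : TermBounded α p i T) (hL : ListBounded α p i L) :
    ListBounded α p i fun κ => T κ :: L κ := by
  obtain ⟨C, hC, hT⟩ := hT
  obtain ⟨C', hC', hL⟩ := hL
  refine ⟨C + C', by positivity, fun κ hκ n n' => ⟨fun S hS => ?_, ?_⟩⟩
  · rcases List.mem_cons.1 hS with rfl | h
    · exact (hT κ hκ n n').1
    · exact (hL κ hκ n n').1 S h
  · rw [List.map_cons, List.sum_cons, add_mul, add_mul]
    have := modelKernel_pos (i * α) n n'
    exact eLpNorm_coeFn_add_le hp _ _ (by positivity) (by positivity) (hT κ hκ n n').2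
      (hL κ hκ n n').2

theorem listBounded_randomTerms (hd : 5 ≤ d) {α p : ℝ} (hα : 0 < α) (hα' : α ≤ 1 / 3)
    (hp : 1 ≤ p) {i : ℕ} (hi : i ≤ 5) : ListBounded α p i fun κ => randomTerms d κ α i := by
  obtain ⟨CG, hCG, hG⟩ := exists_abs_G0_le (d := d) (by omega)
  obtain ⟨CW, hCW, hW⟩ := exists_abs_G0tWG0_le (d := d) hd hα (by linarith)
  obtain ⟨CD, hCD, hD⟩ := exists_abs_D4_le (d := d) hd hα (by linarith)
  have hdR : (5 : ℝ) ≤ d := by exact_mod_cast hd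
  have hiα : (i : ℝ) * α ≤ d - 2 := by
    have : (i : ℝ) ≤ 5 := by exact_mod_cast hi
    have : (i : ℝ) * α ≤ 5 * (1 / 3) := by gcongr
    linarith
  have hG' : ∀ κ : ℝ, 0 ≤ κ → ∀ x y : Site d,
      |G0 d x y| ≤ (CG + CW) * κ ^ 0 * modelKernel d ((0 : ℕ) * α) x y := fun κ _ x y => by
    have := Real.rpow_pos_of_pos (size_pos (x - y)) (-(d - 2 : ℝ))
    unfold modelKernel
    simp only [pow_zero, mul_one, Nat.cast_zero, zero_mul, neg_zero, Real.rpow_zero, one_mul]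
    refine (hG x y).trans ?_
    gcongr
    linarith
  have hW' : ∀ κ : ℝ, 0 ≤ κ → ∀ x y : Site d, |mul3 (G0t d) (W d κ α) (G0 d) x y| ≤
      (CG + CW) * κ ^ 4 * modelKernel d ((4 : ℕ) * α) x y := fun κ _ x y => by
    have := modelKernel_pos (4 * α) x y
    refine (hW κ x y).trans ?_
    push_cast
    gcongr
    linarith
  have hW'' : ∀ κ : ℝ, 0 ≤ κ → ∀ x y : Site d, |mul3 (G0 d) (W d κ α) (G0t d) x y| ≤
      (CG + CW) * κ ^ 4 * modelKernel d ((4 : ℕ) * α) x y := fun κ hκ x y => by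
    rw [mul3_G0WG0t (by omega), modelKernel_comm]
    exact hW' κ hκ y x
  have hv : ∀ k : ℕ, ∀ κ : ℝ, 0 ≤ κ → ∀ x : Site d,
      |v κ α x ^ k| ≤ (CD + 1) * κ ^ k * size x ^ (-((k : ℕ) * α)) := fun k κ hκ x => by
    have h0 := Real.rpow_pos_of_pos (size_pos x) (-α)
    have e : v κ α x ^ k = κ ^ k * size x ^ (-((k : ℕ) * α)) := by
      unfold v
      rw [mul_pow, ← Real.rpow_natCast (size x ^ (-α)), ← Real.rpow_mul (size_pos x).le]
      congr 2
      ring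
    rw [abs_of_nonneg (by unfold v; positivity), e]
    have := Real.rpow_pos_of_pos (size_pos x) (-((k : ℕ) * α))
    have : 0 ≤ CD * (κ ^ k * size x ^ (-((k : ℕ) * α))) := by positivity
    linarith
  have hv1 : ∀ κ : ℝ, 0 ≤ κ → ∀ x : Site d,
      |v κ α x| ≤ (CD + 1) * κ ^ 1 * size x ^ (-((1 : ℕ) * α)) := fun κ hκ x => by
    simpa using hv 1 κ hκ x
  have hvD : ∀ κ : ℝ, 0 ≤ κ → ∀ x : Site d,
      |v κ α x * D4 d κ α x| ≤ (CD + 1) * κ ^ 5 * size x ^ (-((5 : ℕ) * α)) := fun κ hκ x => by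
    have h0 := Real.rpow_pos_of_pos (size_pos x) (-α)
    have h4 := Real.rpow_pos_of_pos (size_pos x) (-(4 * α))
    have h1 : |v κ α x| = κ * size x ^ (-α) := abs_of_nonneg (by unfold v; positivity)
    rw [abs_mul, h1]
    calc _ ≤ κ * size x ^ (-α) * (CD * κ ^ 4 * size x ^ (-(4 * α))) := by
          gcongr
          exact hD κ x
      _ = CD * κ ^ 5 * size x ^ (-((5 : ℕ) * α)) := by
          rw [show -(((5 : ℕ) : ℝ) * α) = -α + -(4 * α) by push_cast; ring,
            Real.rpow_add (size_pos x)]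
          ring
      _ ≤ _ := by
          have := Real.rpow_pos_of_pos (size_pos x) (-(((5 : ℕ) : ℝ) * α))
          gcongr
          linarith
  have ha : 0 < CG + CW := by positivity
  have hb : 0 < CD + 1 := by positivity
  have mk : ∀ {s : ℕ} (_ : s ≤ 5) (coef : ℝ) (e : Fin s → ℕ) (_ : ∑ j, e j = i)
      {u : ℝ → Fin s → Site d → ℝ}
      (_ : ∀ κ, 0 ≤ κ → ∀ j x, |u κ j x| ≤ (CD + 1) * κ ^ e j * size x ^ (-(e j * α))),
      TermBounded (d := d) α p i fun κ => chain coef (u κ) := fun hs coef e he u hu =>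
    termBounded hd hα.le ha hb hs hiα coef (f := fun _ => 0) (e := e) (by simpa using he)
      (fun κ hκ _ x y => hG' κ hκ x y) hu
  interval_cases i
  · exact listBounded_nil α p 0
  · refine TermBounded.cons hp ?_ (listBounded_nil α p 1)
    exact mk (by norm_num) _ ![1] rfl fun κ hκ j => by
      fin_cases j; exact hv1 κ hκ
  · refine TermBounded.cons hp ?_ (listBounded_nil α p 2)
    exact mk (by norm_num) _ ![1, 1] rfl fun κ hκ j => by
      fin_cases j <;> exact hv1 κ hκ
  · refine TermBounded.cons hp ?_ (TermBounded.cons hp ?_ (listBounded_nil α p 3))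
    · exact mk (by norm_num) _ ![3] rfl fun κ hκ j => by
        fin_cases j; exact hv 3 κ hκ
    · exact mk (by norm_num) _ ![1, 1, 1] rfl fun κ hκ j => by
        fin_cases j <;> exact hv1 κ hκ
  · refine TermBounded.cons hp ?_ (TermBounded.cons hp ?_ (TermBounded.cons hp ?_
      (listBounded_nil α p 4)))
    · exact mk (by norm_num) _ ![3, 1] rfl fun κ hκ j => by
        fin_cases j
        exacts [hv 3 κ hκ, hv1 κ hκ]
    · exact mk (by norm_num) _ ![1, 3] rfl fun κ hκ j => by
        fin_cases j
        exacts [hv1 κ hκ, hv 3 κ hκ]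
    · exact mk (by norm_num) _ ![1, 1, 1, 1] rfl fun κ hκ j => by
        fin_cases j <;> exact hv1 κ hκ
  · refine TermBounded.cons hp ?_ (TermBounded.cons hp ?_ (TermBounded.cons hp ?_
      (TermBounded.cons hp ?_ (TermBounded.cons hp ?_ (TermBounded.cons hp ?_
      (TermBounded.cons hp ?_ (TermBounded.cons hp ?_ (listBounded_nil α p 5))))))))
    · exact mk (by norm_num) _ ![5] rfl fun κ hκ j => by
        fin_cases j; exact hv 5 κ hκ
    · exact mk (by norm_num) _ ![5] rfl fun κ hκ j => by
        fin_cases j; exact hvD κ hκ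
    · refine termBounded hd hα.le ha hb (by norm_num) hiα _ (f := ![0, 4]) (e := ![1]) rfl
        (fun κ hκ j => ?_) fun κ hκ j => ?_
      · fin_cases j
        exacts [hG' κ hκ, hW' κ hκ]
      · fin_cases j; exact hv1 κ hκ
    · refine termBounded hd hα.le ha hb (by norm_num) hiα _ (f := ![4, 0]) (e := ![1]) rfl
        (fun κ hκ j => ?_) fun κ hκ j => ?_
      · fin_cases j
        exacts [hW'' κ hκ, hG' κ hκ]
      · fin_cases j; exact hv1 κ hκ
    · exact mk (by norm_num) _ ![3, 1, 1] rfl fun κ hκ j => by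
        fin_cases j
        exacts [hv 3 κ hκ, hv1 κ hκ, hv1 κ hκ]
    · exact mk (by norm_num) _ ![1, 3, 1] rfl fun κ hκ j => by
        fin_cases j
        exacts [hv1 κ hκ, hv 3 κ hκ, hv1 κ hκ]
    · exact mk (by norm_num) _ ![1, 1, 3] rfl fun κ hκ j => by
        fin_cases j
        exacts [hv1 κ hκ, hv1 κ hκ, hv 3 κ hκ]
    · exact mk (by norm_num) _ ![1, 1, 1, 1, 1] rfl fun κ hκ j => by
        fin_cases j <;> exact hv1 κ hκ

theorem exists_abs_nonrandomTerm_le (hd : 5 ≤ d) {α : ℝ} (hα : 0 < α) (hα' : α ≤ 1 / 3) (i : ℕ) :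
    ∃ C : ℝ, 0 < C ∧ ∀ κ : ℝ, 0 ≤ κ → ∀ n n' : Site d,
      |nonrandomTerm d κ α i n n'| ≤ C * κ ^ i * modelKernel d (i * α) n n' := by
  have htriv : ∀ i, (∀ κ, nonrandomTerm d κ α i = fun _ _ => 0) → ∃ C : ℝ, 0 < C ∧
      ∀ κ : ℝ, 0 ≤ κ → ∀ n n' : Site d,
      |nonrandomTerm d κ α i n n'| ≤ C * κ ^ i * modelKernel d (i * α) n n' := by
    intro i h
    refine ⟨1, one_pos, fun κ hκ n n' => ?_⟩
    have := modelKernel_pos (i * α) n n'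
    rw [h κ, abs_zero]
    positivity
  match i with
  | 0 =>
    obtain ⟨C, hC, h⟩ := exists_abs_G0_le (d := d) (by omega)
    refine ⟨C, hC, fun κ _ n n' => ?_⟩
    unfold modelKernel
    simpa [nonrandomTerm] using h n n'
  | 4 =>
    obtain ⟨C, hC, h⟩ := exists_abs_G0WG0_le (d := d) hd hα (by linarith)
    exact ⟨C, hC, fun κ _ n n' => by simpa [nonrandomTerm] using h κ n n'⟩
  | 1 => exact htriv 1 fun _ => rfl
  | 2 => exact htriv 2 fun _ => rfl
  | 3 => exact htriv 3 fun _ => rfl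
  | k + 5 => exact htriv (k + 5) fun _ => rfl

theorem exists_eLpNorm_remainder_le (hd : 5 ≤ d) {α p : ℝ} (hα : 0 < α) (hα' : α ≤ 1 / 3)
    (hp : 1 ≤ p) {i : ℕ} (hi : i ≤ 5) : ∃ C : ℝ, 0 < C ∧ ∀ κ : ℝ, 0 ≤ κ → ∀ n n' : Site d,
      eLpNorm (remainder d κ α i n n') (ENNReal.ofReal p) (P d) ≤
        ENNReal.ofReal (C * κ ^ i * modelKernel d (i * α) n n') := by
  obtain ⟨C, hC, h⟩ := exists_abs_nonrandomTerm_le hd hα hα' i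
  obtain ⟨C', hC', h'⟩ := listBounded_randomTerms hd hα hα' hp hi
  refine ⟨C + C', by positivity, fun κ hκ n n' => ?_⟩
  have := modelKernel_pos (i * α) n n'
  rw [add_mul, add_mul]
  refine eLpNorm_coeFn_add_le hp _ _ (by positivity) (by positivity) ?_ (h' κ hκ n n').2
  have e := eLpNorm_const' (μ := P d) (p := ENNReal.ofReal p) (nonrandomTerm d κ α i n n')
    (by simp; linarith) ENNReal.ofReal_ne_top
  rw [measure_univ, ENNReal.one_rpow, mul_one, Real.enorm_eq_ofReal_abs] at e
  refine ((eLpNorm_congr_ae (Lp.coeFn_const (p := 2) (μ := P d) _)).trans e).le.trans ?_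
  exact ENNReal.ofReal_le_ofReal (h κ hκ n n')

theorem modelKernel_eq (hd : 2 ≤ d) (β : ℝ) (n n' : Site d) :
    modelKernel d β n n' = 1 / (min (size n) (size n') ^ β * size (n - n') ^ (d - 2)) := by
  unfold modelKernel
  rw [Real.rpow_neg (min_size_pos n n').le, Real.rpow_neg (size_pos _).le, one_div, mul_inv,
    ← Real.rpow_natCast, Nat.cast_sub hd]
  norm_num

theorem summable_D4 (hd : 5 ≤ d) {κ α : ℝ} (hα : 0 < α) (hα' : α ≤ 1 / 2) (n : Site d) :
    Summable fun m : Site d => v κ α m ^ 2 * G0t d n m ^ 4 := by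
  obtain ⟨C, -, h⟩ := exists_tsum_D4_le (d := d) hd hα hα'
  exact summable_of_tsum_ofReal_le (fun m => by positivity) (h κ n)

end Terms

end DecayingBernoulli

open DecayingBernoulli in
theorem theorem4p3 (d : ℕ) (hd : 5 ≤ d) (α : ℝ) (hα : 1 / 4 < α) (hα' : α ≤ 1 / 3)
    (p : ℝ) (hp : 1 ≤ p) :
    -- all the deterministic and random series below converge
    (∀ κ : ℝ, 0 ≤ κ →
      (∀ n : Site d, Summable fun m : Site d => v κ α m ^ 2 * G0t d n m ^ 4) ∧
      Mul3Summable (G0 d) (W d κ α) (G0 d) ∧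
      Mul3Summable (G0t d) (W d κ α) (G0 d) ∧
      Mul3Summable (G0 d) (W d κ α) (G0t d) ∧
      ∀ i ≤ 5, ∀ T ∈ randomTerms d κ α i, ∀ n n' : Site d, Summable (T.summand n n')) ∧
    -- the moment bound
    ∃ C : ℝ, 0 < C ∧ ∀ κ : ℝ, 0 ≤ κ → ∀ i ≤ 5, ∀ n n' : Site d,
      eLpNorm (remainder d κ α i n n') (ENNReal.ofReal p) (P d) ≤
        ENNReal.ofReal (C * κ ^ i *
          (1 / ((min (size n) (size n')) ^ ((i : ℝ) * α) * size (n - n') ^ (d - 2)))) := by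
  have hα0 : 0 < α := by linarith
  obtain ⟨C₁, -, h₁⟩ := exists_abs_G0_le (d := d) (by omega)
  obtain ⟨C₂, -, h₂⟩ := exists_abs_G0t_le (d := d) (by omega)
  have hG : ∀ n n', |G0 d n n'| ≤ max C₁ C₂ * size (n - n') ^ (-(d - 2 : ℝ)) := fun n n' =>
    (h₁ n n').trans (mul_le_mul_of_nonneg_right (le_max_left _ _)
      (Real.rpow_nonneg (size_pos _).le _))
  have hGt : ∀ n n', |G0t d n n'| ≤ max C₁ C₂ * size (n - n') ^ (-(d - 2 : ℝ)) := fun n n' =>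
    (h₂ n n').trans (mul_le_mul_of_nonneg_right (le_max_right _ _)
      (Real.rpow_nonneg (size_pos _).le _))
  refine ⟨fun κ hκ => ⟨summable_D4 hd hα0 (by linarith), mul3Summable_W hd hα0.le hG hG,
    mul3Summable_W hd hα0.le hGt hG, mul3Summable_W hd hα0.le hG hGt, fun i hi T hT n n' => ?_⟩, ?_⟩
  · obtain ⟨C, -, h⟩ := listBounded_randomTerms hd hα0 hα' hp hi
    exact (h κ hκ n n').1 T hT
  · choose C hC h using fun i : {i : ℕ // i ≤ 5} =>
      exists_eLpNorm_remainder_le hd hα0 hα' hp i.2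
    have : Finite {i : ℕ // i ≤ 5} := (Set.finite_Iic 5).to_subtype
    have := Fintype.ofFinite {i : ℕ // i ≤ 5}
    refine ⟨∑ i, C i, Finset.sum_pos (fun i _ => hC i) ⟨⟨0, by norm_num⟩, Finset.mem_univ _⟩,
      fun κ hκ i hi n n' => ?_⟩
    refine (h ⟨i, hi⟩ κ hκ n n').trans (ENNReal.ofReal_le_ofReal ?_)
    rw [← modelKernel_eq (by omega)]
    have := modelKernel_pos ((i : ℝ) * α) n n'
    gcongr
    exact Finset.single_le_sum (f := C) (fun i _ => (hC i).le) (Finset.mem_univ (⟨i, hi⟩ : {i : ℕ // i ≤ 5}))
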